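/- Let $\mathbb{S}^1=\mathbb{R}/2\pi\mathbb{Z}$ with angular coordinates $(\theta,\varphi)$ on $\mathbb{S}^1\times\mathbb{S}^1$, let $\mathbb{S}^3\subset\mathbb{R}^4$ be the unit sphere, and let $$f_0(\theta,\varphi)=\tfrac{1}{\sqrt2}(\cos\theta,\sin\theta,\cos\varphi,\sin\varphi)$$ be the Clifford torus. Sobolev and Lebesgue norms of functions on $\mathbb{S}^1\times\mathbb{S}^1$ are taken with respect to $d\theta\,d\varphi$. There exist universal constants $\varepsilon>0$ and $C>0$ such that the following holds. Let $f:\mathbb{S}^1\times\mathbb{S}^1\to\mathbb{S}^3$ be a smooth immersion whose induced metric is $g_f=df\otimes df=e^{2u}g_\tau$ for a function $u:\mathbb{S}^1\times\mathbb{S}^1\to\mathbb{R}$ and a constant-coefficient metric $$g_\tau=a\,d\theta^2+2b\,d\theta\,d\varphi+c\,d\varphi^2,\qquad a,b,c\in\mathbb{R},\quad ac-b^2=\tfrac14 .$$ Let $d\mu_f$ be the area measure of $g_f$, let $\mathrm{Area}=\mu_f(\mathbb{S}^1\times\mathbb{S}^1)$ be the area of the immersed surface, and let $H$ be its mean curvature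 vector in $\mathbb{S}^3$ (the $g_f$-trace of the second fundamental form). Assume that $f$ is normalized modulo rotations, that is, $$\int_{\mathbb{S}^1\times\mathbb{S}^1}|f-f_0|^2\,d\theta\,d\varphi\le\int_{\mathbb{S}^1\times\mathbb{S}^1}|Rf-f_0|^2\,d\theta\,d\varphi\qquad\text{for all }R\in SO(4),$$ and that $$\|f-f_0\|_{W^{2,2}}+\|u\|_{L^\infty}+\|H\|_{L^1(d\mu_f)}\le\varepsilon .$$ Then $u$ is smooth, $$\|f-f_0\|_{W^{2,2}}+|b|+|a-\tfrac12|+|c-\tfrac12|+|\mathrm{Area}-2\pi^2|\le C\|H\|_{L^2(d\mu_f)},$$ and $$\|u\|_{L^\infty}+\|u\|_{W^{1,2}}+\|u\|_{W^{2,1}}\le C\|H\|_{L^2(d\mu_f)} .$$ -/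

import Mathlib

open scoped Manifold ContDiff ENNReal

noncomputable section

namespace CliffordTorus

/-- Euclidean four-space, the ambient space of the round three-sphere. -/
abbrev E4 : Type := EuclideanSpace ℝ (Fin 4)

/-- The unit three-sphere. -/
abbrev S3 : Type := Metric.sphere (0 : E4) 1

/-- The torus `S¹ × S¹`, with Mathlib's product manifold structure. -/
abbrev Torus : Type := Circle × Circle

/-- `dim E4 = 3 + 1`; Mathlib's manifold structure on the unit sphere asks for this fact. -/
instance factFinrankE4 : Fact (Module.finrank ℝ E4 = 3 + 1) := ⟨by simp⟩

/-- A map on the torus, read in the angular coordinates `(θ, φ) ∈ ℝ × ℝ`; it is `2π`-periodic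
in both variables. -/
def angular {E : Type*} (g : Torus → E) : ℝ × ℝ → E :=
  fun p => g (Circle.exp p.1, Circle.exp p.2)

/-- A map into the three-sphere, read in angular coordinates as a map into `ℝ⁴`. -/
def angularE4 (f : Torus → S3) : ℝ × ℝ → E4 := angular fun x => (f x : E4)

/-- The Clifford torus `f₀(θ, φ) = (cos θ, sin θ, cos φ, sin φ) / √2`. -/
def clifford : ℝ × ℝ → E4 :=
  fun p => (√2)⁻¹ • !₂[Real.cos p.1, Real.sin p.1, Real.cos p.2, Real.sin p.2]

/-- The measure `dθ dφ` on one period square; its total mass is `4π²`. -/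
def flatMeasure : MeasureTheory.Measure (ℝ × ℝ) :=
  MeasureTheory.volume.restrict
    (Set.Ioc 0 (2 * Real.pi) ×ˢ Set.Ioc 0 (2 * Real.pi))

section Calculus

variable {E : Type*} [NormedAddCommGroup E] [NormedSpace ℝ E]

/-- The coordinate vectors `∂_θ = (1, 0)` and `∂_φ = (0, 1)`. -/
def coordVec (i : Fin 2) : ℝ × ℝ := if i = 0 then (1, 0) else (0, 1)

/-- The coordinate derivative `∂_i g`, where `0` stands for `θ` and `1` for `φ`. -/
def pderiv (i : Fin 2) (g : ℝ × ℝ → E) : ℝ × ℝ → E :=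
  fun p => fderiv ℝ g p (coordVec i)

/-- The Sobolev norm `‖g‖_{W^{k,p}}` on the torus with respect to `dθ dφ`: the sum of the
`L^p` norms of `∂_θ^i ∂_φ^j g` over `i + j ≤ k` (it is applied to smooth `g`). -/
def sobolevNorm (k : ℕ) (p : ℝ≥0∞) (g : ℝ × ℝ → E) : ℝ≥0∞ :=
  ∑ m ∈ Finset.range (k + 1), ∑ α ∈ Finset.HasAntidiagonal.antidiagonal m,
    MeasureTheory.eLpNorm ((pderiv 0)^[α.1] ((pderiv 1)^[α.2] g)) p flatMeasure

end Calculus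

/-- The matrix `⟨∂_i F, ∂_j F⟩` of the induced metric `dF ⊗ dF`. -/
def inducedMetric (F : ℝ × ℝ → E4) (p : ℝ × ℝ) : Matrix (Fin 2) (Fin 2) ℝ :=
  Matrix.of fun i j => inner ℝ (pderiv i F p) (pderiv j F p)

/-- The area measure `dμ_F = √(det g) dθ dφ` of the induced metric. -/
def areaMeasure (F : ℝ × ℝ → E4) : MeasureTheory.Measure (ℝ × ℝ) :=
  flatMeasure.withDensity fun p => ENNReal.ofReal (√(inducedMetric F p).det)

/-- The area of the immersed surface. -/
def area (F : ℝ × ℝ → E4) : ℝ := (areaMeasure F Set.univ).toReal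

/-- The normal space of the immersion in `T_{F p} S³`: the orthogonal complement of
`F p`, `∂_θ F p` and `∂_φ F p` in `ℝ⁴`. -/
def normalSpace (F : ℝ × ℝ → E4) (p : ℝ × ℝ) : Submodule ℝ E4 :=
  (Submodule.span ℝ {F p, pderiv 0 F p, pderiv 1 F p})ᗮ

/-- The second fundamental form in the three-sphere: the normal part of `∂_i ∂_j F`. -/
def secondForm (F : ℝ × ℝ → E4) (p : ℝ × ℝ) (i j : Fin 2) : E4 :=
  (normalSpace F p).starProjection (pderiv i (pderiv j F) p)

/-- The mean curvature vector in the three-sphere: the trace `g^{ij} A_{ij}` of the second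
fundamental form (the sum, not the mean, of the principal curvatures). -/
def meanCurvature (F : ℝ × ℝ → E4) (p : ℝ × ℝ) : E4 :=
  ∑ i : Fin 2, ∑ j : Fin 2, (inducedMetric F p)⁻¹ i j • secondForm F p i j

/-- The norm `‖H‖_{L^q(dμ_F)}` of the mean curvature. -/
def meanCurvatureNorm (q : ℝ≥0∞) (F : ℝ × ℝ → E4) : ℝ≥0∞ :=
  MeasureTheory.eLpNorm (meanCurvature F) q (areaMeasure F)

/-- The `L²` distance to the Clifford torus cannot be decreased by a rotation. -/
def RotationNormalized (F : ℝ × ℝ → E4) : Prop :=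
  ∀ R ∈ Matrix.specialOrthogonalGroup (Fin 4) ℝ,
    ∫ p, ‖F p - clifford p‖ ^ 2 ∂flatMeasure ≤
      ∫ p, ‖Matrix.toEuclideanCLM (𝕜 := ℝ) R (F p) - clifford p‖ ^ 2 ∂flatMeasure

end CliffordTorus

end

/-! Write f = f₀ + h in components and w = e^{2u} = 1 + z. Linearization at the Clifford torus
splits h into tangential components X₁, X₂, a component s normal to the torus inside the sphere, and
a radial component η. Up to quadratic errors: the sphere constraint kills η (`ConformalTorus.η_eq`);
the mean curvature gives the Jacobi equation, in which 2(Δ + 2)s is the normal part of wH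
(`ConformalTorus.jacobi`); the trace-free part of the conformality relation is a Cauchy–Riemann
system for (X₁, X₂) driven by s and the constants a − c and b (`ConformalTorus.A₁_add_s`,
`ConformalTorus.A₂_eq`); its trace determines z (`ConformalTorus.z_eq`).

The kernel of Δ + 2 is spanned by cos(θ ± φ) and sin(θ ± φ), the normal components of infinitesimal
rotations mixing the two circles. Since f is critical for the L² distance under rotations, the
kernel part of s is quadratic (`ConformalTorus.tint_kernelBasis`), and the integer spectrum of Δ
gives a gap elsewhere (`spectral_gap`). So s is controlled by H, then a − c and b by averaging, X₁
and X₂ by the Poincaré inequality, z by the trace, and Δh by the mean curvature equation. All errors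
carry a factor δ² and are absorbed (`ConformalTorus.Near.le_curv`).

The bounds on u need more. The Gauss equation expresses the flat Laplacian of z through the Hessian
determinants of the components of f (`ConformalTorus.lap_z`). These are only integrable, where
Calderón–Zygmund theory fails, but their determinant structure compensates, as in the theory of
Hardy spaces and compensated compactness. Here this is proved by duality
(`integral_abs_second_deriv_le`): testing ∂∂φ against the initial value of a bounded heat solution U
leaves a harmless term at time one and the space-time pairing of ∂∂U with Δφ. For Δφ = det D²h this
pairing is at most C∫|D²h|² (`hess_pairing_heat`, `hess_pairing`). The proof is a paraproduct
argument: at time τ, h is split into its heat flow and a rough remainder. The smooth part is handled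
by Carleson estimates (`carleson`), the remainder by writing determinants as divergences and by a
Hardy inequality (`hardy_rough`). Finally W^{2,1} embeds into the bounded functions (`abs_le_l1`),
and a scaling trick makes the bound linear in h, because each component of f₀ has zero Hessian
determinant (`ConformalTorus.Near.l1_D_D_z`). -/

noncomputable section
namespace CliffordTorus
open MeasureTheory

/-! ### Calculus in the algebra of periodic smooth functions -/

section InvariantFunctions

variable {E : Type*} [NormedAddCommGroup E] [NormedSpace ℝ E]

/-- The algebra of smooth functions on `E` invariant under translation by the vectors of `Γ`. -/
def smoothInv (Γ : Set E) : Subalgebra ℝ (E → ℝ) where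
  carrier := {g | ContDiff ℝ ∞ g ∧ ∀ γ ∈ Γ, ∀ p, g (p + γ) = g p}
  mul_mem' := fun {f g} hf hg =>
    ⟨hf.1.mul hg.1, fun γ hγ p => by simp [hf.2 γ hγ p, hg.2 γ hγ p]⟩
  add_mem' := fun {f g} hf hg =>
    ⟨hf.1.add hg.1, fun γ hγ p => by simp [hf.2 γ hγ p, hg.2 γ hγ p]⟩
  algebraMap_mem' := fun r => ⟨contDiff_const, fun _ _ _ => rfl⟩

variable {Γ : Set E}

lemma smooth (f : smoothInv Γ) : ContDiff ℝ ∞ f.1 := f.2.1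

lemma differentiable (f : smoothInv Γ) : Differentiable ℝ f.1 :=
  (smooth f).differentiable (by simp)

lemma continuous_coe (f : smoothInv Γ) : Continuous f.1 := (smooth f).continuous

@[simp] lemma add_val (f g : smoothInv Γ) (p : E) : (f + g).1 p = f.1 p + g.1 p := rfl
@[simp] lemma sub_val (f g : smoothInv Γ) (p : E) : (f - g).1 p = f.1 p - g.1 p := rfl
@[simp] lemma neg_val (f : smoothInv Γ) (p : E) : (-f).1 p = -f.1 p := rfl
@[simp] lemma mul_val (f g : smoothInv Γ) (p : E) : (f * g).1 p = f.1 p * g.1 p := rfl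
@[simp] lemma pow_val (f : smoothInv Γ) (n : ℕ) (p : E) : (f ^ n).1 p = f.1 p ^ n := rfl
@[simp] lemma smul_val (r : ℝ) (f : smoothInv Γ) (p : E) : (r • f).1 p = r * f.1 p := rfl
@[simp] lemma zero_val (p : E) : (0 : smoothInv Γ).1 p = 0 := rfl
@[simp] lemma one_val (p : E) : (1 : smoothInv Γ).1 p = 1 := rfl
@[simp] lemma two_val (p : E) : (2 : smoothInv Γ).1 p = 2 := rfl
@[simp] lemma algebraMap_val (r : ℝ) (p : E) : (algebraMap ℝ (smoothInv Γ) r).1 p = r := rfl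
@[simp] lemma sum_val {ι : Type*} (s : Finset ι) (f : ι → smoothInv Γ) (p : E) :
    (∑ i ∈ s, f i).1 p = ∑ i ∈ s, (f i).1 p := by
  classical
  induction s using Finset.induction_on with
  | empty => simp
  | insert a s ha ih => simp [Finset.sum_insert ha, ih]

lemma ext_val {f g : smoothInv Γ} (h : ∀ p, f.1 p = g.1 p) : f = g :=
  Subtype.ext (funext h)

/-- The directional derivative along `v`. -/
def D (v : E) : smoothInv Γ →ₗ[ℝ] smoothInv Γ where
  toFun f := ⟨fun p => fderiv ℝ f.1 p v, by
    refine ⟨((smooth f).fderiv_right (m := ∞) (by simp)).clm_apply contDiff_const,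
      fun γ hγ p => ?_⟩
    have h : (fun x => f.1 (x + γ)) = f.1 := funext (f.2.2 γ hγ)
    have := fderiv_comp_add_right (𝕜 := ℝ) (f := f.1) (x := p) γ
    rw [h] at this
    simp [this]⟩
  map_add' f g := ext_val fun p => by
    have := fderiv_add (differentiable f p) (differentiable g p)
    change fderiv ℝ (f.1 + g.1) p v = _
    rw [this]; rfl
  map_smul' r f := ext_val fun p => by
    change fderiv ℝ (r • f.1) p v = _
    rw [fderiv_const_smul (differentiable f p)]; rfl

lemma D_val (v : E) (f : smoothInv Γ) (p : E) : (D v f).1 p = fderiv ℝ f.1 p v := rfl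

lemma D_mul (v : E) (f g : smoothInv Γ) : D v (f * g) = D v f * g + f * D v g := ext_val fun p => by
  change fderiv ℝ (f.1 * g.1) p v = _
  rw [fderiv_mul (differentiable f p) (differentiable g p)]
  simp [D_val]; ring

@[simp] lemma D_algebraMap (v : E) (r : ℝ) : D v (algebraMap ℝ (smoothInv Γ) r) = 0 :=
  ext_val fun p => by
    change fderiv ℝ (fun _ => r) p v = 0
    simp

@[simp] lemma D_one (v : E) : D v (1 : smoothInv Γ) = 0 := by
  simpa using D_algebraMap (Γ := Γ) v 1

lemma D_sq (v : E) (f : smoothInv Γ) : D v (f ^ 2) = 2 * f * D v f := by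
  rw [pow_two, D_mul]; ring

lemma D_comm (v w : E) (f : smoothInv Γ) : D v (D w f) = D w (D v f) := ext_val fun p => by
  have h2 : IsSymmSndFDerivAt ℝ f.1 p :=
    ((smooth f).contDiffAt).isSymmSndFDerivAt
      (by simpa using (WithTop.coe_le_coe.2 le_top : ((2 : ℕ∞) : WithTop ℕ∞) ≤ ((⊤ : ℕ∞) : WithTop ℕ∞)))
  have hd : DifferentiableAt ℝ (fderiv ℝ f.1) p :=
    (((smooth f).fderiv_right (m := ∞) (by simp)).differentiable (by simp)) p
  have key : ∀ a b : E, (D a (D b f)).1 p = fderiv ℝ (fderiv ℝ f.1) p a b := fun a b => by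
    change fderiv ℝ (fun q => fderiv ℝ f.1 q b) p a = _
    rw [fderiv_clm_apply hd (by fun_prop)]
    simp
  rw [key, key]
  exact h2 v w

lemma D_add_vec (v w : E) (f : smoothInv Γ) : D (v + w) f = D v f + D w f :=
  ext_val fun p => by simp [D_val]

lemma D_smul_vec (r : ℝ) (v : E) (f : smoothInv Γ) : D (r • v) f = r • D v f :=
  ext_val fun p => by simp [D_val]

/-- The chain rule for a smooth function of one variable. -/
def compReal (φ : ℝ → ℝ) (hφ : ContDiff ℝ ∞ φ) (f : smoothInv Γ) : smoothInv Γ :=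
  ⟨fun p => φ (f.1 p), hφ.comp (smooth f), fun γ hγ p => by simp [f.2.2 γ hγ p]⟩

end InvariantFunctions

/-! ### Integration and integration by parts on the torus -/

/-- The period vectors of the torus. -/
def periods : Set (ℝ × ℝ) := {(2 * Real.pi, 0), (0, 2 * Real.pi)}

/-- Smooth functions on the torus in angular coordinates. -/
abbrev TF := smoothInv periods

lemma TF.periodic_fst (f : TF) (x y : ℝ) : f.1 (x + 2 * Real.pi, y) = f.1 (x, y) := by
  simpa using f.2.2 (2 * Real.pi, 0) (by simp [periods]) (x, y)

lemma TF.periodic_snd (f : TF) (x y : ℝ) : f.1 (x, y + 2 * Real.pi) = f.1 (x, y) := by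
  simpa using f.2.2 (0, 2 * Real.pi) (by simp [periods]) (x, y)

instance : IsFiniteMeasure flatMeasure := by
  unfold flatMeasure
  refine ⟨?_⟩
  rw [Measure.restrict_apply_univ, Measure.volume_eq_prod, Measure.prod_prod]
  simp [ENNReal.mul_lt_top]

lemma flatMeasure_eq_prod : flatMeasure =
    (volume.restrict (Set.Ioc 0 (2 * Real.pi))).prod (volume.restrict (Set.Ioc 0 (2 * Real.pi))) := by
  rw [flatMeasure, Measure.volume_eq_prod, Measure.prod_restrict]

lemma _root_.Continuous.integrable_flat {E : Type*} [NormedAddCommGroup E] {f : ℝ × ℝ → E}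
    (hf : Continuous f) :
    Integrable f flatMeasure := by
  have : IntegrableOn f (Set.Icc 0 (2 * Real.pi) ×ˢ Set.Icc 0 (2 * Real.pi)) :=
    hf.continuousOn.integrableOn_compact (isCompact_Icc.prod isCompact_Icc)
  exact this.mono_set (Set.prod_mono Set.Ioc_subset_Icc_self Set.Ioc_subset_Icc_self)

/-- Integration over the torus. -/
def tint : TF →ₗ[ℝ] ℝ where
  toFun f := ∫ p, f.1 p ∂flatMeasure
  map_add' f g := integral_add (continuous_coe f).integrable_flat (continuous_coe g).integrable_flat
  map_smul' r _ := integral_const_mul r _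

lemma tint_def (f : TF) : tint f = ∫ p, f.1 p ∂flatMeasure := rfl

lemma tint_mono {f g : TF} (h : ∀ p, f.1 p ≤ g.1 p) : tint f ≤ tint g :=
  integral_mono (continuous_coe f).integrable_flat (continuous_coe g).integrable_flat h

lemma tint_nonneg {f : TF} (h : ∀ p, 0 ≤ f.1 p) : 0 ≤ tint f := integral_nonneg h

lemma tint_sq_nonneg (f : TF) : 0 ≤ tint (f ^ 2) := tint_nonneg fun p => by simpa using sq_nonneg _

lemma tint_algebraMap (r : ℝ) : tint (algebraMap ℝ TF r) = 4 * Real.pi ^ 2 * r := by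
  simp only [tint_def, algebraMap_val]
  rw [integral_const, flatMeasure_eq_prod]
  simp only [Measure.real, ← Set.univ_prod_univ, Measure.prod_prod, Measure.restrict_apply_univ,
    Real.volume_Ioc, sub_zero, ENNReal.toReal_mul, smul_eq_mul,
    ENNReal.toReal_ofReal (show 0 ≤ 2 * Real.pi by positivity)]
  ring

lemma integral_flat {E : Type*} [NormedAddCommGroup E] [NormedSpace ℝ E] {f : ℝ × ℝ → E}
    (hf : Continuous f) : ∫ p, f p ∂flatMeasure =
      ∫ x in (0:ℝ)..(2 * Real.pi), ∫ y in (0:ℝ)..(2 * Real.pi), f (x, y) := by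
  have h := hf.integrable_flat
  rw [flatMeasure_eq_prod] at h ⊢
  rw [integral_prod _ h, intervalIntegral.integral_of_le (by positivity)]
  simp_rw [intervalIntegral.integral_of_le (show (0:ℝ) ≤ 2 * Real.pi by positivity)]

lemma integral_flat_symm {E : Type*} [NormedAddCommGroup E] [NormedSpace ℝ E] {f : ℝ × ℝ → E}
    (hf : Continuous f) : ∫ p, f p ∂flatMeasure =
      ∫ y in (0:ℝ)..(2 * Real.pi), ∫ x in (0:ℝ)..(2 * Real.pi), f (x, y) := by
  have h := hf.integrable_flat
  rw [flatMeasure_eq_prod] at h ⊢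
  rw [integral_prod_symm _ h, intervalIntegral.integral_of_le (by positivity)]
  simp_rw [intervalIntegral.integral_of_le (show (0:ℝ) ≤ 2 * Real.pi by positivity)]

lemma hasDerivAt_fst (f : TF) (x y : ℝ) :
    HasDerivAt (fun t => f.1 (t, y)) ((D (1, 0) f).1 (x, y)) x := by
  have h1 := (differentiable f (x, y)).hasFDerivAt
  have h2 : HasDerivAt (fun t : ℝ => (t, y)) (1, 0) x :=
    (hasDerivAt_id x).prodMk (hasDerivAt_const x y)
  exact h1.comp_hasDerivAt x h2

lemma hasDerivAt_snd (f : TF) (x y : ℝ) :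
    HasDerivAt (fun t => f.1 (x, t)) ((D (0, 1) f).1 (x, y)) y := by
  have h1 := (differentiable f (x, y)).hasFDerivAt
  have h2 : HasDerivAt (fun t : ℝ => (x, t)) (0, 1) y :=
    (hasDerivAt_const y x).prodMk (hasDerivAt_id y)
  exact h1.comp_hasDerivAt y h2

lemma tint_D_fst (f : TF) : tint (D (1, 0) f) = 0 := by
  rw [tint_def, integral_flat_symm (continuous_coe _)]
  have : ∀ y, ∫ x in (0:ℝ)..(2 * Real.pi), (D (1, 0) f).1 (x, y) = 0 := fun y => by
    rw [intervalIntegral.integral_eq_sub_of_hasDerivAt (fun x _ => hasDerivAt_fst f x y)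
      (((continuous_coe (D (1, 0) f)).comp (by fun_prop : Continuous fun x : ℝ => (x, y))).intervalIntegrable _ _)]
    have := TF.periodic_fst f 0 y
    simp at this
    simp [this]
  simp [this]

lemma tint_D_snd (f : TF) : tint (D (0, 1) f) = 0 := by
  rw [tint_def, integral_flat (continuous_coe _)]
  have : ∀ x, ∫ y in (0:ℝ)..(2 * Real.pi), (D (0, 1) f).1 (x, y) = 0 := fun x => by
    rw [intervalIntegral.integral_eq_sub_of_hasDerivAt (fun y _ => hasDerivAt_snd f x y)
      (((continuous_coe (D (0, 1) f)).comp (by fun_prop : Continuous fun y : ℝ => (x, y))).intervalIntegrable _ _)]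
    have := TF.periodic_snd f x 0
    simp at this
    simp [this]
  simp [this]

@[simp] lemma tint_D (v : ℝ × ℝ) (f : TF) : tint (D v f) = 0 := by
  have : v = v.1 • ((1, 0) : ℝ × ℝ) + v.2 • ((0, 1) : ℝ × ℝ) := by ext <;> simp
  rw [this, D_add_vec, D_smul_vec, D_smul_vec, map_add, map_smul, map_smul, tint_D_fst, tint_D_snd]
  simp

lemma tint_D_mul (v : ℝ × ℝ) (f g : TF) : tint (D v f * g) = -tint (f * D v g) := by
  have := tint_D v (f * g)
  rw [D_mul, map_add] at this
  linarith

/-- Cauchy–Schwarz on the torus. -/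
lemma tint_mul_sq_le (f g : TF) : tint (f * g) ^ 2 ≤ tint (f ^ 2) * tint (g ^ 2) := by
  have h : ∀ t : ℝ, 0 ≤ tint (g ^ 2) * (t * t) + 2 * tint (f * g) * t + tint (f ^ 2) := fun t => by
    have : (f + t • g) ^ 2 = (t * t) • g ^ 2 + (2 * t) • (f * g) + f ^ 2 :=
      ext_val fun p => by simp; ring
    have h2 := tint_sq_nonneg (f + t • g)
    rw [this, map_add, map_add, map_smul, map_smul] at h2
    simp only [smul_eq_mul] at h2
    linarith
  have := discrim_le_zero h
  simp only [discrim] at this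
  nlinarith

end CliffordTorus
end

noncomputable section
namespace CliffordTorus
open MeasureTheory

/-! ### Full iterated gradients and Bochner identities -/

section Words

variable {E : Type*} [NormedAddCommGroup E] [NormedSpace ℝ E] {Γ : Set E}

/-- The sum over words `w` of length `j` of the products `D_w G * D_w K`, where `D_w` is the
iterated derivative along the frame vectors. -/
def bi (e : Fin 2 → E) : ℕ → smoothInv Γ → smoothInv Γ → smoothInv Γ
  | 0, G, K => G * K
  | j + 1, G, K => bi e j (D (e 0) G) (D (e 0) K) + bi e j (D (e 1) G) (D (e 1) K)

/-- The sum of squares operator of the frame. -/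
def lap (e : Fin 2 → E) : smoothInv Γ →ₗ[ℝ] smoothInv Γ :=
  D (e 0) ∘ₗ D (e 0) + D (e 1) ∘ₗ D (e 1)

lemma lap_apply (e : Fin 2 → E) (G : smoothInv Γ) :
    lap e G = D (e 0) (D (e 0) G) + D (e 1) (D (e 1) G) := rfl

lemma D_lap (e : Fin 2 → E) (v : E) (G : smoothInv Γ) : D v (lap e G) = lap e (D v G) := by
  simp only [lap_apply, map_add]
  rw [D_comm v, D_comm v (e 0) G, D_comm v, D_comm v (e 1) G]

lemma lap_mul (e : Fin 2 → E) (G K : smoothInv Γ) : lap e (G * K) =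
    lap e G * K + G * lap e K + 2 * (D (e 0) G * D (e 0) K + D (e 1) G * D (e 1) K) := by
  simp only [lap_apply, D_mul, map_add]; ring

lemma bi_add_right (e : Fin 2 → E) (j : ℕ) : ∀ G K K' : smoothInv Γ,
    bi e j G (K + K') = bi e j G K + bi e j G K' := by
  induction j with
  | zero => intro G K K'; simp only [bi]; ring
  | succ j ih => intro G K K'; simp only [bi, map_add, ih]; ring

lemma bi_comm (e : Fin 2 → E) (j : ℕ) : ∀ G K : smoothInv Γ, bi e j G K = bi e j K G := by
  induction j with
  | zero => intro G K; simp only [bi]; ring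
  | succ j ih => intro G K; simp only [bi, ih (D _ G)]

lemma D_bi (e : Fin 2 → E) (v : E) (j : ℕ) : ∀ G K : smoothInv Γ,
    D v (bi e j G K) = bi e j (D v G) K + bi e j G (D v K) := by
  induction j with
  | zero => intro G K; simp only [bi, D_mul]
  | succ j ih =>
    intro G K
    simp only [bi, map_add, ih]
    rw [D_comm v (e 0) G, D_comm v (e 1) G, D_comm v (e 0) K, D_comm v (e 1) K]
    ring

lemma D_bi_self (e : Fin 2 → E) (v : E) (j : ℕ) (G : smoothInv Γ) :
    D v (bi e j G G) = 2 * bi e j G (D v G) := by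
  rw [D_bi, bi_comm e j (D v G)]; ring

/-- The Bochner identity for the flat operator: the frame derivatives commute, so no curvature term
appears, and the last summand is the dissipation used in all energy estimates. -/
lemma lap_bi_self (e : Fin 2 → E) (j : ℕ) (G : smoothInv Γ) :
    lap e (bi e j G G) = 2 * bi e j G (lap e G) + 2 * bi e (j + 1) G G := by
  have h : ∀ v : E, D v (D v (bi e j G G)) =
      2 * bi e j G (D v (D v G)) + 2 * bi e j (D v G) (D v G) := fun v => by
    rw [D_bi, map_add, D_bi, D_bi, bi_comm e j (D v (D v G))]; ring
  simp only [lap_apply, h, bi, bi_add_right]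
  ring

lemma bi_self_nonneg (e : Fin 2 → E) (j : ℕ) : ∀ (G : smoothInv Γ) (p : E),
    0 ≤ (bi e j G G).1 p := by
  induction j with
  | zero => intro G p; simpa [bi] using mul_self_nonneg _
  | succ j ih => intro G p; exact add_nonneg (ih _ _) (ih _ _)

lemma bi_sq_le (e : Fin 2 → E) (j : ℕ) : ∀ (G K : smoothInv Γ) (p : E),
    (bi e j G K).1 p ^ 2 ≤ (bi e j G G).1 p * (bi e j K K).1 p := by
  induction j with
  | zero => intro G K p; simp only [bi, mul_val]; exact le_of_eq (by ring)
  | succ j ih =>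
    intro G K p
    have h0 := ih (D (e 0) G) (D (e 0) K) p
    have h1 := ih (D (e 1) G) (D (e 1) K) p
    have a0 := bi_self_nonneg e j (D (e 0) G) p
    have a1 := bi_self_nonneg e j (D (e 1) G) p
    have b0 := bi_self_nonneg e j (D (e 0) K) p
    have b1 := bi_self_nonneg e j (D (e 1) K) p
    simp only [bi, add_val]
    generalize (bi e j (D (e 0) G) (D (e 0) K)).1 p = x at *
    generalize (bi e j (D (e 1) G) (D (e 1) K)).1 p = y at *
    generalize (bi e j (D (e 0) G) (D (e 0) G)).1 p = a at *
    generalize (bi e j (D (e 1) G) (D (e 1) G)).1 p = b at *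
    generalize (bi e j (D (e 0) K) (D (e 0) K)).1 p = c at *
    generalize (bi e j (D (e 1) K) (D (e 1) K)).1 p = d at *
    -- The cross term of the two Cauchy–Schwarz inequalities is handled by 2xy ≤ ad + bc, from (xy)²
    -- ≤ (ad)(bc).
    have h3 : (2 * (x * y)) ^ 2 ≤ (a * d + b * c) ^ 2 := by
      have : (x * y) ^ 2 ≤ (a * c) * (b * d) := by
        rw [mul_pow]; exact mul_le_mul h0 h1 (sq_nonneg _) (mul_nonneg a0 b0)
      nlinarith [sq_nonneg (a * d - b * c)]
    have h4 := (abs_le.1 (abs_le_of_sq_le_sq h3 (by positivity))).2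
    nlinarith

end Words

/-! ### Functions on space-time and their time slices -/

/-- The period vectors of space-time `ℝ × (ℝ × ℝ)`. -/
def stPeriods : Set (ℝ × (ℝ × ℝ)) := {(0, (2 * Real.pi, 0)), (0, (0, 2 * Real.pi))}

/-- Smooth functions of time and of a point of the torus. -/
abbrev SF := smoothInv stPeriods

/-- The restriction of a space-time function to a time. -/
def slice (τ : ℝ) : SF →ₐ[ℝ] TF where
  toFun U := ⟨fun p => U.1 (τ, p), (smooth U).comp (by fun_prop), by
    intro γ hγ p
    have : ((τ, p + γ) : ℝ × (ℝ × ℝ)) = (τ, p) + (0, γ) := by simp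
    change U.1 (τ, p + γ) = U.1 (τ, p)
    rw [this]
    apply U.2.2
    rcases hγ with rfl | rfl <;> simp [stPeriods]⟩
  map_one' := rfl
  map_mul' _ _ := rfl
  map_zero' := rfl
  map_add' _ _ := rfl
  commutes' _ := rfl

lemma slice_val (τ : ℝ) (U : SF) (p : ℝ × ℝ) : (slice τ U).1 p = U.1 (τ, p) := rfl

/-- A function on the torus as a time-independent function. -/
def static : TF →ₐ[ℝ] SF where
  toFun f := ⟨fun q => f.1 q.2, (smooth f).comp (by fun_prop), by
    rintro γ (rfl | rfl) p <;> apply f.2.2 <;> simp [periods]⟩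
  map_one' := rfl
  map_mul' _ _ := rfl
  map_zero' := rfl
  map_add' _ _ := rfl
  commutes' _ := rfl

lemma static_val (f : TF) (q : ℝ × (ℝ × ℝ)) : (static f).1 q = f.1 q.2 := rfl

@[simp] lemma slice_static (τ : ℝ) (f : TF) : slice τ (static f) = f := rfl

/-- The time coordinate. -/
def tm : SF := ⟨Prod.fst, contDiff_fst, by rintro γ (rfl | rfl) p <;> simp⟩

@[simp] lemma slice_tm (τ : ℝ) : slice τ tm = algebraMap ℝ TF τ := rfl
@[simp] lemma tm_val (q : ℝ × (ℝ × ℝ)) : tm.1 q = q.1 := rfl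

/-- The time derivative. -/
abbrev Dt : SF →ₗ[ℝ] SF := D (1, 0)

/-- A frame of vectors on the torus as a frame of spatial vectors in space-time. -/
def sp (e : Fin 2 → ℝ × ℝ) : Fin 2 → ℝ × (ℝ × ℝ) := fun i => (0, e i)

lemma slice_D (τ : ℝ) (v : ℝ × ℝ) (U : SF) : slice τ (D (0, v) U) = D v (slice τ U) :=
  ext_val fun p => by
    have h1 := (differentiable U (τ, p)).hasFDerivAt
    have h2 : HasFDerivAt (fun x : ℝ × ℝ => (τ, x))
      (ContinuousLinearMap.inr ℝ ℝ (ℝ × ℝ)) p := hasFDerivAt_prodMk_right τ p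
    have := (h1.comp p h2).fderiv
    rw [slice_val, D_val, D_val]
    change _ = fderiv ℝ (U.1 ∘ fun x => (τ, x)) p v
    rw [this]; simp

lemma D_static (v : ℝ × ℝ) (f : TF) : D (0, v) (static f) = static (D v f) :=
  ext_val fun q => by
    have := congrArg (fun g : TF => g.1 q.2) (slice_D q.1 v (static f))
    exact this

lemma hasDerivAt_time (U : SF) (τ : ℝ) (p : ℝ × ℝ) :
    HasDerivAt (fun s => U.1 (s, p)) ((Dt U).1 (τ, p)) τ := by
  have h1 := (differentiable U (τ, p)).hasFDerivAt
  have h2 : HasDerivAt (fun t : ℝ => (t, p)) (1, 0) τ :=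
    (hasDerivAt_id τ).prodMk (hasDerivAt_const τ p)
  exact h1.comp_hasDerivAt τ h2

@[simp] lemma Dt_static (f : TF) : Dt (static f) = 0 := ext_val fun q => by
  have := (hasDerivAt_time (static f) q.1 q.2).unique (hasDerivAt_const q.1 (f.1 q.2))
  simpa using this

@[simp] lemma Dt_tm : Dt tm = 1 := ext_val fun q =>
  (hasDerivAt_time tm q.1 q.2).unique (hasDerivAt_id q.1)

@[simp] lemma D_tm (v : ℝ × ℝ) : D (0, v) tm = 0 := ext_val fun q => by
  change (slice q.1 (D (0, v) tm)).1 q.2 = 0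
  rw [slice_D]; simp

lemma D_pow_succ {E : Type*} [NormedAddCommGroup E] [NormedSpace ℝ E] {Γ : Set E} (v : E)
    (f : smoothInv Γ) (n : ℕ) : D v (f ^ (n + 1)) = ((n + 1 : ℕ) : ℝ) • (f ^ n * D v f) := by
  induction n with
  | zero => simp
  | succ n ih =>
    rw [pow_succ, D_mul, ih]
    refine ext_val fun p => ?_
    simp; ring

lemma slice_lap (e : Fin 2 → ℝ × ℝ) (τ : ℝ) (U : SF) :
    slice τ (lap (sp e) U) = lap e (slice τ U) := by
  simp only [lap_apply, sp, map_add, slice_D]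

lemma slice_bi (e : Fin 2 → ℝ × ℝ) (τ : ℝ) (j : ℕ) : ∀ U V : SF,
    slice τ (bi (sp e) j U V) = bi e j (slice τ U) (slice τ V) := by
  induction j with
  | zero => intro U V; simp [bi]
  | succ j ih => intro U V; simp only [bi, map_add, ih]; simp only [sp, slice_D]

@[simp] lemma tint_lap (e : Fin 2 → ℝ × ℝ) (f : TF) : tint (lap e f) = 0 := by
  simp [lap_apply]

lemma tint_lap_mul (e : Fin 2 → ℝ × ℝ) (f g : TF) : tint (lap e f * g) = tint (f * lap e g) := by
  have h : ∀ v, tint (D v (D v f) * g) = tint (f * D v (D v g)) := fun v => by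
    rw [tint_D_mul, tint_D_mul, neg_neg]
  simp only [lap_apply, add_mul, mul_add, map_add, h]

lemma hasDerivAt_tint_slice (U : SF) (τ : ℝ) :
    HasDerivAt (fun s => tint (slice s U)) (tint (slice τ (Dt U))) τ := by
  have hK : IsCompact (Set.Icc (τ - 1) (τ + 1) ×ˢ
      (Set.Icc 0 (2 * Real.pi) ×ˢ Set.Icc 0 (2 * Real.pi)) : Set (ℝ × (ℝ × ℝ))) :=
    isCompact_Icc.prod (isCompact_Icc.prod isCompact_Icc)
  obtain ⟨C, hC⟩ := hK.exists_bound_of_continuousOn (continuous_coe (Dt U)).continuousOn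
  refine (hasDerivAt_integral_of_dominated_loc_of_deriv_le
    (F := fun s p => U.1 (s, p)) (F' := fun s p => (Dt U).1 (s, p)) (bound := fun _ => C)
    (s := Set.Icc (τ - 1) (τ + 1)) (Icc_mem_nhds (by linarith) (by linarith)) ?_ ?_ ?_ ?_ ?_ ?_).2
  · exact Filter.Eventually.of_forall fun s =>
      (continuous_coe (slice s U)).integrable_flat.aestronglyMeasurable
  · exact (continuous_coe (slice τ U)).integrable_flat
  · exact (continuous_coe (slice τ (Dt U))).integrable_flat.aestronglyMeasurable
  · unfold flatMeasure
    filter_upwards [ae_restrict_mem (measurableSet_Ioc.prod measurableSet_Ioc)] with p hp s hs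
    exact hC (s, p) ⟨hs, ⟨Set.Ioc_subset_Icc_self hp.1, Set.Ioc_subset_Icc_self hp.2⟩⟩
  · exact integrable_const C
  · exact Filter.Eventually.of_forall fun p s _ => hasDerivAt_time U s p

lemma continuous_tint_slice (U : SF) : Continuous fun τ => tint (slice τ U) :=
  continuous_iff_continuousAt.2 fun τ => (hasDerivAt_tint_slice U τ).continuousAt

/-- The integral over the torus and the times in `[a, 1]`. -/
def stint (a : ℝ) : SF →ₗ[ℝ] ℝ where
  toFun U := ∫ τ in a..1, tint (slice τ U)
  map_add' U V := by
    simp only [map_add]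
    exact intervalIntegral.integral_add ((continuous_tint_slice U).intervalIntegrable _ _)
      ((continuous_tint_slice V).intervalIntegrable _ _)
  map_smul' r U := by
    simp only [map_smul, smul_eq_mul, RingHom.id_apply]
    exact intervalIntegral.integral_const_mul _ _

lemma stint_def (a : ℝ) (U : SF) : stint a U = ∫ τ in a..1, tint (slice τ U) := rfl

lemma stint_mono {a : ℝ} (ha : a ≤ 1) {U V : SF}
    (h : ∀ τ ∈ Set.Icc a 1, tint (slice τ U) ≤ tint (slice τ V)) : stint a U ≤ stint a V :=
  intervalIntegral.integral_mono_on ha ((continuous_tint_slice U).intervalIntegrable _ _)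
    ((continuous_tint_slice V).intervalIntegrable _ _) h

lemma stint_mono' {a : ℝ} (ha : a ≤ 1) {U V : SF}
    (h : ∀ τ ∈ Set.Icc a 1, ∀ p, U.1 (τ, p) ≤ V.1 (τ, p)) : stint a U ≤ stint a V :=
  stint_mono ha fun τ hτ => tint_mono (h τ hτ)

lemma stint_Dt (a : ℝ) (U : SF) : stint a (Dt U) = tint (slice 1 U) - tint (slice a U) :=
  intervalIntegral.integral_eq_sub_of_hasDerivAt (fun τ _ => hasDerivAt_tint_slice U τ)
    ((continuous_tint_slice _).intervalIntegrable _ _)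

@[simp] lemma stint_D (a : ℝ) (v : ℝ × ℝ) (U : SF) : stint a (D (0, v) U) = 0 := by
  simp [stint_def, slice_D]

@[simp] lemma stint_lap (a : ℝ) (e : Fin 2 → ℝ × ℝ) (U : SF) : stint a (lap (sp e) U) = 0 := by
  simp [stint_def, slice_lap]

lemma stint_D_mul (a : ℝ) (v : ℝ × ℝ) (U V : SF) :
    stint a (D (0, v) U * V) = -stint a (U * D (0, v) V) := by
  have := stint_D a v (U * V)
  rw [D_mul, map_add] at this
  linarith

lemma stint_le_stint {a : ℝ} (h0 : 0 ≤ a) (h1 : a ≤ 1) {U : SF}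
    (h : ∀ τ ∈ Set.Icc (0:ℝ) 1, ∀ p, 0 ≤ U.1 (τ, p)) : stint a U ≤ stint 0 U := by
  have := intervalIntegral.integral_add_adjacent_intervals (μ := volume)
    ((continuous_tint_slice U).intervalIntegrable 0 a)
    ((continuous_tint_slice U).intervalIntegrable a 1)
  rw [stint_def, stint_def, ← this]
  have h2 : 0 ≤ ∫ τ in (0:ℝ)..a, tint (slice τ U) :=
    intervalIntegral.integral_nonneg h0 fun τ hτ =>
      tint_nonneg (h τ ⟨hτ.1, hτ.2.trans h1⟩)
  linarith

/-! ### The maximum principle -/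

/-- A positive second derivative would make the maximum point a local minimum too; then f is locally
constant and its second derivative vanishes. -/
lemma deriv_deriv_nonpos_of_max {f f' : ℝ → ℝ} {f'' x : ℝ} (h1 : ∀ y, HasDerivAt f (f' y) y)
    (h2 : HasDerivAt f' f'' x) (hmax : ∀ y, f y ≤ f x) : f'' ≤ 0 := by
  by_contra! hpos
  have hd : deriv f = f' := funext fun y => (h1 y).deriv
  have hl : IsLocalMax f x := Filter.Eventually.of_forall hmax
  have hmin : IsLocalMin f x := isLocalMin_of_deriv_deriv_pos (by rw [hd, h2.deriv]; exact hpos)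
    hl.deriv_eq_zero (h1 x).continuousAt
  have heq : f =ᶠ[nhds x] fun _ => f x := by
    filter_upwards [hl, hmin] with y a b using le_antisymm a b
  have h3 : deriv (deriv f) x = 0 := by
    have := heq.deriv.deriv_eq
    simpa using this
  rw [hd, h2.deriv] at h3
  linarith

lemma D_D_nonpos_of_max (f : TF) (v p : ℝ × ℝ) (hmax : ∀ q, f.1 q ≤ f.1 p) :
    (D v (D v f)).1 p ≤ 0 := by
  have key : ∀ (g : TF) (t : ℝ), HasDerivAt (fun t : ℝ => g.1 (p + t • v))
      ((D v g).1 (p + t • v)) t := fun g t => by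
    have h1 := (differentiable g (p + t • v)).hasFDerivAt
    have h2 : HasDerivAt (fun t : ℝ => p + t • v) v t := by
      simpa using ((hasDerivAt_id t).smul_const v).const_add p
    exact h1.comp_hasDerivAt t h2
  have := deriv_deriv_nonpos_of_max (f := fun t : ℝ => f.1 (p + t • v)) (x := 0)
    (fun t => key f t) (key (D v f) 0) (by simpa using fun y => hmax _)
  simpa using this

/-- Compactness is available only on the period square; one representative q serves all periodic
functions at once. -/
lemma TF.exists_mem_square (p : ℝ × ℝ) :
    ∃ q ∈ Set.Icc 0 (2 * Real.pi) ×ˢ Set.Icc 0 (2 * Real.pi), ∀ (g : TF), g.1 q = g.1 p := by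
  have h2 : (0:ℝ) < 2 * Real.pi := by positivity
  have H1 : ∀ (g : TF) (y : ℝ), Function.Periodic (fun x => g.1 (x, y)) (2 * Real.pi) :=
    fun g y x => TF.periodic_fst g x y
  have H2 : ∀ (g : TF) (x : ℝ), Function.Periodic (fun y => g.1 (x, y)) (2 * Real.pi) :=
    fun g x y => TF.periodic_snd g x y
  refine ⟨(toIcoMod h2 0 p.1, toIcoMod h2 0 p.2), ⟨?_, ?_⟩, fun g => ?_⟩
  · simpa using Set.Ico_subset_Icc_self (toIcoMod_mem_Ico h2 0 p.1)
  · simpa using Set.Ico_subset_Icc_self (toIcoMod_mem_Ico h2 0 p.2)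
  · have a := (H1 g (toIcoMod h2 0 p.2)).sub_zsmul_eq (x := p.1) (toIcoDiv h2 0 p.1)
    have b := (H2 g p.1).sub_zsmul_eq (x := p.2) (toIcoDiv h2 0 p.2)
    rw [self_sub_toIcoDiv_zsmul] at a b
    rw [a, b]

/-- The weak maximum principle for the heat operator of a frame. -/
lemma max_principle (e : Fin 2 → ℝ × ℝ) (U : SF) (M : ℝ)
    (hU : ∀ τ ∈ Set.Icc (0:ℝ) 1, ∀ p, (Dt U).1 (τ, p) ≤ (lap (sp e) U).1 (τ, p))
    (h0 : ∀ p, U.1 (0, p) ≤ M) : ∀ τ ∈ Set.Icc (0:ℝ) 1, ∀ p, U.1 (τ, p) ≤ M := by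
  -- Subtracting ετ makes the differential inequality strict, which excludes a maximum at a positive
  -- time.
  have main : ∀ ε > 0, ∀ τ ∈ Set.Icc (0:ℝ) 1, ∀ p, U.1 (τ, p) ≤ M + ε * τ := by
    intro ε hε τ hτ p
    have hK : IsCompact (Set.Icc (0:ℝ) 1 ×ˢ
      (Set.Icc 0 (2 * Real.pi) ×ˢ Set.Icc 0 (2 * Real.pi)) : Set (ℝ × (ℝ × ℝ))) :=
      isCompact_Icc.prod (isCompact_Icc.prod isCompact_Icc)
    have hpi := Real.pi_pos
    obtain ⟨⟨τ₀, p₀⟩, hq, hmax⟩ := hK.exists_isMaxOn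
      ⟨(0, (0, 0)), by simp [hpi.le]⟩
      (f := fun q => U.1 q - ε * q.1)
      ((continuous_coe U).sub (by fun_prop)).continuousOn
    have hmax' : ∀ τ ∈ Set.Icc (0:ℝ) 1, ∀ p, U.1 (τ, p) - ε * τ ≤ U.1 (τ₀, p₀) - ε * τ₀ := by
      intro τ hτ p
      obtain ⟨q, hq, hqp⟩ := TF.exists_mem_square p
      have := hmax (show (τ, q) ∈ _ from ⟨hτ, hq⟩)
      have h3 := hqp (slice τ U)
      rw [slice_val, slice_val] at h3
      simp only [Set.mem_ofPred_eq] at this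
      rw [← h3]; exact this
    have hτ₀ : τ₀ ∈ Set.Icc (0:ℝ) 1 := hq.1
    rcases eq_or_lt_of_le hτ₀.1 with h | h
    · have := hmax' τ hτ p
      have h4 := h0 p₀
      rw [← h] at this
      linarith
    · exfalso
      have hl : (lap (sp e) U).1 (τ₀, p₀) ≤ 0 := by
        have hm : ∀ q, (slice τ₀ U).1 q ≤ (slice τ₀ U).1 p₀ := fun q => by
          have := hmax' τ₀ hτ₀ q
          simpa [slice_val] using this
        rw [← slice_val, slice_lap, lap_apply, add_val]
        have a := D_D_nonpos_of_max _ (e 0) p₀ hm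
        have b := D_D_nonpos_of_max _ (e 1) p₀ hm
        linarith
      -- The maximum may sit at the final time, so only difference quotients from the left are used.
      have hd : ε ≤ (Dt U).1 (τ₀, p₀) := by
        have hder := (hasDerivAt_time U τ₀ p₀).hasDerivWithinAt (s := Set.Iio τ₀)
        rw [hasDerivWithinAt_iff_tendsto_slope' (by simp)] at hder
        refine ge_of_tendsto hder ?_
        filter_upwards [Ioo_mem_nhdsLT h] with s hs
        have := hmax' s ⟨hs.1.le, hs.2.le.trans hτ₀.2⟩ p₀
        rw [slope_def_field, le_div_iff_of_neg (by linarith [hs.2])]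
        nlinarith
      linarith [hU τ₀ hτ₀ p₀]
  intro τ hτ p
  refine le_of_forall_pos_le_add fun ε hε => ?_
  have := main ε hε τ hτ p
  nlinarith [hτ.1, hτ.2]

/-! ### Solutions of the heat equation -/

/-- The heat equation of a frame. -/
def IsHeat (e : Fin 2 → ℝ × ℝ) (U : SF) : Prop := Dt U = lap (sp e) U

variable {e : Fin 2 → ℝ × ℝ}

lemma IsHeat.D {U : SF} (h : IsHeat e U) (v : ℝ × ℝ) : IsHeat e (D (0, v) U) := by
  unfold IsHeat at *
  rw [D_comm, h, D_lap]

/-- Each squared gradient is a subsolution, with the next squared gradient as dissipation. This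
hierarchy yields both the pointwise bounds and the energy bounds. -/
lemma IsHeat.Dt_bi {U : SF} (h : IsHeat e U) (j : ℕ) :
    Dt (bi (sp e) j U U) = lap (sp e) (bi (sp e) j U U) - 2 * bi (sp e) (j + 1) U U := by
  rw [D_bi_self, h, lap_bi_self]; ring

lemma lap_tm_mul (j : ℕ) (U : SF) : lap (sp e) (tm ^ j * U) = tm ^ j * lap (sp e) U := by
  have h : ∀ i, D (sp e i) (tm ^ j) = 0 := fun i => by
    cases j with
    | zero => simp
    | succ j => rw [D_pow_succ]; simp [sp]
  simp [lap_apply, D_mul, h]; ring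

/-- Derivative bounds for bounded solutions of the heat equation. -/
lemma IsHeat.bound {U : SF} (h : IsHeat e U) (h0 : ∀ p, |U.1 (0, p)| ≤ 1) {τ : ℝ}
    (hτ : τ ∈ Set.Icc (0:ℝ) 1) (p : ℝ × ℝ) :
    (bi (sp e) 0 U U).1 (τ, p) + 2 * (τ * (bi (sp e) 1 U U).1 (τ, p))
      + 2 * (τ ^ 2 * (bi (sp e) 2 U U).1 (τ, p)) + 4 / 3 * (τ ^ 3 * (bi (sp e) 3 U U).1 (τ, p))
      + 2 / 3 * (τ ^ 4 * (bi (sp e) 4 U U).1 (τ, p)) ≤ 1 := by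
  -- The weights are 2^j / j!: differentiating τ^j at level j is then compensated exactly by the
  -- dissipation of level j − 1. Only the negative fifth-order term survives, and P is a
  -- subsolution.
  set P : SF := bi (sp e) 0 U U + (2:ℝ) • (tm ^ 1 * bi (sp e) 1 U U)
      + (2:ℝ) • (tm ^ 2 * bi (sp e) 2 U U) + (4 / 3 : ℝ) • (tm ^ 3 * bi (sp e) 3 U U)
      + (2 / 3 : ℝ) • (tm ^ 4 * bi (sp e) 4 U U) with hP
  have := max_principle e P 1 (fun τ hτ p => ?_) (fun p => ?_) τ hτ p
  · simpa [hP] using this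
  · have h5 := bi_self_nonneg (sp e) 5 U (τ, p)
    have h6 : 0 ≤ τ ^ 4 := by positivity
    rw [hP]
    simp only [map_add, map_smul, lap_tm_mul, D_mul, D_pow_succ, h.Dt_bi, Dt_tm]
    simp
    nlinarith [mul_nonneg h6 h5]
  · have := sq_le_one_iff_abs_le_one (U.1 (0, p)) |>.2 (h0 p)
    simp [hP, bi]
    nlinarith

lemma mul_mul_le_of_sq_le {b b' c : ℝ} (hb : 0 ≤ b) (hb' : 0 ≤ b') (hc : c ^ 2 ≤ b * b') (x y : ℝ) :
    -(8 * (c * x * y)) ≤ b' * x ^ 2 + 16 * (b * y ^ 2) := by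
  have h1 : (8 * (c * x * y)) ^ 2 ≤ (b' * x ^ 2 + 16 * (b * y ^ 2)) ^ 2 := by
    have : c ^ 2 * (x * y) ^ 2 ≤ b * b' * (x * y) ^ 2 :=
      mul_le_mul_of_nonneg_right hc (sq_nonneg _)
    nlinarith [sq_nonneg (b' * x ^ 2 - 16 * (b * y ^ 2))]
  exact (abs_le.1 (abs_le_of_sq_le_sq h1 (by positivity))).1 |> fun h => by linarith

/-- The energy inequality behind the Carleson estimates. -/
lemma carleson_step {U G : SF} (hU : IsHeat e U) (hG : IsHeat e G) (j : ℕ) {τ : ℝ} (hτ : 0 ≤ τ) :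
    tint (slice τ (tm ^ j * Dt (bi (sp e) j U U * G ^ 2))) ≤
      tint (slice τ (tm ^ j * ((14:ℝ) • (bi (sp e) j U U * bi (sp e) 1 G G)
        - bi (sp e) (j + 1) U U * G ^ 2))) := by
  have key : tm ^ j * Dt (bi (sp e) j U U * G ^ 2) = lap (sp e) (tm ^ j * (bi (sp e) j U U * G ^ 2))
      + tm ^ j * (- 2 * (D (sp e 0) (bi (sp e) j U U) * D (sp e 0) (G ^ 2) +
        D (sp e 1) (bi (sp e) j U U) * D (sp e 1) (G ^ 2))
        - 2 * bi (sp e) (j + 1) U U * G ^ 2 - 2 * bi (sp e) j U U * bi (sp e) 1 G G) := by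
    have hG2 : Dt (G ^ 2) = lap (sp e) (G ^ 2) - 2 * bi (sp e) 1 G G := by
      have := hG.Dt_bi 0
      simpa [bi, pow_two] using this
    rw [lap_tm_mul, lap_mul, D_mul, hU.Dt_bi, hG2]
    ring
  rw [key, map_add, slice_lap, map_add, tint_lap, zero_add]
  refine tint_mono fun p => ?_
  simp only [slice_val, mul_val, pow_val, tm_val]
  refine mul_le_mul_of_nonneg_left ?_ (by positivity)
  simp only [D_bi_self, D_sq]
  -- The cross term is absorbed into half of the dissipation of U; its cost 16|∇G|², less the 2
  -- already available from G, is the constant 14.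
  have h : ∀ i, -(8 * ((bi (sp e) j U (D (sp e i) U)).1 (τ, p) * G.1 (τ, p) * (D (sp e i) G).1 (τ, p)))
      ≤ (bi (sp e) j (D (sp e i) U) (D (sp e i) U)).1 (τ, p) * G.1 (τ, p) ^ 2
        + 16 * ((bi (sp e) j U U).1 (τ, p) * (D (sp e i) G).1 (τ, p) ^ 2) := fun i =>
    mul_mul_le_of_sq_le (bi_self_nonneg _ _ _ _) (bi_self_nonneg _ _ _ _) (bi_sq_le _ _ _ _ _) _ _
  have h0 := h 0
  have h1 := h 1
  simp [bi]
  linarith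

end CliffordTorus
end

noncomputable section
namespace CliffordTorus
open MeasureTheory

/-! ### Hessian determinants, Carleson estimates and the three paraproduct pieces -/

section Hessian

variable {E : Type*} [NormedAddCommGroup E] [NormedSpace ℝ E] {Γ : Set E}

lemma bi_D_le (e : Fin 2 → E) (j : ℕ) (i : Fin 2) (G : smoothInv Γ) (p : E) :
    (bi e j (D (e i) G) (D (e i) G)).1 p ≤ (bi e (j + 1) G G).1 p := by
  have h0 := bi_self_nonneg e j (D (e 0) G) p
  have h1 := bi_self_nonneg e j (D (e 1) G) p
  fin_cases i <;> simp [bi] <;> linarith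

/-- The Hessian determinant in the directions of a frame. -/
def hess (e : Fin 2 → E) (G : smoothInv Γ) : smoothInv Γ :=
  D (e 0) (D (e 0) G) * D (e 1) (D (e 1) G) - D (e 0) (D (e 1) G) ^ 2

/-- The polarization of the Hessian determinant. -/
def hessBi (e : Fin 2 → E) (G K : smoothInv Γ) : smoothInv Γ :=
  D (e 0) (D (e 0) G) * D (e 1) (D (e 1) K) + D (e 1) (D (e 1) G) * D (e 0) (D (e 0) K)
    - 2 * (D (e 0) (D (e 1) G) * D (e 0) (D (e 1) K))

lemma hess_add (e : Fin 2 → E) (G K : smoothInv Γ) :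
    hess e (G + K) = hess e G + hessBi e G K + hess e K := by
  simp only [hess, hessBi, map_add]; ring

lemma D_hess (e : Fin 2 → E) (v : E) (G : smoothInv Γ) :
    D v (hess e G) = hessBi e G (D v G) := by
  simp only [hess, hessBi, map_sub, D_mul, D_sq, D_comm v]; ring

lemma bi_two (e : Fin 2 → E) (G : smoothInv Γ) : bi e 2 G G =
    D (e 0) (D (e 0) G) ^ 2 + 2 * D (e 0) (D (e 1) G) ^ 2 + D (e 1) (D (e 1) G) ^ 2 := by
  simp only [bi, D_comm (e 1) (e 0)]; ring

lemma bi_one (e : Fin 2 → E) (G : smoothInv Γ) : bi e 1 G G = D (e 0) G ^ 2 + D (e 1) G ^ 2 := by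
  simp only [bi]; ring

/-- The cofactor matrix of a Hessian is divergence free, so K can be left with a single derivative.
-/
lemma hessBi_eq_div (e : Fin 2 → E) (G K : smoothInv Γ) : hessBi e G K =
    D (e 0) (D (e 1) (D (e 1) G) * D (e 0) K - D (e 0) (D (e 1) G) * D (e 1) K)
    + D (e 1) (D (e 0) (D (e 0) G) * D (e 1) K - D (e 0) (D (e 1) G) * D (e 0) K) := by
  simp only [hessBi, map_sub, D_mul]
  rw [D_comm (e 1) (e 0) K, D_comm (e 1) (e 0) (D (e 0) G), D_comm (e 1) (e 0) G,
    D_comm (e 1) (e 0) (D (e 1) G)]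
  ring

/-- The very weak form of the determinant: it is a double divergence of products of first
derivatives, so both outer derivatives can be moved to a test function. -/
lemma two_hess_eq_div (e : Fin 2 → E) (K : smoothInv Γ) : 2 * hess e K =
    2 * D (e 0) (D (e 1) (D (e 0) K * D (e 1) K))
    - D (e 1) (D (e 1) (D (e 0) K ^ 2)) - D (e 0) (D (e 0) (D (e 1) K ^ 2)) := by
  have h0 : ∀ v, D v (2 : smoothInv Γ) = 0 := fun v => by
    have := D_algebraMap (Γ := Γ) v 2
    rwa [map_ofNat] at this
  simp only [hess, D_mul, D_sq, map_add, h0]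
  simp only [D_comm (e 1) (e 0)]
  ring

end Hessian

lemma mul_form_sq_le (x a b c d e f : ℝ) :
    2 * |x * (a * f + c * d - 2 * (b * e))| ≤
      x ^ 2 * (a ^ 2 + 2 * b ^ 2 + c ^ 2) + (d ^ 2 + 2 * e ^ 2 + f ^ 2) := by
  rw [show (2:ℝ) * |x * (a * f + c * d - 2 * (b * e))| = |2 * (x * (a * f + c * d - 2 * (b * e)))| by
    rw [abs_mul 2]; norm_num]
  rw [abs_le]
  constructor <;> nlinarith [sq_nonneg (x * a + f), sq_nonneg (x * c + d), sq_nonneg (x * b - e),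
    sq_nonneg (x * a - f), sq_nonneg (x * c - d), sq_nonneg (x * b + e)]

/-- Cauchy–Schwarz for the cofactor matrix, whose Frobenius norm is that of the matrix, followed by
the arithmetic-geometric mean inequality with weight s². The weight will be the time variable. -/
lemma cof_form_le (s u v a b c k l : ℝ) (hs : 0 < s) :
    2 * |u * (c * k - b * l) + v * (a * l - b * k)| ≤
      s ^ 2 * ((u ^ 2 + v ^ 2) * (a ^ 2 + 2 * b ^ 2 + c ^ 2)) + (s ^ 2)⁻¹ * (k ^ 2 + l ^ 2) := by
  set A := u * (c * k - b * l) + v * (a * l - b * k)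
  have hA : A ^ 2 ≤ ((u ^ 2 + v ^ 2) * (a ^ 2 + 2 * b ^ 2 + c ^ 2)) * (k ^ 2 + l ^ 2) := by
    have e : A = k * (u * c - v * b) + l * (v * a - u * b) := by simp only [A]; ring
    have h1 : A ^ 2 ≤ (k ^ 2 + l ^ 2) * ((u * c - v * b) ^ 2 + (v * a - u * b) ^ 2) := by
      rw [e]; nlinarith [sq_nonneg (k * (v * a - u * b) - l * (u * c - v * b))]
    have h2 : (u * c - v * b) ^ 2 + (v * a - u * b) ^ 2 ≤
        (u ^ 2 + v ^ 2) * (a ^ 2 + 2 * b ^ 2 + c ^ 2) := by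
      nlinarith [sq_nonneg (u * b + v * c), sq_nonneg (u * a + v * b)]
    nlinarith [mul_le_mul_of_nonneg_left h2 (by positivity : 0 ≤ k ^ 2 + l ^ 2)]
  set P := (u ^ 2 + v ^ 2) * (a ^ 2 + 2 * b ^ 2 + c ^ 2)
  set Q := k ^ 2 + l ^ 2
  have hP : 0 ≤ P := by positivity
  have hQ : 0 ≤ Q := by positivity
  have hs2 : s ^ 2 * (s ^ 2)⁻¹ = 1 := mul_inv_cancel₀ (by positivity)
  have h : (2 * A) ^ 2 ≤ (s ^ 2 * P + (s ^ 2)⁻¹ * Q) ^ 2 := by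
    have : 4 * (s ^ 2 * P) * ((s ^ 2)⁻¹ * Q) = 4 * (P * Q) := by
      linear_combination 4 * P * Q * hs2
    nlinarith [sq_nonneg (s ^ 2 * P - (s ^ 2)⁻¹ * Q)]
  have := abs_le_of_sq_le_sq h (by positivity)
  rwa [abs_mul, abs_two] at this

variable {e : Fin 2 → ℝ × ℝ}

/-- The energy identity: the rate of change of the level-j energy is minus twice the next energy,
and the energy at time one is discarded. -/
lemma IsHeat.stint_bi {G : SF} (hG : IsHeat e G) (j : ℕ) :
    stint 0 (bi (sp e) (j + 1) G G) ≤ 1 / 2 * tint (bi e j (slice 0 G) (slice 0 G)) := by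
  have h := stint_Dt 0 (bi (sp e) j G G)
  have h2 : (2 * bi (sp e) (j + 1) G G : SF) = (2:ℝ) • bi (sp e) (j + 1) G G :=
    ext_val fun p => by simp
  rw [hG.Dt_bi, map_sub, stint_lap, slice_bi, slice_bi, h2, map_smul, smul_eq_mul] at h
  have := tint_nonneg (bi_self_nonneg e j (slice 1 G))
  linarith

/-- `carleson_step` integrated in time. The pointwise bounds replace the weighted gradient of U by
1, and the remaining energy of G contributes 14 · 1/2 = 7. The last term, from differentiating the
weight, involves the previous level and permits induction on j. -/
lemma carleson_aux {U G : SF} (hU : IsHeat e U) (hG : IsHeat e G) (h0 : ∀ p, |U.1 (0, p)| ≤ 1)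
    (j : ℕ) (hj : j ≤ 2) :
    stint 0 (tm ^ j * (bi (sp e) (j + 1) U U * G ^ 2)) ≤ 7 * tint (slice 0 G ^ 2) +
      tint (slice 0 (tm ^ j * (bi (sp e) j U U * G ^ 2))) +
      stint 0 (Dt (tm ^ j) * (bi (sp e) j U U * G ^ 2)) := by
  have h1 := stint_Dt 0 (tm ^ j * (bi (sp e) j U U * G ^ 2))
  rw [D_mul, map_add] at h1
  have h2 : stint 0 (tm ^ j * Dt (bi (sp e) j U U * G ^ 2)) ≤
      stint 0 (tm ^ j * ((14:ℝ) • (bi (sp e) j U U * bi (sp e) 1 G G)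
        - bi (sp e) (j + 1) U U * G ^ 2)) :=
    stint_mono zero_le_one fun τ hτ => carleson_step hU hG j hτ.1
  have h3 : stint 0 (tm ^ j * ((14:ℝ) • (bi (sp e) j U U * bi (sp e) 1 G G))) ≤
      stint 0 ((14:ℝ) • bi (sp e) 1 G G) := by
    refine stint_mono' zero_le_one fun τ hτ p => ?_
    have hb := hU.bound h0 hτ p
    have n := fun j => bi_self_nonneg (sp e) j U (τ, p)
    have nG := bi_self_nonneg (sp e) 1 G (τ, p)
    have hτ0 := hτ.1
    have m := fun j => mul_nonneg (pow_nonneg hτ0 j) (n j)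
    have : τ ^ j * (bi (sp e) j U U).1 (τ, p) ≤ 1 := by
      have := m 0; have := m 1; have := m 2; have := m 3; have := m 4
      interval_cases j <;> simp at * <;> linarith
    simp
    nlinarith
  rw [mul_sub, map_sub] at h2
  rw [map_smul, smul_eq_mul] at h3
  have h4 := hG.stint_bi 0
  have h5 : 0 ≤ tint (slice 1 (tm ^ j * (bi (sp e) j U U * G ^ 2))) := tint_nonneg fun p => by
    simpa [slice_val] using mul_nonneg (bi_self_nonneg (sp e) j U (1, p)) (sq_nonneg _)
  have h6 : tint (bi e 0 (slice 0 G) (slice 0 G)) = tint (slice 0 G ^ 2) := by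
    simp only [bi, pow_two]
  linarith

/-- The Carleson estimates for bounded solutions of the heat equation. -/
lemma carleson {U G : SF} (hU : IsHeat e U) (hG : IsHeat e G) (h0 : ∀ p, |U.1 (0, p)| ≤ 1) :
    stint 0 (bi (sp e) 1 U U * G ^ 2) ≤ 8 * tint (slice 0 G ^ 2) ∧
    stint 0 (tm ^ 2 * (bi (sp e) 3 U U * G ^ 2)) ≤ 37 * tint (slice 0 G ^ 2) := by
  -- The three levels give the constants 8 = 7 + 1, then 15 = 7 + 8, then 37 = 7 + 2 · 15.
  have a := carleson_aux hU hG h0 0 (by norm_num)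
  have b := carleson_aux hU hG h0 1 (by norm_num)
  have c := carleson_aux hU hG h0 2 (by norm_num)
  have e0 : tint (slice 0 (tm ^ 0 * (bi (sp e) 0 U U * G ^ 2))) ≤ tint (slice 0 G ^ 2) := by
    refine tint_mono fun p => ?_
    have := (sq_le_one_iff_abs_le_one _).2 (h0 p)
    simp [slice_val, bi]
    nlinarith [sq_nonneg (G.1 (0, p))]
  have e1 : slice 0 (tm ^ 1 * (bi (sp e) 1 U U * G ^ 2)) = 0 := by simp
  have e2 : slice 0 (tm ^ 2 * (bi (sp e) 2 U U * G ^ 2)) = 0 := by simp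
  have d1 : Dt (tm ^ 1) = 1 := by simp
  have d2 : Dt (tm ^ 2) = (2:ℝ) • tm ^ 1 := by rw [D_pow_succ]; simp
  rw [pow_zero, D_one, zero_mul, map_zero] at a
  simp only [zero_add, one_mul] at a
  rw [e1, d1, one_mul, map_zero] at b
  rw [e2, d2, map_zero, smul_mul_assoc, map_smul, smul_eq_mul] at c
  simp only [Nat.reduceAdd] at b c
  rw [pow_zero, one_mul] at e0
  constructor <;> linarith

/-- Second derivatives of G again solve the heat equation, so the Carleson estimates apply to each
of them. -/
lemma carleson_two {U G : SF} (hU : IsHeat e U) (hG : IsHeat e G) (h0 : ∀ p, |U.1 (0, p)| ≤ 1) :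
    stint 0 (bi (sp e) 1 U U * bi (sp e) 2 G G) ≤ 8 * tint (bi e 2 (slice 0 G) (slice 0 G)) ∧
    stint 0 (tm ^ 2 * (bi (sp e) 3 U U * bi (sp e) 2 G G)) ≤
      37 * tint (bi e 2 (slice 0 G) (slice 0 G)) := by
  have h := fun i j => carleson hU ((hG.D (e i)).D (e j)) h0
  simp only [slice_D] at h
  have exp : ∀ A : SF, A * bi (sp e) 2 G G = A * D (0, e 0) (D (0, e 0) G) ^ 2
      + A * D (0, e 1) (D (0, e 0) G) ^ 2 + A * D (0, e 0) (D (0, e 1) G) ^ 2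
      + A * D (0, e 1) (D (0, e 1) G) ^ 2 := fun A => by simp only [bi, sp]; ring
  have exp' : bi e 2 (slice 0 G) (slice 0 G) = D (e 0) (D (e 0) (slice 0 G)) ^ 2
      + D (e 1) (D (e 0) (slice 0 G)) ^ 2 + D (e 0) (D (e 1) (slice 0 G)) ^ 2
      + D (e 1) (D (e 1) (slice 0 G)) ^ 2 := by simp only [bi]; ring
  have h00 := h 0 0
  have h01 := h 0 1
  have h10 := h 1 0
  have h11 := h 1 1
  rw [exp, exp, exp']
  simp only [mul_add, map_add]
  constructor <;> linarith

/-- The low-frequency part of the Hessian pairing. -/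
lemma low_part {U G : SF} (hU : IsHeat e U) (hG : IsHeat e G) (h0 : ∀ p, |U.1 (0, p)| ≤ 1)
    (p q : Fin 2) {a : ℝ} (ha : a ∈ Set.Icc (0:ℝ) 1) :
    |stint a (D (sp e p) (D (sp e q) U) * hess (sp e) G)| ≤
      5 * tint (bi e 2 (slice 0 G) (slice 0 G)) := by
  -- One derivative is moved off U: the remaining first derivative is controlled by the Carleson
  -- estimate, and the third derivatives of G by the energy identity.
  have h1 : stint a (D (sp e p) (D (sp e q) U) * hess (sp e) G) =
      - stint a (D (sp e q) U * hessBi (sp e) G (D (sp e p) G)) := by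
    rw [← D_hess]; exact stint_D_mul a _ _ _
  have pt : ∀ x, |(D (sp e q) U * hessBi (sp e) G (D (sp e p) G)).1 x| ≤
      ((1 / 2 : ℝ) • (bi (sp e) 1 U U * bi (sp e) 2 G G + bi (sp e) 3 G G)).1 x := fun x => by
    have h2 := mul_form_sq_le ((D (sp e q) U).1 x) ((D (sp e 0) (D (sp e 0) G)).1 x)
      ((D (sp e 0) (D (sp e 1) G)).1 x) ((D (sp e 1) (D (sp e 1) G)).1 x)
      ((D (sp e 0) (D (sp e 0) (D (sp e p) G))).1 x)
      ((D (sp e 0) (D (sp e 1) (D (sp e p) G))).1 x)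
      ((D (sp e 1) (D (sp e 1) (D (sp e p) G))).1 x)
    have h3 := bi_D_le (sp e) 0 q U x
    have h4 := bi_D_le (sp e) 2 p G x
    have h5 := bi_self_nonneg (sp e) 2 G x
    have h6 : (D (sp e q) U).1 x ^ 2 * (bi (sp e) 2 G G).1 x ≤
        (bi (sp e) 1 U U).1 x * (bi (sp e) 2 G G).1 x := by
      refine mul_le_mul_of_nonneg_right ?_ h5
      simpa [bi, pow_two] using h3
    rw [bi_two] at h4
    have h7 : (bi (sp e) 2 G G).1 x = (D (sp e 0) (D (sp e 0) G)).1 x ^ 2 +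
      2 * (D (sp e 0) (D (sp e 1) G)).1 x ^ 2 + (D (sp e 1) (D (sp e 1) G)).1 x ^ 2 := by
      rw [bi_two]; simp
    rw [← h7] at h2
    simp only [add_val, pow_val, mul_val, two_val] at h4
    simp only [hessBi, mul_val, add_val, sub_val, smul_val, two_val]
    linarith
  have hnn : stint a ((1 / 2 : ℝ) • (bi (sp e) 1 U U * bi (sp e) 2 G G + bi (sp e) 3 G G)) ≤
      stint 0 ((1 / 2 : ℝ) • (bi (sp e) 1 U U * bi (sp e) 2 G G + bi (sp e) 3 G G)) :=
    stint_le_stint ha.1 ha.2 fun τ _ x => (abs_nonneg _).trans (pt (τ, x))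
  have h8 : |stint a (D (sp e q) U * hessBi (sp e) G (D (sp e p) G))| ≤
      stint a ((1 / 2 : ℝ) • (bi (sp e) 1 U U * bi (sp e) 2 G G + bi (sp e) 3 G G)) := by
    rw [abs_le, ← map_neg]
    exact ⟨stint_mono' ha.2 fun τ _ x => (abs_le.1 (pt (τ, x))).1,
      stint_mono' ha.2 fun τ _ x => (abs_le.1 (pt (τ, x))).2⟩
  rw [h1, abs_neg]
  refine h8.trans (hnn.trans ?_)
  have h9 := (carleson_two hU hG h0).1
  have h10 := hG.stint_bi 2
  have h11 := tint_nonneg (bi_self_nonneg e 2 (slice 0 G))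
  rw [map_smul, map_add, smul_eq_mul]
  linarith

lemma tint_abs_le {f g : TF} (h : ∀ p, |f.1 p| ≤ g.1 p) : |tint f| ≤ tint g := by
  rw [abs_le, ← map_neg]
  exact ⟨tint_mono fun p => (abs_le.1 (h p)).1, tint_mono fun p => (abs_le.1 (h p)).2⟩

/-- The mixed part of the Hessian pairing at a fixed time. -/
lemma mixed_part (U G K : TF) (p q : Fin 2) {τ : ℝ} (hτ : 0 < τ) :
    2 * |tint (D (e p) (D (e q) U) * hessBi e G K)| ≤
      τ ^ 2 * tint (bi e 3 U U * bi e 2 G G) + (τ ^ 2)⁻¹ * tint (bi e 1 K K) := by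
  set V := D (e p) (D (e q) U) with hV
  -- The divergence form leaves three derivatives on U, two on the smooth part and one on the rough
  -- part.
  have h1 : tint (V * hessBi e G K) = - tint
      (D (e 0) V * (D (e 1) (D (e 1) G) * D (e 0) K - D (e 0) (D (e 1) G) * D (e 1) K)
      + D (e 1) V * (D (e 0) (D (e 0) G) * D (e 1) K - D (e 0) (D (e 1) G) * D (e 0) K)) := by
    have ibp : ∀ (v : ℝ × ℝ) (A : TF), tint (V * D v A) = -tint (D v V * A) := fun v A => by
      linarith [tint_D_mul v V A]
    rw [hessBi_eq_div, mul_add, map_add, map_add, ibp, ibp]; ring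
  rw [h1, abs_neg, ← smul_eq_mul (τ ^ 2), ← smul_eq_mul (τ ^ 2)⁻¹, ← map_smul, ← map_smul,
    ← map_add, show (2:ℝ) = |2| by norm_num, ← abs_mul, ← smul_eq_mul, ← map_smul]
  refine tint_abs_le fun x => ?_
  have h2 := cof_form_le τ ((D (e 0) V).1 x) ((D (e 1) V).1 x) ((D (e 0) (D (e 0) G)).1 x)
    ((D (e 0) (D (e 1) G)).1 x) ((D (e 1) (D (e 1) G)).1 x) ((D (e 0) K).1 x) ((D (e 1) K).1 x) hτ
  have h3 : (bi e 1 V V).1 x ≤ (bi e 3 U U).1 x := (bi_D_le e 1 p _ x).trans (bi_D_le e 2 q U x)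
  have h7 : (bi e 2 G G).1 x = (D (e 0) (D (e 0) G)).1 x ^ 2 +
      2 * (D (e 0) (D (e 1) G)).1 x ^ 2 + (D (e 1) (D (e 1) G)).1 x ^ 2 := by
    rw [bi_two]; simp
  have h8 : (bi e 1 K K).1 x = (D (e 0) K).1 x ^ 2 + (D (e 1) K).1 x ^ 2 := by
    rw [bi_one]; simp
  have h9 : (bi e 1 V V).1 x = (D (e 0) V).1 x ^ 2 + (D (e 1) V).1 x ^ 2 := by
    rw [bi_one]; simp
  rw [← h7, ← h8, ← h9] at h2
  have h10 := mul_le_mul_of_nonneg_left (mul_le_mul_of_nonneg_right h3 (bi_self_nonneg e 2 G x))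
    (sq_nonneg τ)
  simp only [add_val, smul_val, mul_val, sub_val, abs_mul, abs_two]
  linarith

lemma quad_form_le {s x y z : ℝ} (hs : 0 < s) (hx : (s * x) ^ 2 ≤ 4) (hy : (s * y) ^ 2 ≤ 4)
    (hz : (s * z) ^ 2 ≤ 4) (a b : ℝ) :
    |2 * (x * (a * b)) - y * a ^ 2 - z * b ^ 2| ≤ 6 * (s⁻¹ * (a ^ 2 + b ^ 2)) := by
  have h : ∀ t : ℝ, (s * t) ^ 2 ≤ 4 → |s * t| ≤ 2 := fun t ht =>
    abs_le_of_sq_le_sq (by linarith) (by norm_num)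
  have h1 : |s * (2 * (x * (a * b)) - y * a ^ 2 - z * b ^ 2)| ≤ 6 * (a ^ 2 + b ^ 2) := by
    have hx' := abs_le.1 (h x hx)
    have hy' := abs_le.1 (h y hy)
    have hz' := abs_le.1 (h z hz)
    have e : s * (2 * (x * (a * b)) - y * a ^ 2 - z * b ^ 2) =
      (s * x) * (2 * (a * b)) - (s * y) * a ^ 2 - (s * z) * b ^ 2 := by ring
    rw [e]
    have hab : |(s * x) * (2 * (a * b))| ≤ 2 * (a ^ 2 + b ^ 2) := by
      rw [abs_mul]
      refine mul_le_mul (h x hx) ?_ (abs_nonneg _) (by norm_num)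
      rw [abs_le]; constructor <;> nlinarith [sq_nonneg (a + b), sq_nonneg (a - b)]
    rw [abs_le] at hab ⊢
    constructor <;> nlinarith [sq_nonneg a, sq_nonneg b]
  rw [abs_mul, abs_of_pos hs] at h1
  rw [show 6 * (s⁻¹ * (a ^ 2 + b ^ 2)) = s⁻¹ * (6 * (a ^ 2 + b ^ 2)) by ring]
  rwa [le_inv_mul_iff₀ hs]

/-- The high-frequency part of the Hessian pairing at a fixed time. -/
lemma high_part (U K : TF) (p q : Fin 2) {τ : ℝ} (hτ : 0 < τ)
    (hU : ∀ x, τ ^ 4 * (bi e 4 U U).1 x ≤ 3 / 2) :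
    |tint (D (e p) (D (e q) U) * hess e K)| ≤ 3 * ((τ ^ 2)⁻¹ * tint (bi e 1 K K)) := by
  set V := D (e p) (D (e q) U) with hV
  -- Both divergences are moved to U, which then carries four derivatives, of size at most a
  -- multiple of τ⁻² pointwise.
  have h1 : tint ((2:ℝ) • (V * hess e K)) = tint
      ((2:ℝ) • (D (e 0) (D (e 1) V) * (D (e 0) K * D (e 1) K))
      - D (e 1) (D (e 1) V) * D (e 0) K ^ 2 - D (e 0) (D (e 0) V) * D (e 1) K ^ 2) := by
    have h2 : (2:ℝ) • (V * hess e K) = (2:ℝ) • (V * D (e 0) (D (e 1) (D (e 0) K * D (e 1) K)))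
        - V * D (e 1) (D (e 1) (D (e 0) K ^ 2)) - V * D (e 0) (D (e 0) (D (e 1) K ^ 2)) := by
      have := two_hess_eq_div e K
      refine ext_val fun x => ?_
      have := congrArg (fun f : TF => f.1 x) this
      simp at this ⊢
      linear_combination V.1 x * this
    have ibp : ∀ (v w : ℝ × ℝ) (A : TF), tint (V * D v (D w A)) = tint (D w (D v V) * A) :=
      fun v w A => by
        have a := tint_D_mul v V (D w A)
        have b := tint_D_mul w (D v V) A
        linarith
    rw [h2]
    simp only [map_sub, map_smul, ibp]
    rw [D_comm (e 1) (e 0)]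
  have h3 : |tint ((2:ℝ) • (V * hess e K))| ≤ tint ((6 * (τ ^ 2)⁻¹) • bi e 1 K K) := by
    rw [h1]
    refine tint_abs_le fun x => ?_
    have h4 : (bi e 2 V V).1 x ≤ (bi e 4 U U).1 x := (bi_D_le e 2 p _ x).trans (bi_D_le e 3 q U x)
    have h5 : τ ^ 4 * (bi e 2 V V).1 x ≤ 3 / 2 :=
      (mul_le_mul_of_nonneg_left h4 (by positivity)).trans (hU x)
    rw [bi_two] at h5
    simp only [add_val, pow_val, mul_val, two_val] at h5
    have hτ4 : 0 ≤ τ ^ 4 := by positivity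
    have hτ22 : (τ ^ 2) ^ 2 = τ ^ 4 := by ring
    have a1 := mul_nonneg hτ4 (sq_nonneg ((D (e 0) (D (e 0) V)).1 x))
    have a2 := mul_nonneg hτ4 (sq_nonneg ((D (e 0) (D (e 1) V)).1 x))
    have a3 := mul_nonneg hτ4 (sq_nonneg ((D (e 1) (D (e 1) V)).1 x))
    have := quad_form_le (s := τ ^ 2) (by positivity) (x := (D (e 0) (D (e 1) V)).1 x)
      (y := (D (e 1) (D (e 1) V)).1 x) (z := (D (e 0) (D (e 0) V)).1 x)
      (by rw [mul_pow, hτ22]; linarith) (by rw [mul_pow, hτ22]; linarith)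
      (by rw [mul_pow, hτ22]; linarith) ((D (e 0) K).1 x) ((D (e 1) K).1 x)
    rw [bi_one]
    simp only [add_val, smul_val, mul_val, sub_val, pow_val]
    rw [mul_assoc]
    exact this
  rw [map_smul, map_smul, smul_eq_mul, smul_eq_mul, abs_mul, abs_two] at h3
  linarith

end CliffordTorus
end

/-! ### The Hardy inequality and the Hessian pairing for heat flows -/

noncomputable section
namespace CliffordTorus
open MeasureTheory

variable {e : Fin 2 → ℝ × ℝ}

lemma two_mul_le_of_sq_le {b b' c t : ℝ} (hb : 0 ≤ b) (hb' : 0 ≤ b') (hc : c ^ 2 ≤ b * b')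
    (ht : 0 < t) : 2 * c ≤ 1 / 2 * t⁻¹ * b + 2 * t * b' := by
  have hs : t * t⁻¹ = 1 := mul_inv_cancel₀ ht.ne'
  have h : (2 * c) ^ 2 ≤ (1 / 2 * t⁻¹ * b + 2 * t * b') ^ 2 := by
    have : 4 * (1 / 2 * t⁻¹ * b) * (2 * t * b') = 4 * (b * b') := by
      linear_combination 4 * b * b' * hs
    nlinarith [sq_nonneg (1 / 2 * t⁻¹ * b - 2 * t * b')]
  exact (abs_le.1 (abs_le_of_sq_le_sq h (by positivity))).2

lemma bi_one_lap_le (G : SF) (x : ℝ × (ℝ × ℝ)) :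
    (bi (sp e) 1 (lap (sp e) G) (lap (sp e) G)).1 x ≤ 2 * (bi (sp e) 3 G G).1 x := by
  have h : ∀ i, ((D (sp e i) (lap (sp e) G)).1 x) ^ 2 ≤
      2 * (bi (sp e) 2 (D (sp e i) G) (D (sp e i) G)).1 x := fun i => by
    rw [D_lap, bi_two, lap_apply]
    simp only [add_val, pow_val, mul_val, two_val]
    nlinarith [sq_nonneg ((D (sp e 0) (D (sp e 0) (D (sp e i) G))).1 x
      - (D (sp e 1) (D (sp e 1) (D (sp e i) G))).1 x),
      sq_nonneg ((D (sp e 0) (D (sp e 1) (D (sp e i) G))).1 x)]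
  rw [bi_one]
  have h3 : (bi (sp e) 3 G G).1 x = (bi (sp e) 2 (D (sp e 0) G) (D (sp e 0) G)).1 x
    + (bi (sp e) 2 (D (sp e 1) G) (D (sp e 1) G)).1 x := rfl
  rw [h3]
  simp only [add_val, pow_val]
  linarith [h 0, h 1]

/-- The part of a static function which has been smoothed away by the heat flow `G`. -/
def rough (G : SF) : SF := static (slice 0 G) - G

lemma continuousOn_inv_sq_mul (U : SF) {a : ℝ} (ha : 0 < a) :
    ContinuousOn (fun τ : ℝ => (τ ^ 2)⁻¹ * tint (slice τ U)) (Set.uIcc a 1) ∨ 1 < a := by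
  rcases le_or_gt a 1 with h | h
  · left
    rw [Set.uIcc_of_le h]
    refine ContinuousOn.mul (ContinuousOn.inv₀ (by fun_prop) fun x hx => ?_)
      (continuous_tint_slice U).continuousOn
    exact (pow_pos (ha.trans_le hx.1) 2).ne'
  · exact Or.inr h

lemma intervalIntegrable_inv_sq_mul (U : SF) {a : ℝ} (ha : 0 < a) (ha1 : a ≤ 1) :
    IntervalIntegrable (fun τ : ℝ => (τ ^ 2)⁻¹ * tint (slice τ U)) volume a 1 :=
  ((continuousOn_inv_sq_mul U ha).resolve_right (not_lt.2 ha1)).intervalIntegrable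

/-- A Hardy inequality for the rough part. -/
lemma hardy_rough {G : SF} (hG : IsHeat e G) {a : ℝ} (ha : 0 < a) (ha1 : a ≤ 1) :
    ∫ τ in a..1, (τ ^ 2)⁻¹ * tint (slice τ (bi (sp e) 1 (rough G) (rough G))) ≤
      2 * (a⁻¹ * tint (slice a (bi (sp e) 1 (rough G) (rough G))))
        + 4 * tint (bi e 2 (slice 0 G) (slice 0 G)) := by
  set B : SF := bi (sp e) 1 (rough G) (rough G) with hB
  have hint := intervalIntegrable_inv_sq_mul B ha ha1
  -- Hardy's argument: integrate by parts against the primitive −τ⁻¹ of τ⁻².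
  have hder : ∀ τ ∈ Set.uIcc a 1, HasDerivAt (fun τ => -(τ⁻¹ * tint (slice τ B)))
      ((τ ^ 2)⁻¹ * tint (slice τ B) - τ⁻¹ * tint (slice τ (Dt B))) τ := fun τ hτ => by
    rw [Set.uIcc_of_le ha1] at hτ
    have hτ0 : τ ≠ 0 := (ha.trans_le hτ.1).ne'
    have := ((hasDerivAt_inv hτ0).mul (hasDerivAt_tint_slice B τ)).neg
    convert! this using 1
    ring
  have hcont : ContinuousOn (fun τ : ℝ => (τ ^ 2)⁻¹ * tint (slice τ B) - τ⁻¹ * tint (slice τ (Dt B)))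
      (Set.uIcc a 1) := by
    refine ContinuousOn.sub ((continuousOn_inv_sq_mul B ha).resolve_right (not_lt.2 ha1)) ?_
    refine ContinuousOn.mul (continuousOn_inv₀.mono fun x hx => ?_)
      (continuous_tint_slice _).continuousOn
    rw [Set.uIcc_of_le ha1] at hx
    exact (ha.trans_le hx.1).ne'
  have hftc := intervalIntegral.integral_eq_sub_of_hasDerivAt hder hcont.intervalIntegrable
  have hlow : ∫ τ in a..1, (1 / 2 * ((τ ^ 2)⁻¹ * tint (slice τ B))
        - 4 * tint (slice τ (bi (sp e) 3 G G))) ≤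
      ∫ τ in a..1, ((τ ^ 2)⁻¹ * tint (slice τ B) - τ⁻¹ * tint (slice τ (Dt B))) := by
    refine intervalIntegral.integral_mono_on ha1 ((hint.const_mul _).sub
      (((continuous_tint_slice _).intervalIntegrable _ _).const_mul _))
      hcont.intervalIntegrable fun τ hτ => ?_
    have hτ0 : 0 < τ := ha.trans_le hτ.1
    -- The rough part changes in time by −ΔG. Young's inequality is weighted so that half of the
    -- left side is absorbed and the rest is the unweighted energy of third derivatives.
    have hE : tint (slice τ (Dt B)) ≤ tint ((1 / 2 * τ⁻¹) • slice τ B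
        + (4 * τ) • slice τ (bi (sp e) 3 G G)) := by
      refine tint_mono fun x => ?_
      have hD : Dt (rough G) = - lap (sp e) G := by
        rw [rough, map_sub, Dt_static, hG]; ring
      rw [hB, D_bi_self, hD]
      have h1 := two_mul_le_of_sq_le (bi_self_nonneg (sp e) 1 (rough G) (τ, x))
        (bi_self_nonneg (sp e) 1 (- lap (sp e) G) (τ, x)) (bi_sq_le (sp e) 1 _ _ (τ, x)) hτ0
      have h2 := bi_one_lap_le (e := e) G (τ, x)
      have h3 : (bi (sp e) 1 (- lap (sp e) G) (- lap (sp e) G)).1 (τ, x) =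
        (bi (sp e) 1 (lap (sp e) G) (lap (sp e) G)).1 (τ, x) := by
        simp only [bi_one, map_neg, add_val, pow_val, neg_val, neg_sq]
      rw [h3] at h1
      simp only [slice_val, mul_val, add_val, smul_val, two_val]
      nlinarith
    rw [map_add, map_smul, map_smul, smul_eq_mul, smul_eq_mul] at hE
    have := mul_le_mul_of_nonneg_left hE (inv_pos.2 hτ0).le
    have e1 : τ⁻¹ * (1 / 2 * τ⁻¹ * tint (slice τ B) + 4 * τ * tint (slice τ (bi (sp e) 3 G G))) =
        1 / 2 * ((τ ^ 2)⁻¹ * tint (slice τ B)) + 4 * tint (slice τ (bi (sp e) 3 G G)) := by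
      field_simp
    rw [e1] at this
    linarith
  rw [intervalIntegral.integral_sub (hint.const_mul _)
      (((continuous_tint_slice _).intervalIntegrable _ _).const_mul _),
    intervalIntegral.integral_const_mul, intervalIntegral.integral_const_mul, hftc] at hlow
  have h1 : 0 ≤ tint (slice 1 B) := tint_nonneg fun x => bi_self_nonneg (sp e) 1 _ (1, x)
  have h2 : stint a (bi (sp e) 3 G G) ≤ stint 0 (bi (sp e) 3 G G) :=
    stint_le_stint ha.le ha1 fun τ _ x => bi_self_nonneg (sp e) 3 G (τ, x)
  have h3 := hG.stint_bi 2
  rw [stint_def] at h2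
  simp only [Nat.reduceAdd] at h3
  simp only [inv_one, one_mul] at hlow
  linarith

/-- The rough part vanishes at time zero, so its squared gradient has zero value and zero time
derivative there; the Hardy boundary term therefore disappears in the limit. -/
lemma IsHeat.rough_tendsto (G : SF) :
    Filter.Tendsto (fun a : ℝ => a⁻¹ * tint (slice a (bi (sp e) 1 (rough G) (rough G))))
      (nhdsWithin 0 (Set.Ioi 0)) (nhds 0) := by
  have h0 : slice 0 (rough G) = 0 := by simp [rough]
  have h := hasDerivAt_tint_slice (bi (sp e) 1 (rough G) (rough G)) 0
  have h1 : slice 0 (Dt (bi (sp e) 1 (rough G) (rough G))) = 0 := by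
    rw [D_bi_self, map_mul, slice_bi, h0]; simp [bi]
  rw [h1, map_zero] at h
  have h2 := (hasDerivAt_iff_tendsto_slope.1 h).mono_left
    (nhdsWithin_mono 0 fun x hx => ne_of_gt hx)
  refine h2.congr fun a => ?_
  rw [slope_def_field, slice_bi (τ := 0), h0]
  simp [bi]; ring

lemma stint_tendsto (U : SF) :
    Filter.Tendsto (fun a => stint a U) (nhdsWithin 0 (Set.Ioi 0)) (nhds (stint 0 U)) := by
  have : Continuous fun a => stint a U := by
    simp only [stint_def]
    simp_rw [intervalIntegral.integral_symm 1]
    exact (intervalIntegral.continuous_primitive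
      (fun a b => (continuous_tint_slice U).intervalIntegrable a b) 1).neg
  exact (this.tendsto 0).mono_left nhdsWithin_le_nhds

/-- At every time the initial datum is the heat flow plus the rough part; expanding the determinant
gives the low, mixed and high terms. -/
lemma hess_static (G : SF) : static (hess e (slice 0 G)) =
    hess (sp e) G + hessBi (sp e) G (rough G) + hess (sp e) (rough G) := by
  rw [← hess_add]
  have : G + rough G = static (slice 0 G) := by rw [rough]; ring
  rw [this]
  simp only [hess, sp, D_static, map_sub, map_mul, map_pow]

lemma slice_hess (τ : ℝ) (G : SF) : slice τ (hess (sp e) G) = hess e (slice τ G) := by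
  simp only [hess, sp, map_sub, map_mul, map_pow, slice_D]

lemma slice_hessBi (τ : ℝ) (G K : SF) :
    slice τ (hessBi (sp e) G K) = hessBi e (slice τ G) (slice τ K) := by
  simp only [hessBi, sp, map_sub, map_add, map_mul, slice_D, map_ofNat]

/-- The bound for the Hessian pairing, for functions which are initial values of the heat
equation. -/
lemma hess_pairing_heat {U G : SF} (hU : IsHeat e U) (hG : IsHeat e G)
    (h0 : ∀ p, |U.1 (0, p)| ≤ 1) (p q : Fin 2) :
    |stint 0 (D (sp e p) (D (sp e q) U) * static (hess e (slice 0 G)))| ≤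
      40 * tint (bi e 2 (slice 0 G) (slice 0 G)) := by
  set V := D (sp e p) (D (sp e q) U) with hV
  set I2 := tint (bi e 2 (slice 0 G) (slice 0 G)) with hI2
  set B : SF := bi (sp e) 1 (rough G) (rough G) with hB
  -- The weight τ⁻² forces a cutoff a > 0, removed at the end. The mixed part contributes 37/2 and
  -- the low part 5. The Hardy term has factor 7/2 = 1/2 + 3 and adds 14, so the total is below 40.
  have main : ∀ a ∈ Set.Ioc (0:ℝ) 1, |stint a (V * static (hess e (slice 0 G)))| ≤
      40 * I2 + 7 * (a⁻¹ * tint (slice a B)) := by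
    rintro a ⟨ha, ha1⟩
    have hlow := low_part hU hG h0 p q ⟨ha.le, ha1⟩
    rw [← hV, ← hI2] at hlow
    set R : SF := V * (hessBi (sp e) G (rough G) + hess (sp e) (rough G)) with hR
    set S : SF := (1 / 2 : ℝ) • (tm ^ 2 * (bi (sp e) 3 U U * bi (sp e) 2 G G)) with hS
    have hsplit : V * static (hess e (slice 0 G)) = V * hess (sp e) G + R := by
      rw [hess_static, hR]; ring
    have hint := intervalIntegrable_inv_sq_mul B ha ha1
    have hSint := (continuous_tint_slice S).intervalIntegrable (μ := volume) a 1
    have hRb : |stint a R| ≤ ∫ τ in a..1, (tint (slice τ S) + 7 / 2 * ((τ ^ 2)⁻¹ * tint (slice τ B))) := by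
      rw [stint_def, ← Real.norm_eq_abs]
      refine intervalIntegral.norm_integral_le_of_norm_le ha1 ?_ (hSint.add (hint.const_mul _))
      refine Filter.Eventually.of_forall fun τ hτ => ?_
      have hτ0 : 0 < τ := ha.trans hτ.1
      have m := mixed_part (e := e) (slice τ U) (slice τ G) (slice τ (rough G)) p q hτ0
      -- The bound 3/2 is the reciprocal of the fourth-order weight in `IsHeat.bound`.
      have hh := high_part (e := e) (slice τ U) (slice τ (rough G)) p q hτ0 fun x => by
        have hb := hU.bound h0 ⟨hτ0.le, hτ.2⟩ x
        have n := fun j => bi_self_nonneg (sp e) j U (τ, x)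
        have n0 := n 0
        have n1 := mul_nonneg (pow_nonneg hτ0.le 1) (n 1)
        have n2 := mul_nonneg (pow_nonneg hτ0.le 2) (n 2)
        have n3 := mul_nonneg (pow_nonneg hτ0.le 3) (n 3)
        rw [← slice_bi, slice_val]
        linarith
      have e1 : slice τ R = D (e p) (D (e q) (slice τ U)) * hessBi e (slice τ G) (slice τ (rough G))
          + D (e p) (D (e q) (slice τ U)) * hess e (slice τ (rough G)) := by
        rw [hR, map_mul, map_add, slice_hess, slice_hessBi, hV]
        simp only [sp, slice_D]; ring
      have e2 : tint (slice τ S) =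
          1 / 2 * (τ ^ 2 * tint (bi e 3 (slice τ U) (slice τ U) * bi e 2 (slice τ G) (slice τ G))) := by
        have : slice τ S = (1 / 2 * τ ^ 2) •
            (bi e 3 (slice τ U) (slice τ U) * bi e 2 (slice τ G) (slice τ G)) := by
          rw [hS, map_smul, map_mul, map_mul, map_pow, slice_tm, slice_bi, slice_bi]
          exact ext_val fun x => by simp; ring
        rw [this, map_smul, smul_eq_mul]; ring
      have e3 : slice τ B = bi e 1 (slice τ (rough G)) (slice τ (rough G)) := slice_bi _ _ _ _ _
      rw [e1, e2, e3, map_add, Real.norm_eq_abs]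
      refine (abs_add_le _ _).trans ?_
      linarith
    rw [intervalIntegral.integral_add hSint (hint.const_mul _),
      intervalIntegral.integral_const_mul, ← stint_def] at hRb
    have hW := hardy_rough hG ha ha1
    have hS1 : stint a S ≤ stint 0 S := stint_le_stint ha.le ha1 fun τ hτ x => by
      simp only [hS, smul_val, mul_val, pow_val, tm_val]
      have := bi_self_nonneg (sp e) 3 U (τ, x)
      have := bi_self_nonneg (sp e) 2 G (τ, x)
      positivity
    have hS2 := (carleson_two hU hG h0).2
    rw [← hI2] at hS2 hW
    rw [← hB] at hW
    have hS3 : stint 0 S = 1 / 2 * stint 0 (tm ^ 2 * (bi (sp e) 3 U U * bi (sp e) 2 G G)) := by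
      rw [hS, map_smul, smul_eq_mul]
    rw [hsplit, map_add]
    refine (abs_add_le _ _).trans ?_
    have hI : 0 ≤ I2 := tint_nonneg (bi_self_nonneg e 2 _)
    linarith
  have hlim := ((IsHeat.rough_tendsto (e := e) G).const_mul 7).const_add (40 * I2)
  rw [mul_zero, add_zero] at hlim
  refine le_of_tendsto_of_tendsto (stint_tendsto _).abs hlim ?_
  filter_upwards [Ioc_mem_nhdsGT (zero_lt_one' ℝ)] with a ha using main a ha

end CliffordTorus
end

/-! ### Trigonometric polynomials and their heat flows -/

noncomputable section
namespace CliffordTorus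
open MeasureTheory

/-- The phase `m θ + n φ`. -/
def phase (n : ℤ × ℤ) : ℝ × ℝ →L[ℝ] ℝ :=
  (n.1 : ℝ) • ContinuousLinearMap.fst ℝ ℝ ℝ + (n.2 : ℝ) • ContinuousLinearMap.snd ℝ ℝ ℝ

lemma phase_apply (n : ℤ × ℤ) (p : ℝ × ℝ) : phase n p = n.1 * p.1 + n.2 * p.2 := by
  simp [phase]

lemma phase_add (m n : ℤ × ℤ) (p : ℝ × ℝ) : phase (m + n) p = phase m p + phase n p := by
  simp [phase_apply]; ring

lemma phase_sub (m n : ℤ × ℤ) (p : ℝ × ℝ) : phase (m - n) p = phase m p - phase n p := by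
  simp [phase_apply]; ring

lemma phase_period (n : ℤ × ℤ) {γ : ℝ × ℝ} (hγ : γ ∈ periods) :
    ∃ k : ℤ, phase n γ = k * (2 * Real.pi) := by
  rcases hγ with rfl | rfl
  · exact ⟨n.1, by simp [phase_apply]⟩
  · exact ⟨n.2, by simp [phase_apply]⟩

/-- The function `cos (m θ + n φ)`. -/
def cosT (n : ℤ × ℤ) : TF :=
  ⟨fun p => Real.cos (phase n p), Real.contDiff_cos.comp (phase n).contDiff, fun γ hγ p => by
    obtain ⟨k, hk⟩ := phase_period n hγ
    simp only [map_add, hk, Real.cos_add_int_mul_two_pi]⟩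

/-- The function `sin (m θ + n φ)`. -/
def sinT (n : ℤ × ℤ) : TF :=
  ⟨fun p => Real.sin (phase n p), Real.contDiff_sin.comp (phase n).contDiff, fun γ hγ p => by
    obtain ⟨k, hk⟩ := phase_period n hγ
    simp only [map_add, hk, Real.sin_add_int_mul_two_pi]⟩

lemma cosT_val (n : ℤ × ℤ) (p : ℝ × ℝ) : (cosT n).1 p = Real.cos (phase n p) := rfl
lemma sinT_val (n : ℤ × ℤ) (p : ℝ × ℝ) : (sinT n).1 p = Real.sin (phase n p) := rfl

lemma D_cosT (v : ℝ × ℝ) (n : ℤ × ℤ) : D v (cosT n) = -(phase n v) • sinT n := ext_val fun p => by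
  have h := ((phase n).hasFDerivAt (x := p)).cos
  rw [D_val]
  change fderiv ℝ (fun p => Real.cos (phase n p)) p v = _
  rw [h.fderiv]
  simp [sinT_val]; ring

lemma D_sinT (v : ℝ × ℝ) (n : ℤ × ℤ) : D v (sinT n) = phase n v • cosT n := ext_val fun p => by
  have h := ((phase n).hasFDerivAt (x := p)).sin
  rw [D_val]
  change fderiv ℝ (fun p => Real.sin (phase n p)) p v = _
  rw [h.fderiv]
  simp [cosT_val]; ring

/-- The eigenvalue of the frame operator on the waves of phase `n`. -/
def freq (e : Fin 2 → ℝ × ℝ) (n : ℤ × ℤ) : ℝ := phase n (e 0) ^ 2 + phase n (e 1) ^ 2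

lemma freq_nonneg (e : Fin 2 → ℝ × ℝ) (n : ℤ × ℤ) : 0 ≤ freq e n := by unfold freq; positivity

lemma lap_cosT (e : Fin 2 → ℝ × ℝ) (n : ℤ × ℤ) : lap e (cosT n) = -freq e n • cosT n := by
  refine ext_val fun p => ?_
  simp only [lap_apply, D_cosT, D_sinT, map_smul, freq]
  simp; ring

lemma lap_sinT (e : Fin 2 → ℝ × ℝ) (n : ℤ × ℤ) : lap e (sinT n) = -freq e n • sinT n := by
  refine ext_val fun p => ?_
  simp only [lap_apply, D_cosT, D_sinT, map_smul, freq]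
  simp; ring

/-- The trigonometric polynomials. -/
def trig : Submodule ℝ TF := Submodule.span ℝ (Set.range cosT ∪ Set.range sinT)

lemma cosT_mem (n : ℤ × ℤ) : cosT n ∈ trig := Submodule.subset_span (Or.inl ⟨n, rfl⟩)
lemma sinT_mem (n : ℤ × ℤ) : sinT n ∈ trig := Submodule.subset_span (Or.inr ⟨n, rfl⟩)

lemma trig_mul_mem {s t : TF} (hs : s ∈ trig) (ht : t ∈ trig) : s * t ∈ trig := by
  have cc : ∀ m n, cosT m * cosT n = (1 / 2 : ℝ) • (cosT (m - n) + cosT (m + n)) := fun m n =>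
    ext_val fun p => by
      simp [cosT_val, phase_add, phase_sub, Real.cos_add, Real.cos_sub]; ring
  have ss : ∀ m n, sinT m * sinT n = (1 / 2 : ℝ) • (cosT (m - n) - cosT (m + n)) := fun m n =>
    ext_val fun p => by
      simp [cosT_val, sinT_val, phase_add, phase_sub, Real.cos_add, Real.cos_sub]; ring
  have sc : ∀ m n, sinT m * cosT n = (1 / 2 : ℝ) • (sinT (m + n) + sinT (m - n)) := fun m n =>
    ext_val fun p => by
      simp [cosT_val, sinT_val, phase_add, phase_sub, Real.sin_add, Real.sin_sub]; ring
  induction hs using Submodule.span_induction with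
  | zero => rw [zero_mul]; exact trig.zero_mem
  | add x y _ _ hx hy => rw [add_mul]; exact trig.add_mem hx hy
  | smul r x _ hx => rw [smul_mul_assoc]; exact trig.smul_mem r hx
  | mem x hx =>
    induction ht using Submodule.span_induction with
    | zero => rw [mul_zero]; exact trig.zero_mem
    | add y z _ _ hy hz => rw [mul_add]; exact trig.add_mem hy hz
    | smul r y _ hy => rw [mul_smul_comm]; exact trig.smul_mem r hy
    | mem y hy =>
      rcases hx with ⟨m, rfl⟩ | ⟨m, rfl⟩ <;> rcases hy with ⟨n, rfl⟩ | ⟨n, rfl⟩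
      · rw [cc]; exact trig.smul_mem _ (trig.add_mem (cosT_mem _) (cosT_mem _))
      · rw [mul_comm, sc]; exact trig.smul_mem _ (trig.add_mem (sinT_mem _) (sinT_mem _))
      · rw [sc]; exact trig.smul_mem _ (trig.add_mem (sinT_mem _) (sinT_mem _))
      · rw [ss]; exact trig.smul_mem _ (trig.sub_mem (cosT_mem _) (cosT_mem _))

/-- The function `exp (-λ τ)` of time. -/
def expT (l : ℝ) : SF :=
  ⟨fun q => Real.exp (-l * q.1), by fun_prop, by rintro γ (rfl | rfl) p <;> simp⟩

lemma Dt_expT (l : ℝ) : Dt (expT l) = -l • expT l := ext_val fun q => by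
  have h1 : HasDerivAt (fun s : ℝ => Real.exp (-l * s)) (Real.exp (-l * q.1) * (-l)) q.1 := by
    simpa using ((hasDerivAt_id q.1).const_mul (-l)).exp
  have := (hasDerivAt_time (expT l) q.1 q.2).unique h1
  rw [show q = (q.1, q.2) from rfl, this]
  simp [expT]; ring

lemma slice_expT (l τ : ℝ) : slice τ (expT l) = algebraMap ℝ TF (Real.exp (-l * τ)) := rfl

@[simp] lemma D_expT (l : ℝ) (v : ℝ × ℝ) : D (0, v) (expT l) = 0 := ext_val fun q => by
  change (slice q.1 (D (0, v) (expT l))).1 q.2 = 0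
  rw [slice_D, slice_expT]; simp

lemma isHeat_expT_mul (e : Fin 2 → ℝ × ℝ) {f : TF} {l : ℝ} (hf : lap e f = -l • f) :
    IsHeat e (expT l * static f) := by
  have h1 : lap (sp e) (static f) = static (lap e f) := by
    simp only [lap_apply, sp, D_static, map_add]
  have h2 : lap (sp e) (expT l) = 0 := by simp [lap_apply, sp]
  have h3 : ∀ i, D (sp e i) (expT l) = 0 := fun i => D_expT l (e i)
  unfold IsHeat
  rw [lap_mul, h1, h2, h3, h3, hf, D_mul, Dt_expT, Dt_static]
  refine ext_val fun q => ?_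
  simp [static_val]; ring

/-- Trigonometric polynomials are initial values of the heat equation. -/
lemma exists_isHeat (e : Fin 2 → ℝ × ℝ) {t : TF} (ht : t ∈ trig) :
    ∃ G, IsHeat e G ∧ slice 0 G = t := by
  induction ht using Submodule.span_induction with
  | zero => exact ⟨0, by simp [IsHeat], by simp⟩
  | add x y _ _ hx hy =>
    obtain ⟨G, hG, h1⟩ := hx
    obtain ⟨K, hK, h2⟩ := hy
    exact ⟨G + K, by unfold IsHeat at *; rw [map_add, map_add, hG, hK], by rw [map_add, h1, h2]⟩
  | smul r x _ hx =>
    obtain ⟨G, hG, h1⟩ := hx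
    exact ⟨r • G, by unfold IsHeat at *; rw [map_smul, map_smul, hG], by rw [map_smul, h1]⟩
  | mem x hx =>
    rcases hx with ⟨n, rfl⟩ | ⟨n, rfl⟩
    · exact ⟨_, isHeat_expT_mul e (lap_cosT e n), by simp [slice_expT]⟩
    · exact ⟨_, isHeat_expT_mul e (lap_sinT e n), by simp [slice_expT]⟩

/-- On an eigenfunction 1 − Δ is multiplication by 1 + λ ≥ 1. Inverting it inside the trigonometric
polynomials turns uniform density into Sobolev density. -/
lemma exists_resolvent (e : Fin 2 → ℝ × ℝ) {t : TF} (ht : t ∈ trig) :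
    ∃ s ∈ trig, s - lap e s = t := by
  have aux : ∀ (f : TF) (l : ℝ), f ∈ trig → 0 ≤ l → lap e f = -l • f →
      ∃ s ∈ trig, s - lap e s = f := fun f l hf hl h =>
    ⟨(1 + l)⁻¹ • f, trig.smul_mem _ hf, by
      rw [map_smul, h]
      refine ext_val fun p => ?_
      have : 1 + l ≠ 0 := by positivity
      simp; field_simp⟩
  induction ht using Submodule.span_induction with
  | zero => exact ⟨0, trig.zero_mem, by simp⟩
  | add x y _ _ hx hy =>
    obtain ⟨G, hG, h1⟩ := hx
    obtain ⟨K, hK, h2⟩ := hy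
    exact ⟨G + K, trig.add_mem hG hK, by rw [map_add, ← h1, ← h2]; ring⟩
  | smul r x _ hx =>
    obtain ⟨G, hG, h1⟩ := hx
    exact ⟨r • G, trig.smul_mem _ hG, by rw [map_smul, ← smul_sub, h1]⟩
  | mem x hx =>
    rcases hx with ⟨n, rfl⟩ | ⟨n, rfl⟩
    · exact aux _ _ (cosT_mem n) (freq_nonneg e n) (lap_cosT e n)
    · exact aux _ _ (sinT_mem n) (freq_nonneg e n) (lap_sinT e n)

/-! ### Uniform density of trigonometric polynomials -/

instance : Fact (0 < 2 * Real.pi) := ⟨by positivity⟩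

/-- The torus as a product of additive circles. -/
abbrev AddTorus : Type := AddCircle (2 * Real.pi) × AddCircle (2 * Real.pi)

/-- The covering map of the torus. -/
def covering : C(ℝ × ℝ, AddTorus) :=
  ⟨Prod.map (fun x => (x : AddCircle (2 * Real.pi))) (fun x => (x : AddCircle (2 * Real.pi))),
    (AddCircle.continuous_mk' _).prodMap (AddCircle.continuous_mk' _)⟩

lemma isQuotientMap_covering : Topology.IsQuotientMap covering :=
  (IsOpenQuotientMap.prodMap QuotientAddGroup.isOpenQuotientMap_mk
    QuotientAddGroup.isOpenQuotientMap_mk).isQuotientMap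

lemma TF.factorsThrough (f : TF) :
    Function.FactorsThrough (⟨f.1, continuous_coe f⟩ : C(ℝ × ℝ, ℝ)) covering := by
  rintro ⟨x, y⟩ ⟨x', y'⟩ h
  obtain ⟨h1, h2⟩ := Prod.ext_iff.1 h
  obtain ⟨m, hm⟩ := AddSubgroup.mem_zmultiples_iff.1 (QuotientAddGroup.eq_iff_sub_mem.1 h1)
  obtain ⟨n, hn⟩ := AddSubgroup.mem_zmultiples_iff.1 (QuotientAddGroup.eq_iff_sub_mem.1 h2)
  have H1 : ∀ y : ℝ, Function.Periodic (fun x => f.1 (x, y)) (2 * Real.pi) :=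
    fun y x => TF.periodic_fst f x y
  have H2 : ∀ x : ℝ, Function.Periodic (fun y => f.1 (x, y)) (2 * Real.pi) :=
    fun x y => TF.periodic_snd f x y
  have a := ((H1 y).zsmul m) x'
  have b := ((H2 x').zsmul n) y'
  rw [hm] at a
  rw [hn] at b
  simp only [add_sub_cancel] at a b
  exact a.trans b

/-- A smooth function on the torus as a continuous function on the product of circles. -/
def TF.lift (f : TF) : C(AddTorus, ℝ) :=
  isQuotientMap_covering.lift ⟨f.1, continuous_coe f⟩ (TF.factorsThrough f)

lemma TF.lift_covering (f : TF) (p : ℝ × ℝ) : (TF.lift f) (covering p) = f.1 p :=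
  congrArg (fun g : C(ℝ × ℝ, ℝ) => g p)
    (isQuotientMap_covering.lift_comp ⟨f.1, continuous_coe f⟩ (TF.factorsThrough f))

/-- The continuous functions given by trigonometric polynomials. -/
def trigAlg : Subalgebra ℝ C(AddTorus, ℝ) where
  carrier := {g | ∃ t ∈ trig, ∀ p, g (covering p) = t.1 p}
  mul_mem' := by
    rintro f g ⟨s, hs, h1⟩ ⟨t, ht, h2⟩
    exact ⟨s * t, trig_mul_mem hs ht, fun p => by simp [h1, h2]⟩
  add_mem' := by
    rintro f g ⟨s, hs, h1⟩ ⟨t, ht, h2⟩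
    exact ⟨s + t, trig.add_mem hs ht, fun p => by simp [h1, h2]⟩
  algebraMap_mem' r := ⟨r • cosT 0, trig.smul_mem _ (cosT_mem 0), fun p => by
    simp [cosT_val, phase_apply]⟩

lemma trigAlg_separatesPoints : trigAlg.SeparatesPoints := by
  intro z w hzw
  obtain ⟨p, rfl⟩ := isQuotientMap_covering.surjective z
  obtain ⟨q, rfl⟩ := isQuotientMap_covering.surjective w
  by_contra! hcon
  have key : ∀ t ∈ trig, t.1 p = t.1 q := fun t ht => by
    have := hcon (TF.lift t) ⟨TF.lift t, ⟨t, ht, (TF.lift_covering t)⟩, rfl⟩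
    rwa [(TF.lift_covering t), (TF.lift_covering t)] at this
  apply hzw
  refine Prod.ext ?_ ?_
  · have c := key _ (cosT_mem (1, 0))
    have s := key _ (sinT_mem (1, 0))
    simp [cosT_val, sinT_val, phase_apply] at c s
    exact Real.Angle.cos_sin_inj c s
  · have c := key _ (cosT_mem (0, 1))
    have s := key _ (sinT_mem (0, 1))
    simp [cosT_val, sinT_val, phase_apply] at c s
    exact Real.Angle.cos_sin_inj c s

/-- Stone–Weierstrass on the compact product of circles, where periodic functions descend. -/
lemma trig_dense (f : TF) {ε : ℝ} (hε : 0 < ε) : ∃ t ∈ trig, ∀ p, |t.1 p - f.1 p| ≤ ε := by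
  obtain ⟨⟨g, t, ht, hg⟩, h⟩ :=
    ContinuousMap.exists_mem_subalgebra_near_continuousMap_of_separatesPoints trigAlg
      trigAlg_separatesPoints (TF.lift f) ε hε
  refine ⟨t, ht, fun p => ?_⟩
  have := (ContinuousMap.norm_coe_le_norm (g - TF.lift f) (covering p)).trans h.le
  rwa [ContinuousMap.sub_apply, hg, (TF.lift_covering f), Real.norm_eq_abs] at this

/-! ### Sobolev density -/

variable {e : Fin 2 → ℝ × ℝ}

lemma tint_mul_lap (e : Fin 2 → ℝ × ℝ) (f : TF) : tint (f * lap e f) = -tint (bi e 1 f f) := by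
  simp only [lap_apply, mul_add, map_add, bi]
  linarith [tint_D_mul (e 0) f (D (e 0) f), tint_D_mul (e 1) f (D (e 1) f)]

/-- Two integrations by parts turn the product of the pure second derivatives into the square of the
mixed one. -/
lemma tint_lap_sq (e : Fin 2 → ℝ × ℝ) (f : TF) : tint (lap e f ^ 2) = tint (bi e 2 f f) := by
  have h : tint (D (e 0) (D (e 0) f) * D (e 1) (D (e 1) f)) = tint (D (e 0) (D (e 1) f) ^ 2) := by
    rw [tint_D_mul, D_comm (e 0) (e 1), mul_comm, tint_D_mul, neg_neg, D_comm (e 1) (e 0), pow_two]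
  have e1 : lap e f ^ 2 = D (e 0) (D (e 0) f) ^ 2
      + (2:ℝ) • (D (e 0) (D (e 0) f) * D (e 1) (D (e 1) f)) + D (e 1) (D (e 1) f) ^ 2 :=
    ext_val fun p => by simp [lap_apply]; ring
  have e2 : bi e 2 f f = D (e 0) (D (e 0) f) ^ 2 + (2:ℝ) • D (e 0) (D (e 1) f) ^ 2
      + D (e 1) (D (e 1) f) ^ 2 := ext_val fun p => by rw [bi_two]; simp
  rw [e1, e2]
  simp only [map_add, map_smul, h]

lemma resolvent_identity (e : Fin 2 → ℝ × ℝ) (f : TF) : tint ((f - lap e f) ^ 2) =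
    tint (f ^ 2) + 2 * tint (bi e 1 f f) + tint (bi e 2 f f) := by
  have : (f - lap e f) ^ 2 = f ^ 2 - (2:ℝ) • (f * lap e f) + lap e f ^ 2 :=
    ext_val fun p => by simp; ring
  rw [this, map_add, map_sub, map_smul, tint_mul_lap, tint_lap_sq, smul_eq_mul]
  ring

/-- Approximate (1 − Δ)f uniformly and apply the resolvent: by `resolvent_identity` the full
second-order error is the L² norm of the error in (1 − Δ)f. -/
lemma trig_dense_sobolev (e : Fin 2 → ℝ × ℝ) (f : TF) {ε : ℝ} (hε : 0 < ε) :
    ∃ t ∈ trig, tint ((f - t) ^ 2) + 2 * tint (bi e 1 (f - t) (f - t))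
      + tint (bi e 2 (f - t) (f - t)) ≤ ε := by
  set δ := √(ε / (4 * Real.pi ^ 2)) with hδ
  have hπ := Real.pi_pos
  have hδ0 : 0 < δ := Real.sqrt_pos.2 (by positivity)
  obtain ⟨s, hs, h⟩ := trig_dense (f - lap e f) hδ0
  obtain ⟨t, ht, rfl⟩ := exists_resolvent e hs
  refine ⟨t, ht, ?_⟩
  rw [← resolvent_identity]
  have h1 : tint ((f - t - lap e (f - t)) ^ 2) ≤ tint (algebraMap ℝ TF (δ ^ 2)) := by
    refine tint_mono fun p => ?_
    have := sq_le_sq' (by linarith [(abs_le.1 (h p)).1]) (abs_le.1 (h p)).2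
    rw [map_sub (lap e)]
    simp only [sub_val, pow_val, algebraMap_val] at this ⊢
    linarith [this]
  rw [tint_algebraMap, hδ, Real.sq_sqrt (by positivity)] at h1
  have : 4 * Real.pi ^ 2 * (ε / (4 * Real.pi ^ 2)) = ε := by field_simp
  linarith

end CliffordTorus
end

/-! ### Density argument and L¹ duality -/

noncomputable section
namespace CliffordTorus
open MeasureTheory

variable {e : Fin 2 → ℝ × ℝ}

lemma le_of_forall_small {a b K : ℝ} (hK : 0 ≤ K) (h : ∀ x, 0 < x → x ≤ 1 → a ≤ b + x * K) :
    a ≤ b := by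
  refine le_of_forall_pos_le_add fun ε hε => ?_
  have hx : 0 < min 1 (ε / (K + 1)) := lt_min one_pos (by positivity)
  have h1 := h _ hx (min_le_left _ _)
  have h2 : min 1 (ε / (K + 1)) * K ≤ ε := by
    calc min 1 (ε / (K + 1)) * K ≤ ε / (K + 1) * K :=
          mul_le_mul_of_nonneg_right (min_le_right _ _) hK
      _ ≤ ε / (K + 1) * (K + 1) := mul_le_mul_of_nonneg_left (by linarith) (by positivity)
      _ = ε := by field_simp
  linarith

/-- A merely qualitative bound: it enters only multiplied by errors that tend to zero. -/
lemma exists_bound (V : SF) : ∃ M, 0 ≤ M ∧ ∀ τ ∈ Set.Icc (0:ℝ) 1, ∀ p, |V.1 (τ, p)| ≤ M := by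
  have hK : IsCompact (Set.Icc (0:ℝ) 1 ×ˢ
      (Set.Icc 0 (2 * Real.pi) ×ˢ Set.Icc 0 (2 * Real.pi)) : Set (ℝ × (ℝ × ℝ))) :=
    isCompact_Icc.prod (isCompact_Icc.prod isCompact_Icc)
  obtain ⟨C, hC⟩ := hK.exists_bound_of_continuousOn (continuous_coe V).continuousOn
  refine ⟨max C 0, le_max_right _ _, fun τ hτ p => ?_⟩
  obtain ⟨q, hq, h⟩ := TF.exists_mem_square p
  have := hC (τ, q) ⟨hτ, hq⟩
  have h2 := h (slice τ V)
  rw [slice_val, slice_val] at h2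
  rw [← h2]
  exact this.trans (le_max_left _ _)

lemma stint_static (f : TF) : stint 0 (static f) = tint f := by
  simp [stint_def]

lemma stint_mul_static_le {V : SF} {M : ℝ}
    (hM : ∀ τ ∈ Set.Icc (0:ℝ) 1, ∀ p, |V.1 (τ, p)| ≤ M) {X Y : TF}
    (hXY : ∀ p, |X.1 p| ≤ Y.1 p) : |stint 0 (V * static X)| ≤ M * tint Y := by
  have pt : ∀ τ ∈ Set.Icc (0:ℝ) 1, ∀ p, |(V * static X).1 (τ, p)| ≤ (static (M • Y)).1 (τ, p) :=
    fun τ hτ p => by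
      simp only [mul_val, static_val, smul_val, abs_mul]
      exact mul_le_mul (hM τ hτ p) (hXY p) (abs_nonneg _) ((abs_nonneg _).trans (hM τ hτ p))
  have hs : M * tint Y = stint 0 (static (M • Y)) := by rw [stint_static, map_smul, smul_eq_mul]
  rw [hs, abs_le, ← map_neg (stint 0)]
  exact ⟨stint_mono' zero_le_one fun τ hτ x => (abs_le.1 (pt τ hτ x)).1,
    stint_mono' zero_le_one fun τ hτ x => (abs_le.1 (pt τ hτ x)).2⟩

/-- The bound for the Hessian pairing. -/
lemma hess_pairing {U : SF} (hU : IsHeat e U) (h0 : ∀ p, |U.1 (0, p)| ≤ 1) (p q : Fin 2) (h : TF) :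
    |stint 0 (D (sp e p) (D (sp e q) U) * static (hess e h))| ≤ 40 * tint (bi e 2 h h) := by
  set V := D (sp e p) (D (sp e q) U) with hV
  obtain ⟨M, hM0, hM⟩ := exists_bound V
  set y := tint (bi e 2 h h) with hy
  have hy0 : 0 ≤ y := tint_nonneg (bi_self_nonneg e 2 h)
  -- The second-order error r is of size x while Young's inequality is weighted by x. All terms
  -- involving the qualitative bound M are then O(x) and vanish as x tends to 0.
  refine le_of_forall_small (K := 40 * y + 80 + M * (y + 2)) (by positivity) fun x hx hx1 => ?_
  obtain ⟨t, ht, hr⟩ := trig_dense_sobolev e h (ε := x ^ 2) (by positivity)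
  obtain ⟨G, hG, rfl⟩ := exists_isHeat e ht
  have hA := hess_pairing_heat hU hG h0 p q
  rw [← hV] at hA
  set t := slice 0 G
  set r := h - t with hrdef
  have hr2 : tint (bi e 2 r r) ≤ x ^ 2 := by
    have a := tint_sq_nonneg r
    have b := tint_nonneg (bi_self_nonneg e 1 r)
    linarith
  have hr0 : 0 ≤ tint (bi e 2 r r) := tint_nonneg (bi_self_nonneg e 2 r)
  have hinv : x * x⁻¹ = 1 := mul_inv_cancel₀ hx.ne'
  have hxi : 0 < x⁻¹ := inv_pos.2 hx
  have ht2 : tint (bi e 2 t t) ≤ (1 + x) * y + (1 + x⁻¹) * tint (bi e 2 r r) := by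
    rw [hy, ← smul_eq_mul, ← smul_eq_mul, ← map_smul, ← map_smul, ← map_add]
    refine tint_mono fun z => ?_
    have htr : t = h - r := by rw [hrdef]; ring
    have sq : ∀ u v : ℝ, (u - v) ^ 2 ≤ (1 + x) * u ^ 2 + (1 + x⁻¹) * v ^ 2 := fun u v => by
      have h1 : (1 + x) * u ^ 2 + (1 + x⁻¹) * v ^ 2 - (u - v) ^ 2 = x⁻¹ * (x * u + v) ^ 2 := by
        linear_combination -(x * u ^ 2 + 2 * u * v) * hinv
      have h2 : 0 ≤ x⁻¹ * (x * u + v) ^ 2 := by positivity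
      linarith
    rw [htr]
    simp only [bi_two, map_sub, add_val, mul_val, pow_val, sub_val, two_val, smul_val]
    linarith [sq ((D (e 0) (D (e 0) h)).1 z) ((D (e 0) (D (e 0) r)).1 z),
      sq ((D (e 0) (D (e 1) h)).1 z) ((D (e 0) (D (e 1) r)).1 z),
      sq ((D (e 1) (D (e 1) h)).1 z) ((D (e 1) (D (e 1) r)).1 z)]
  have hB : |stint 0 (V * static (hessBi e t r))| ≤
      M * (1 / 2 * x * tint (bi e 2 t t) + 1 / 2 * x⁻¹ * tint (bi e 2 r r)) := by
    rw [← smul_eq_mul (1 / 2 * x), ← smul_eq_mul (1 / 2 * x⁻¹), ← map_smul, ← map_smul, ← map_add]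
    refine stint_mul_static_le hM fun z => ?_
    have h2 := mul_form_sq_le x ((D (e 0) (D (e 0) t)).1 z)
      ((D (e 0) (D (e 1) t)).1 z) ((D (e 1) (D (e 1) t)).1 z)
      ((D (e 0) (D (e 0) r)).1 z) ((D (e 0) (D (e 1) r)).1 z) ((D (e 1) (D (e 1) r)).1 z)
    rw [abs_mul, abs_of_pos hx] at h2
    simp only [hessBi, bi_two, add_val, mul_val, pow_val, sub_val, two_val, smul_val]
    have key : ∀ w A S : ℝ, 2 * (x * w) ≤ x ^ 2 * A + S → w ≤ 1 / 2 * x * A + 1 / 2 * x⁻¹ * S :=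
      fun w A S hw => by
        have h3 := mul_le_mul_of_nonneg_left hw (by positivity : 0 ≤ 1 / 2 * x⁻¹)
        have h4 : 1 / 2 * x⁻¹ * (2 * (x * w)) = w := by linear_combination w * hinv
        have h5 : 1 / 2 * x⁻¹ * (x ^ 2 * A + S) = 1 / 2 * x * A + 1 / 2 * x⁻¹ * S := by
          linear_combination x / 2 * A * hinv
        linarith
    exact key _ _ _ h2
  have hC : |stint 0 (V * static (hess e r))| ≤ M * (1 / 2 * tint (bi e 2 r r)) := by
    rw [← smul_eq_mul (1 / 2 : ℝ), ← map_smul]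
    refine stint_mul_static_le hM fun z => ?_
    simp only [hess, bi_two, add_val, mul_val, pow_val, sub_val, two_val, smul_val]
    rw [abs_le]
    constructor <;> nlinarith [sq_nonneg ((D (e 0) (D (e 0) r)).1 z + (D (e 1) (D (e 1) r)).1 z),
      sq_nonneg ((D (e 0) (D (e 0) r)).1 z - (D (e 1) (D (e 1) r)).1 z),
      sq_nonneg ((D (e 0) (D (e 1) r)).1 z)]
  have hsplit : V * static (hess e h) = V * static (hess e t) + V * static (hessBi e t r)
      + V * static (hess e r) := by
    have : h = t + r := by rw [hrdef]; ring
    rw [this, hess_add]; simp only [map_add]; ring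
  rw [hsplit, map_add, map_add]
  refine (abs_add_three _ _ _).trans ?_
  have k1 : x⁻¹ * tint (bi e 2 r r) ≤ x := by
    calc x⁻¹ * tint (bi e 2 r r) ≤ x⁻¹ * x ^ 2 := mul_le_mul_of_nonneg_left hr2 hxi.le
      _ = x := by field_simp
  have k2 : tint (bi e 2 r r) ≤ x := hr2.trans (by nlinarith)
  have k3 : tint (bi e 2 t t) ≤ (1 + x) * y + 2 * x := by linarith
  have k4 : tint (bi e 2 t t) ≤ 2 * y + 2 := by nlinarith
  have k5 : 1 / 2 * x * tint (bi e 2 t t) + 1 / 2 * x⁻¹ * tint (bi e 2 r r)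
      + 1 / 2 * tint (bi e 2 r r) ≤ x * (y + 2) := by nlinarith
  have k6 := mul_le_mul_of_nonneg_left k5 hM0
  nlinarith

lemma tint_abs_le_integral {f g : TF} (h : ∀ p, |f.1 p| ≤ 1) :
    |tint (f * g)| ≤ ∫ p, |g.1 p| ∂flatMeasure := by
  rw [tint_def, ← Real.norm_eq_abs]
  refine norm_integral_le_of_norm_le (continuous_coe g).abs.integrable_flat
    (Filter.Eventually.of_forall fun p => ?_)
  rw [mul_val, norm_mul]
  exact mul_le_of_le_one_left (norm_nonneg _) (h p)

/-- Duality: the `L¹` norm is computed by bounded initial values of the heat equation. -/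
lemma integral_abs_le_of_heat (e : Fin 2 → ℝ × ℝ) (v : TF) {K : ℝ}
    (h : ∀ U, IsHeat e U → (∀ p, |U.1 (0, p)| ≤ 1) → |tint (slice 0 U * v)| ≤ K) :
    ∫ p, |v.1 p| ∂flatMeasure ≤ K := by
  set L := ∫ p, |v.1 p| ∂flatMeasure with hL
  have hL0 : 0 ≤ L := integral_nonneg fun p => abs_nonneg _
  have hK0 : 0 ≤ K := (abs_nonneg _).trans (h 0 (by simp [IsHeat]) (by simp))
  have hπ := Real.pi_pos
  refine le_of_forall_small (K := 4 * Real.pi ^ 2 + K + L) (by positivity) fun x hx hx1 => ?_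
  -- The sign of v is replaced by the smooth function v / √(v² + x²).
  have hsm : ContDiff ℝ ∞ fun s : ℝ => s / √(s ^ 2 + x ^ 2) := by
    refine contDiff_id.div ((contDiff_id.pow 2 |>.add contDiff_const).sqrt fun s => ?_) fun s => ?_
    · simp only [id]; positivity
    · have : 0 < √(s ^ 2 + x ^ 2) := Real.sqrt_pos.2 (by positivity)
      simpa using this.ne'
  set ψ : TF := compReal _ hsm v with hψ
  have hψv : ∀ p, ψ.1 p = v.1 p / √(v.1 p ^ 2 + x ^ 2) := fun p => rfl
  have hsq : ∀ p, |v.1 p| ≤ √(v.1 p ^ 2 + x ^ 2) := fun p =>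
    Real.abs_le_sqrt (by nlinarith [sq_nonneg x])
  have hpos : ∀ p, 0 < √(v.1 p ^ 2 + x ^ 2) := fun p => Real.sqrt_pos.2 (by positivity)
  have hψ1 : ∀ p, |ψ.1 p| ≤ 1 := fun p => by
    rw [hψv, abs_div, abs_of_pos (hpos p)]
    exact div_le_one_of_le₀ (hsq p) (hpos p).le
  have hlow : ∀ p, |v.1 p| - x ≤ (ψ * v).1 p := fun p => by
    rw [mul_val, hψv, div_mul_eq_mul_div, le_div_iff₀ (hpos p), ← sq]
    have h1 : √(v.1 p ^ 2 + x ^ 2) ≤ |v.1 p| + x := by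
      rw [Real.sqrt_le_left (by positivity)]
      nlinarith [sq_abs (v.1 p), mul_nonneg (abs_nonneg (v.1 p)) hx.le]
    have h3 := sq_abs (v.1 p)
    have h4 := hpos p
    generalize √(v.1 p ^ 2 + x ^ 2) = R at *
    rcases le_total (|v.1 p|) x with h2 | h2
    · nlinarith [mul_nonneg (sub_nonneg.2 h2) h4.le, sq_nonneg (v.1 p)]
    · nlinarith [mul_le_mul_of_nonneg_left h1 (sub_nonneg.2 h2), sq_nonneg x]
  -- An exact heat evolution is available for trigonometric polynomials; the factor (1 + x)⁻¹
  -- restores the bound by one after approximation.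
  obtain ⟨t, ht, htψ⟩ := trig_dense ψ hx
  obtain ⟨G, hG, hGt⟩ := exists_isHeat e ht
  have h1 := h ((1 + x)⁻¹ • G) (by unfold IsHeat at *; rw [map_smul, map_smul, hG]) fun p => by
    have h2 : |G.1 (0, p)| ≤ 1 + x := by
      rw [← slice_val, hGt]
      have := abs_sub_abs_le_abs_sub (t.1 p) (ψ.1 p)
      linarith [htψ p, hψ1 p]
    rw [smul_val, abs_mul, abs_of_pos (by positivity : 0 < (1 + x)⁻¹)]
    rw [inv_mul_le_iff₀ (by positivity)]
    linarith
  rw [map_smul, smul_mul_assoc, map_smul, smul_eq_mul, abs_mul,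
    abs_of_pos (by positivity : 0 < (1 + x)⁻¹), inv_mul_le_iff₀ (by positivity), hGt] at h1
  have h2 : |tint (x⁻¹ • (ψ - t) * v)| ≤ L := tint_abs_le_integral fun p => by
    rw [smul_val, sub_val, abs_mul, abs_of_pos (inv_pos.2 hx), inv_mul_le_iff₀ hx, abs_sub_comm]
    linarith [htψ p]
  rw [smul_mul_assoc, map_smul, smul_eq_mul, abs_mul, abs_of_pos (inv_pos.2 hx),
    inv_mul_le_iff₀ hx, sub_mul, map_sub] at h2
  have h3 : L - 4 * Real.pi ^ 2 * x ≤ tint (ψ * v) := by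
    have h4 : ∫ p, (|v.1 p| - x) ∂flatMeasure ≤ tint (ψ * v) :=
      integral_mono ((continuous_coe v).abs.integrable_flat.sub (integrable_const x))
        (continuous_coe (ψ * v)).integrable_flat hlow
    rw [integral_sub (continuous_coe v).abs.integrable_flat (integrable_const x)] at h4
    have h5 : ∫ _, x ∂flatMeasure = 4 * Real.pi ^ 2 * x := tint_algebraMap x
    rwa [h5] at h4
  have h6 := le_abs_self (tint (t * v))
  have h7 := le_abs_self (tint (ψ * v) - tint (t * v))
  nlinarith

/-- The `L¹` bound for the second derivatives of a function whose frame Laplacian is a sum of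
Hessian determinants. -/
theorem integral_abs_second_deriv_le {ι : Type*} (s : Finset ι) (c : ι → ℝ) (h : ι → TF) (φ : TF)
    (hφ : lap e φ = ∑ i ∈ s, c i • hess e (h i)) (p q : Fin 2) :
    ∫ x, |(D (e p) (D (e q) φ)).1 x| ∂flatMeasure ≤
      ∫ x, |φ.1 x| ∂flatMeasure + 40 * ∑ i ∈ s, |c i| * tint (bi e 2 (h i) (h i)) := by
  refine integral_abs_le_of_heat e _ fun U hU h0 => ?_
  set v := D (e p) (D (e q) φ) with hv
  set V := D (sp e p) (D (sp e q) U) with hV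
  have ibp : ∀ (a b : ℝ × ℝ) (A B : TF), tint (A * D a (D b B)) = tint (D b (D a A) * B) :=
    fun a b A B => by
      have h1 := tint_D_mul a A (D b B)
      have h2 := tint_D_mul b (D a A) B
      linarith
  have h1 := stint_Dt 0 (U * static v)
  -- The heat operator on U is the frame Laplacian; moving it and the two derivatives across the
  -- integral exchanges them between U and φ.
  have h2 : stint 0 (Dt (U * static v)) = stint 0 (V * static (lap e φ)) := by
    rw [stint_def, stint_def]
    congr 1
    funext τ
    rw [D_mul, Dt_static, mul_zero, add_zero, hU, map_mul (slice τ), map_mul (slice τ), slice_lap, slice_static,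
      slice_static, tint_lap_mul, hV, hv]
    simp only [sp, slice_D]
    rw [← D_lap, ← D_lap, ibp, D_comm]
  rw [h2, map_mul (slice 1), map_mul (slice 0), slice_static, slice_static] at h1
  -- At time one U is already smooth: the two derivatives fall on it and are bounded by
  -- `IsHeat.bound`, leaving only the L¹ norm of φ.
  have h3 : |tint (slice 1 U * v)| ≤ ∫ x, |φ.1 x| ∂flatMeasure := by
    rw [hv, ibp, D_comm]
    refine tint_abs_le_integral fun x => ?_
    have hb := hU.bound h0 (Set.right_mem_Icc.2 zero_le_one) x
    have n := fun j => bi_self_nonneg (sp e) j U (1, x)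
    have n0 := n 0
    have n1 := n 1
    have n3 := n 3
    have n4 := n 4
    have h4 := (bi_D_le (sp e) 0 p (D (sp e q) U) (1, x)).trans (bi_D_le (sp e) 1 q U (1, x))
    have h5 : (bi (sp e) 0 (D (sp e p) (D (sp e q) U)) (D (sp e p) (D (sp e q) U))).1 (1, x) =
        (D (e p) (D (e q) (slice 1 U))).1 x ^ 2 := by
      rw [← slice_D, ← slice_D, slice_val, pow_two]; rfl
    rw [h5] at h4
    rw [← sq_le_one_iff_abs_le_one]
    linarith
  have h4 : |stint 0 (V * static (lap e φ))| ≤ 40 * ∑ i ∈ s, |c i| * tint (bi e 2 (h i) (h i)) := by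
    rw [hφ, map_sum, Finset.mul_sum, map_sum, Finset.mul_sum]
    refine (Finset.abs_sum_le_sum_abs _ _).trans (Finset.sum_le_sum fun i _ => ?_)
    rw [map_smul, mul_smul_comm, map_smul, smul_eq_mul, abs_mul]
    have := mul_le_mul_of_nonneg_left (hess_pairing hU h0 p q (h i)) (abs_nonneg (c i))
    linarith
  have h5 : tint (slice 0 U * v) = tint (slice 1 U * v) - stint 0 (V * static (lap e φ)) := by
    linarith
  rw [h5]
  exact (abs_sub _ _).trans (add_le_add h3 h4)

end CliffordTorus
end

noncomputable section
namespace CliffordTorus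
open MeasureTheory

/-! ### Spectral estimates -/

/-- The coordinate frame, whose operator is the flat Laplacian `∂_θ² + ∂_φ²`. -/
abbrev std : Fin 2 → ℝ × ℝ := coordVec

lemma freq_std (n : ℤ × ℤ) : freq std n = ((n.1 ^ 2 + n.2 ^ 2 : ℤ) : ℝ) := by
  simp [freq, phase_apply, std, coordVec]

/-- The trigonometric polynomials of given frequency. -/
def eigen (k : ℕ) : Submodule ℝ TF :=
  Submodule.span ℝ {f | ∃ n : ℤ × ℤ, n.1 ^ 2 + n.2 ^ 2 = k ∧ (f = cosT n ∨ f = sinT n)}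

lemma lap_of_mem_eigen {k : ℕ} {f : TF} (hf : f ∈ eigen k) : lap std f = -(k : ℝ) • f := by
  induction hf using Submodule.span_induction with
  | zero => simp
  | add x y _ _ hx hy => rw [map_add, hx, hy, smul_add]
  | smul r x _ hx => rw [map_smul, hx, smul_comm]
  | mem x hx =>
    obtain ⟨n, hn, rfl | rfl⟩ := hx
    · rw [lap_cosT, freq_std, hn]; simp
    · rw [lap_sinT, freq_std, hn]; simp

lemma exists_eigen_sum {t : TF} (ht : t ∈ trig) :
    ∃ T : ℕ →₀ TF, (∀ k, T k ∈ eigen k) ∧ ∑ k ∈ T.support, T k = t := by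
  have hle : trig ≤ ⨆ k, eigen k := by
    refine Submodule.span_le.2 ?_
    have aux : ∀ n : ℤ × ℤ, ∃ k : ℕ, n.1 ^ 2 + n.2 ^ 2 = k := fun n =>
      ⟨(n.1 ^ 2 + n.2 ^ 2).toNat, by rw [Int.toNat_of_nonneg (by positivity)]⟩
    rintro f (⟨n, rfl⟩ | ⟨n, rfl⟩) <;> obtain ⟨k, hk⟩ := aux n <;>
      refine Submodule.mem_iSup_of_mem k (Submodule.subset_span ⟨n, hk, ?_⟩) <;> simp
  obtain ⟨T, hT, hsum⟩ := (Submodule.mem_iSup_iff_exists_finsupp _ _).1 (hle ht)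
  exact ⟨T, hT, hsum⟩

lemma tint_mul_eq_zero_of_eigen {k l : ℕ} (hkl : k ≠ l) {f g : TF} (hf : f ∈ eigen k)
    (hg : g ∈ eigen l) : tint (f * g) = 0 := by
  have h := tint_lap_mul std f g
  rw [lap_of_mem_eigen hf, lap_of_mem_eigen hg, smul_mul_assoc, mul_smul_comm, map_smul, map_smul,
    smul_eq_mul, smul_eq_mul] at h
  have h2 : ((k : ℝ) - l) * tint (f * g) = 0 := by linarith
  rcases mul_eq_zero.1 h2 with h3 | h3
  · exact absurd (Nat.cast_injective (R := ℝ) (by linarith)) hkl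
  · exact h3

lemma tint_eigen_sum (T : ℕ →₀ TF) (hT : ∀ k, T k ∈ eigen k) (c d : ℕ → ℝ) :
    tint ((∑ k ∈ T.support, c k • T k) * (∑ k ∈ T.support, d k • T k)) =
      ∑ k ∈ T.support, c k * d k * tint (T k ^ 2) := by
  rw [Finset.sum_mul_sum, map_sum]
  refine Finset.sum_congr rfl fun k hk => ?_
  rw [map_sum, Finset.sum_eq_single k]
  · rw [smul_mul_smul_comm, map_smul, smul_eq_mul, pow_two]
  · intro l _ hl
    rw [smul_mul_smul_comm, map_smul, tint_mul_eq_zero_of_eigen hl.symm (hT k) (hT l), smul_zero]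
  · intro h; exact absurd hk h

lemma tint_cosT_eq_zero {n : ℤ × ℤ} (hn : n ≠ 0) : tint (cosT n) = 0 ∧ tint (sinT n) = 0 := by
  have h1 := tint_lap std (cosT n)
  have h2 := tint_lap std (sinT n)
  have h3 : freq std n ≠ 0 := by
    rw [freq_std]
    intro h
    have h4 : n.1 ^ 2 + n.2 ^ 2 = 0 := by exact_mod_cast h
    apply hn
    have h5 : n.1 = 0 := by nlinarith [sq_nonneg n.1, sq_nonneg n.2]
    have h6 : n.2 = 0 := by nlinarith [sq_nonneg n.1, sq_nonneg n.2]
    exact Prod.ext h5 h6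
  rw [lap_cosT, map_smul, smul_eq_mul] at h1
  rw [lap_sinT, map_smul, smul_eq_mul] at h2
  constructor
  · exact (mul_eq_zero.1 h1).resolve_left (neg_ne_zero.2 h3)
  · exact (mul_eq_zero.1 h2).resolve_left (neg_ne_zero.2 h3)

lemma cosT_mul_cosT (m n : ℤ × ℤ) : cosT m * cosT n = (1 / 2 : ℝ) • (cosT (m - n) + cosT (m + n)) :=
  ext_val fun p => by simp [cosT_val, phase_add, phase_sub, Real.cos_add, Real.cos_sub]; ring
lemma sinT_mul_sinT (m n : ℤ × ℤ) : sinT m * sinT n = (1 / 2 : ℝ) • (cosT (m - n) - cosT (m + n)) :=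
  ext_val fun p => by simp [cosT_val, sinT_val, phase_add, phase_sub, Real.cos_add, Real.cos_sub]; ring
lemma sinT_mul_cosT (m n : ℤ × ℤ) : sinT m * cosT n = (1 / 2 : ℝ) • (sinT (m + n) + sinT (m - n)) :=
  ext_val fun p => by simp [cosT_val, sinT_val, phase_add, phase_sub, Real.sin_add, Real.sin_sub]; ring

lemma cosT_zero : cosT 0 = algebraMap ℝ TF 1 := ext_val fun p => by simp [cosT_val, phase_apply]
lemma sinT_zero : sinT 0 = 0 := ext_val fun p => by simp [sinT_val, phase_apply]

/-- An orthogonal basis of the trigonometric polynomials of frequency two. -/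
def kernelBasis : Fin 4 → TF := ![cosT (1, 1), sinT (1, 1), cosT (1, -1), sinT (1, -1)]

lemma kernelBasis_mem (i : Fin 4) : kernelBasis i ∈ eigen 2 := by
  fin_cases i
  · exact Submodule.subset_span ⟨(1, 1), by norm_num, Or.inl rfl⟩
  · exact Submodule.subset_span ⟨(1, 1), by norm_num, Or.inr rfl⟩
  · exact Submodule.subset_span ⟨(1, -1), by norm_num, Or.inl rfl⟩
  · exact Submodule.subset_span ⟨(1, -1), by norm_num, Or.inr rfl⟩

lemma tint_kernelBasis_mul (i j : Fin 4) :
    tint (kernelBasis i * kernelBasis j) = if i = j then 2 * Real.pi ^ 2 else 0 := by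
  have c0 : tint (cosT 0) = 4 * Real.pi ^ 2 := by rw [cosT_zero, tint_algebraMap, mul_one]
  have s0 : tint (sinT 0) = 0 := by rw [sinT_zero, map_zero]
  have cc := fun n : ℤ × ℤ => fun hn : n ≠ 0 => (tint_cosT_eq_zero hn).1
  have ss := fun n : ℤ × ℤ => fun hn : n ≠ 0 => (tint_cosT_eq_zero hn).2
  have cs : ∀ m n, cosT m * sinT n = sinT n * cosT m := fun m n => mul_comm _ _
  fin_cases i <;> fin_cases j <;>
    simp [kernelBasis, cs, cosT_mul_cosT, sinT_mul_sinT, sinT_mul_cosT, c0, s0, cc, ss] <;> ring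

lemma cosT_neg (n : ℤ × ℤ) : cosT (-n) = cosT n := ext_val fun p => by
  simp [cosT_val, phase_apply]
  rw [← Real.cos_neg]; ring_nf

lemma sinT_neg (n : ℤ × ℤ) : sinT (-n) = (-1 : ℝ) • sinT n := ext_val fun p => by
  simp [sinT_val, phase_apply]
  rw [← Real.sin_neg]; ring_nf

lemma sq_eq_one_of_sq_add_sq_eq_two {m n : ℤ} (h : m ^ 2 + n ^ 2 = 2) : m ^ 2 = 1 ∧ n ^ 2 = 1 := by
  have : n ≤ 1 := by nlinarith [sq_nonneg m]
  have : -1 ≤ n := by nlinarith [sq_nonneg m]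
  have : m ≤ 1 := by nlinarith [sq_nonneg n]
  have : -1 ≤ m := by nlinarith [sq_nonneg n]
  interval_cases n <;> interval_cases m <;> simp_all

/-- The lattice points with m² + n² = 2 are (±1, ±1), and opposite points give the same waves up to
sign. -/
lemma eigen_two_le : eigen 2 ≤ Submodule.span ℝ (Set.range kernelBasis) := by
  refine Submodule.span_le.2 ?_
  rintro f ⟨⟨m, n⟩, h, hf⟩
  have mem : ∀ i, kernelBasis i ∈ Submodule.span ℝ (Set.range kernelBasis) :=
    fun i => Submodule.subset_span ⟨i, rfl⟩
  obtain ⟨hm, hn⟩ := sq_eq_one_of_sq_add_sq_eq_two (m := m) (n := n) (by exact_mod_cast h)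
  have m0 := mem 0
  have m1 := mem 1
  have m2 := mem 2
  have m3 := mem 3
  generalize Submodule.span ℝ (Set.range kernelBasis) = S at *
  have k0 : kernelBasis 0 = cosT (1, 1) := rfl
  have k1 : kernelBasis 1 = sinT (1, 1) := rfl
  have k2 : kernelBasis 2 = cosT (1, -1) := rfl
  have k3 : kernelBasis 3 = sinT (1, -1) := rfl
  rw [k0] at m0
  rw [k1] at m1
  rw [k2] at m2
  rw [k3] at m3
  have e1 : ((-1, 1) : ℤ × ℤ) = -(1, -1) := by simp
  have e2 : ((-1, -1) : ℤ × ℤ) = -(1, 1) := by simp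
  have all : cosT (m, n) ∈ S ∧ sinT (m, n) ∈ S := by
    rcases sq_eq_one_iff.1 hm with rfl | rfl <;> rcases sq_eq_one_iff.1 hn with rfl | rfl
    · exact ⟨m0, m1⟩
    · exact ⟨m2, m3⟩
    · rw [e1, cosT_neg, sinT_neg]; exact ⟨m2, Submodule.smul_mem _ _ m3⟩
    · rw [e2, cosT_neg, sinT_neg]; exact ⟨m0, Submodule.smul_mem _ _ m1⟩
  rcases hf with rfl | rfl
  · exact all.1
  · exact all.2

lemma tint_sq_eigen_two {f : TF} (hf : f ∈ eigen 2) :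
    tint (f ^ 2) = (2 * Real.pi ^ 2)⁻¹ * ∑ i, tint (kernelBasis i * f) ^ 2 := by
  obtain ⟨a, rfl⟩ := (Submodule.mem_span_range_iff_exists_fun ℝ).1 (eigen_two_le hf)
  have h1 : ∀ i, tint (kernelBasis i * ∑ j, a j • kernelBasis j) = 2 * Real.pi ^ 2 * a i := fun i => by
    rw [Finset.mul_sum, map_sum]
    simp only [mul_smul_comm, map_smul, tint_kernelBasis_mul, smul_eq_mul, mul_ite, mul_zero]
    simp; ring
  have h2 : tint ((∑ j, a j • kernelBasis j) ^ 2) = ∑ i, 2 * Real.pi ^ 2 * a i * a i := by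
    rw [pow_two, Finset.sum_mul, map_sum]
    refine Finset.sum_congr rfl fun i _ => ?_
    rw [smul_mul_assoc, map_smul, h1, smul_eq_mul]; ring
  have hπ := Real.pi_pos
  rw [h2, Finset.mul_sum]
  refine Finset.sum_congr rfl fun i _ => ?_
  rw [h1]; field_simp

lemma eigen_zero_le {f : TF} (hf : f ∈ eigen 0) : ∃ r : ℝ, f = algebraMap ℝ TF r := by
  induction hf using Submodule.span_induction with
  | zero => exact ⟨0, by simp⟩
  | add x y _ _ hx hy =>
    obtain ⟨a, rfl⟩ := hx; obtain ⟨b, rfl⟩ := hy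
    exact ⟨a + b, by simp⟩
  | smul r x _ hx => obtain ⟨a, rfl⟩ := hx; exact ⟨r * a, ext_val fun p => by simp⟩
  | mem x hx =>
    obtain ⟨⟨m, n⟩, h, hf⟩ := hx
    have h' : m ^ 2 + n ^ 2 = 0 := by exact_mod_cast h
    have h5 : m = 0 := by nlinarith [sq_nonneg m, sq_nonneg n]
    have h6 : n = 0 := by nlinarith [sq_nonneg m, sq_nonneg n]
    subst h5 h6
    rcases hf with rfl | rfl
    · exact ⟨1, cosT_zero⟩
    · exact ⟨0, by rw [map_zero]; exact sinT_zero⟩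

lemma eigen_mul_sum (T : ℕ →₀ TF) (hT : ∀ k, T k ∈ eigen k) {l : ℕ} {g : TF} (hg : g ∈ eigen l) :
    tint (g * ∑ k ∈ T.support, T k) = tint (g * T l) := by
  rw [Finset.mul_sum, map_sum, Finset.sum_eq_single l]
  · intro k _ hk; exact tint_mul_eq_zero_of_eigen hk.symm hg (hT k)
  · intro h; rw [Finsupp.notMem_support_iff.1 h, mul_zero, map_zero]

lemma lap_eigen_sum (T : ℕ →₀ TF) (hT : ∀ k, T k ∈ eigen k) :
    lap std (∑ k ∈ T.support, T k) = ∑ k ∈ T.support, (-(k : ℝ)) • T k := by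
  rw [map_sum]
  exact Finset.sum_congr rfl fun k _ => lap_of_mem_eigen (hT k)

/-- The eigenvalues of −Δ are integers k, so (2 − k)² ≥ 1 away from k = 2; the remaining eigenspace
is measured by its orthogonal basis. -/
lemma spectral_gap_trig {t : TF} (ht : t ∈ trig) :
    tint (t ^ 2) ≤ tint ((lap std t + 2 * t) ^ 2) +
      (2 * Real.pi ^ 2)⁻¹ * ∑ i, tint (kernelBasis i * t) ^ 2 := by
  obtain ⟨T, hT, rfl⟩ := exists_eigen_sum ht
  have h1 := tint_eigen_sum T hT (fun _ => 1) (fun _ => 1)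
  have h2 := tint_eigen_sum T hT (fun k => 2 - k) (fun k => 2 - k)
  have h3 : lap std (∑ k ∈ T.support, T k) + 2 * ∑ k ∈ T.support, T k =
      ∑ k ∈ T.support, (2 - (k : ℝ)) • T k := by
    rw [lap_eigen_sum T hT, Finset.mul_sum, ← Finset.sum_add_distrib]
    exact Finset.sum_congr rfl fun k _ => ext_val fun p => by simp; ring
  simp only [one_smul, one_mul] at h1
  rw [h3, pow_two, pow_two, h1, h2]
  have h4 : ∑ i, tint (kernelBasis i * ∑ k ∈ T.support, T k) ^ 2 =
      ∑ i, tint (kernelBasis i * T 2) ^ 2 :=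
    Finset.sum_congr rfl fun i _ => by rw [eigen_mul_sum T hT (kernelBasis_mem i)]
  rw [h4, ← tint_sq_eigen_two (hT 2)]
  have h5 : ∀ k ∈ T.support, tint (T k ^ 2) ≤ (2 - (k : ℝ)) * (2 - k) * tint (T k ^ 2) +
      if k = 2 then tint (T 2 ^ 2) else 0 := fun k _ => by
    have n := tint_sq_nonneg (T k)
    split_ifs with hk
    · subst hk; simp
    · have : (1:ℝ) ≤ (2 - (k : ℝ)) * (2 - k) := by
        have h6 : (1:ℤ) ≤ (2 - (k : ℤ)) * (2 - k) := by
          have : (2 - (k : ℤ)) ≠ 0 := by omega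
          nlinarith [Int.one_le_abs this, sq_abs (2 - (k : ℤ)), abs_nonneg (2 - (k : ℤ))]
        exact_mod_cast h6
      nlinarith
  refine (Finset.sum_le_sum h5).trans ?_
  rw [Finset.sum_add_distrib, Finset.sum_ite_eq']
  have := tint_sq_nonneg (T 2)
  split_ifs <;> linarith

lemma poincare_trig {t : TF} (ht : t ∈ trig) :
    tint (t ^ 2) ≤ tint (bi std 1 t t) + (4 * Real.pi ^ 2)⁻¹ * tint t ^ 2 := by
  obtain ⟨T, hT, rfl⟩ := exists_eigen_sum ht
  have h1 := tint_eigen_sum T hT (fun _ => 1) (fun _ => 1)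
  have h2 := tint_eigen_sum T hT (fun _ => 1) (fun k => -k)
  simp only [one_smul, one_mul] at h1 h2
  rw [← lap_eigen_sum T hT, tint_mul_lap] at h2
  have h3 : tint (bi std 1 (∑ k ∈ T.support, T k) (∑ k ∈ T.support, T k)) =
      ∑ k ∈ T.support, (k : ℝ) * tint (T k ^ 2) := by
    simp only [neg_mul, Finset.sum_neg_distrib] at h2; linarith
  have hone : (1 : TF) ∈ eigen 0 :=
    Submodule.subset_span ⟨0, by simp, Or.inl (by rw [cosT_zero, map_one])⟩
  have h4 := eigen_mul_sum T hT hone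
  rw [one_mul, one_mul] at h4
  obtain ⟨r, hr⟩ := eigen_zero_le (hT 0)
  have hπ := Real.pi_pos
  have h6 : (4 * Real.pi ^ 2)⁻¹ * tint (∑ k ∈ T.support, T k) ^ 2 = tint (T 0 ^ 2) := by
    rw [h4, hr, ← map_pow (algebraMap ℝ TF), tint_algebraMap, tint_algebraMap]; field_simp
  rw [h6, h3, pow_two, h1]
  have h5 : ∀ k ∈ T.support, tint (T k ^ 2) ≤ (k : ℝ) * tint (T k ^ 2) +
      if k = 0 then tint (T 0 ^ 2) else 0 := fun k _ => by
    have n := tint_sq_nonneg (T k)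
    split_ifs with hk
    · subst hk; simp
    · have : (1:ℝ) ≤ k := by exact_mod_cast Nat.one_le_iff_ne_zero.2 hk
      nlinarith
  refine (Finset.sum_le_sum h5).trans ?_
  rw [Finset.sum_add_distrib, Finset.sum_ite_eq']
  have := tint_sq_nonneg (T 0)
  split_ifs <;> linarith

lemma weighted_sq_le {x : ℝ} (hx : 0 < x) (u v : ℝ) :
    (u + v) ^ 2 ≤ (1 + x) * u ^ 2 + (1 + x⁻¹) * v ^ 2 := by
  have hinv : x * x⁻¹ = 1 := mul_inv_cancel₀ hx.ne'
  have h1 : (1 + x) * u ^ 2 + (1 + x⁻¹) * v ^ 2 - (u + v) ^ 2 = x⁻¹ * (x * u - v) ^ 2 := by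
    linear_combination -(x * u ^ 2 - 2 * u * v) * hinv
  have h2 : 0 ≤ x⁻¹ * (x * u - v) ^ 2 := by positivity
  linarith

lemma tint_add_sq_le {x : ℝ} (hx : 0 < x) (f g : TF) :
    tint ((f + g) ^ 2) ≤ (1 + x) * tint (f ^ 2) + (1 + x⁻¹) * tint (g ^ 2) := by
  rw [← smul_eq_mul, ← smul_eq_mul, ← map_smul, ← map_smul, ← map_add]
  exact tint_mono fun p => by simpa using weighted_sq_le hx (f.1 p) (g.1 p)

/-- The spectral gap of the operator `Δ + 2` away from its kernel. -/
lemma spectral_gap (s : TF) : tint (s ^ 2) ≤ tint ((lap std s + 2 * s) ^ 2) +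
      (2 * Real.pi ^ 2)⁻¹ * ∑ i, tint (kernelBasis i * s) ^ 2 := by
  have hπ := Real.pi_pos
  set S := (2 * Real.pi ^ 2)⁻¹ * ∑ i, tint (kernelBasis i * s) ^ 2 with hS
  set B := tint ((lap std s + 2 * s) ^ 2) with hB
  have hS0 : 0 ≤ S := by positivity
  have hB0 : 0 ≤ B := tint_sq_nonneg _
  refine le_of_forall_small (K := 3 * (B + S) + 60) (by positivity) fun x hx hx1 => ?_
  obtain ⟨t, ht, hr⟩ := trig_dense_sobolev std s (ε := x ^ 2) (by positivity)
  set r := s - t with hrdef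
  have ra := tint_sq_nonneg r
  have rb := tint_nonneg (bi_self_nonneg std 1 r)
  have rc := tint_nonneg (bi_self_nonneg std 2 r)
  have hxi : 0 < x⁻¹ := inv_pos.2 hx
  have hk : x⁻¹ * x ^ 2 = x := by field_simp
  have small : ∀ A : ℝ, A ≤ x ^ 2 → (1 + x⁻¹) * A ≤ 2 * x := fun A hA => by
    have := mul_le_mul_of_nonneg_left hA (by positivity : 0 ≤ 1 + x⁻¹)
    nlinarith
  have h1 : tint (s ^ 2) ≤ (1 + x) * tint (t ^ 2) + 2 * x := by
    have := tint_add_sq_le hx t r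
    rw [show t + r = s by rw [hrdef]; ring] at this
    linarith [small (tint (r ^ 2)) (by linarith)]
  have h2 : tint ((lap std t + 2 * t) ^ 2) ≤ (1 + x) * B + 20 * x := by
    have h3 := tint_add_sq_le hx (lap std s + 2 * s) (-(lap std r + 2 * r))
    have h4 : lap std s + 2 * s + -(lap std r + 2 * r) = lap std t + 2 * t := by
      rw [hrdef, map_sub]; ring
    rw [h4, ← hB] at h3
    have h5 := tint_add_sq_le one_pos (lap std r) (2 * r)
    have h6 : (-(lap std r + 2 * r)) ^ 2 = (lap std r + 2 * r) ^ 2 := by ring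
    have h7 : (2 * r) ^ 2 = (4:ℝ) • r ^ 2 := ext_val fun p => by simp; ring
    rw [h7, map_smul, smul_eq_mul, tint_lap_sq] at h5
    rw [h6] at h3
    norm_num at h5
    have h8 := small (tint ((lap std r + 2 * r) ^ 2) / 10) (by linarith)
    linarith
  have h3 : (2 * Real.pi ^ 2)⁻¹ * ∑ i, tint (kernelBasis i * t) ^ 2 ≤ (1 + x) * S + 8 * x := by
    have h4 : ∀ i, tint (kernelBasis i * t) ^ 2 ≤ (1 + x) * tint (kernelBasis i * s) ^ 2
        + 2 * x * (2 * Real.pi ^ 2) := fun i => by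
      have h5 := weighted_sq_le hx (tint (kernelBasis i * s)) (-tint (kernelBasis i * r))
      have h6 : tint (kernelBasis i * s) + -tint (kernelBasis i * r) = tint (kernelBasis i * t) := by
        rw [hrdef, mul_sub, map_sub]; ring
      have h7 := tint_mul_sq_le (kernelBasis i) r
      have h8 := tint_kernelBasis_mul i i
      rw [if_pos rfl, ← pow_two] at h8
      rw [h8] at h7
      rw [h6, neg_sq] at h5
      have h9 := small (tint (r ^ 2)) (by linarith)
      have h10 := mul_le_mul_of_nonneg_left h7 (by positivity : 0 ≤ 1 + x⁻¹)
      have h11 := mul_le_mul_of_nonneg_right h9 (by positivity : 0 ≤ 2 * Real.pi ^ 2)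
      linarith
    have h5 := Finset.sum_le_sum fun (i : Fin 4) (_ : i ∈ Finset.univ) => h4 i
    rw [Finset.sum_add_distrib, ← Finset.mul_sum] at h5
    simp only [Finset.sum_const, Finset.card_univ, Fintype.card_fin, nsmul_eq_mul] at h5
    have h6 := mul_le_mul_of_nonneg_left h5 (by positivity : 0 ≤ (2 * Real.pi ^ 2)⁻¹)
    refine h6.trans (le_of_eq ?_)
    rw [hS]; push_cast; field_simp; ring
  have h4 := spectral_gap_trig ht
  have h5 : tint (t ^ 2) ≤ (1 + x) * (B + S) + 28 * x := by linarith
  nlinarith [mul_nonneg hx.le (add_nonneg hB0 hS0)]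

/-- The Poincaré inequality. -/
lemma poincare {s : TF} (hs : tint s = 0) : tint (s ^ 2) ≤ tint (bi std 1 s s) := by
  have hπ := Real.pi_pos
  set B := tint (bi std 1 s s) with hB
  have hB0 : 0 ≤ B := tint_nonneg (bi_self_nonneg std 1 s)
  refine le_of_forall_small (K := 3 * B + 16) (by positivity) fun x hx hx1 => ?_
  obtain ⟨t, ht, hr⟩ := trig_dense_sobolev std s (ε := x ^ 2) (by positivity)
  set r := s - t with hrdef
  have ra := tint_sq_nonneg r
  have rb := tint_nonneg (bi_self_nonneg std 1 r)
  have rc := tint_nonneg (bi_self_nonneg std 2 r)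
  have hxi : 0 < x⁻¹ := inv_pos.2 hx
  have hk : x⁻¹ * x ^ 2 = x := by field_simp
  have small : ∀ A : ℝ, A ≤ x ^ 2 → (1 + x⁻¹) * A ≤ 2 * x := fun A hA => by
    have := mul_le_mul_of_nonneg_left hA (by positivity : 0 ≤ 1 + x⁻¹)
    nlinarith
  have h1 : tint (s ^ 2) ≤ (1 + x) * tint (t ^ 2) + 2 * x := by
    have := tint_add_sq_le hx t r
    rw [show t + r = s by rw [hrdef]; ring] at this
    linarith [small (tint (r ^ 2)) (by linarith)]
  have h2 : tint (bi std 1 t t) ≤ (1 + x) * B + 2 * x := by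
    have e1 : ∀ f : TF, tint (bi std 1 f f) = tint (D (std 0) f ^ 2) + tint (D (std 1) f ^ 2) :=
      fun f => by rw [bi_one, map_add]
    have h3 := fun i => tint_add_sq_le hx (D (std i) s) (-D (std i) r)
    have h4 : ∀ i, D (std i) s + -D (std i) r = D (std i) t := fun i => by
      rw [hrdef, map_sub]; ring
    have h5 : ∀ i, (-D (std i) r) ^ 2 = D (std i) r ^ 2 := fun i => by ring
    simp only [h4, h5] at h3
    have h6 := small (tint (bi std 1 r r)) (by linarith)
    rw [e1] at h6 ⊢
    rw [hB, e1]
    linarith [h3 0, h3 1]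
  have h3 : (4 * Real.pi ^ 2)⁻¹ * tint t ^ 2 ≤ x := by
    have h4 : tint t = - tint (1 * r) := by rw [one_mul, hrdef, map_sub, hs]; ring
    have h5 := tint_mul_sq_le 1 r
    have h6 : tint (1 ^ 2) = 4 * Real.pi ^ 2 := by
      have := tint_algebraMap 1
      rw [map_one] at this; rw [one_pow, this, mul_one]
    rw [h6] at h5
    rw [h4, neg_sq, inv_mul_le_iff₀ (by positivity)]
    refine h5.trans (mul_le_mul_of_nonneg_left ?_ (by positivity))
    nlinarith
  have h4 := poincare_trig ht
  have h5 : tint (t ^ 2) ≤ (1 + x) * B + 3 * x := by linarith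
  nlinarith [mul_nonneg hx.le hB0]

end CliffordTorus
end

noncomputable section
namespace CliffordTorus
open MeasureTheory

/-! ### Sobolev embeddings -/

/-- The value at x differs from the value at t by at most the total variation; average over t. -/
lemma abs_le_interval {f f' : ℝ → ℝ} (hf : ∀ t, HasDerivAt f (f' t) t) (hf' : Continuous f') {x : ℝ}
    (hx : x ∈ Set.Icc 0 (2 * Real.pi)) :
    |f x| ≤ (2 * Real.pi)⁻¹ * (∫ t in (0:ℝ)..(2 * Real.pi), |f t|)
      + ∫ t in (0:ℝ)..(2 * Real.pi), |f' t| := by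
  have hπ := Real.pi_pos
  have hcf : Continuous f := continuous_iff_continuousAt.2 fun t => (hf t).continuousAt
  set V := ∫ t in (0:ℝ)..(2 * Real.pi), |f' t| with hV
  have key : ∀ t ∈ Set.Icc 0 (2 * Real.pi), |f x| ≤ |f t| + V := fun t ht => by
    have h1 : ∫ r in t..x, f' r = f x - f t :=
      intervalIntegral.integral_eq_sub_of_hasDerivAt (fun r _ => hf r) (hf'.intervalIntegrable _ _)
    have h2 : |∫ r in t..x, f' r| ≤ V := by
      have h3 := intervalIntegral.norm_integral_le_integral_norm_uIoc (f := f') (a := t) (b := x)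
        (μ := volume)
      have h4 : Set.uIoc t x ⊆ Set.Ioc 0 (2 * Real.pi) :=
        Set.Ioc_subset_Ioc (le_min ht.1 hx.1) (max_le ht.2 hx.2)
      have hV' : V = ∫ t in Set.Ioc 0 (2 * Real.pi), |f' t| := by
        rw [hV, intervalIntegral.integral_of_le (by linarith)]
      rw [hV']
      refine h3.trans (setIntegral_mono_set ?_ (Filter.Eventually.of_forall fun _ => abs_nonneg _)
        h4.eventuallyLE)
      exact (hf'.abs.intervalIntegrable 0 (2 * Real.pi)).1
    rw [h1] at h2
    have := abs_sub_abs_le_abs_sub (f x) (f t)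
    linarith
  have h3 : ∫ _ in (0:ℝ)..(2 * Real.pi), |f x| ≤ ∫ t in (0:ℝ)..(2 * Real.pi), (|f t| + V) :=
    intervalIntegral.integral_mono_on (by positivity) (by simp)
      ((hcf.abs.add continuous_const).intervalIntegrable _ _) key
  rw [intervalIntegral.integral_add (hcf.abs.intervalIntegrable _ _) (by simp)] at h3
  simp only [intervalIntegral.integral_const, sub_zero, smul_eq_mul] at h3
  have h4 := mul_le_mul_of_nonneg_left h3 (by positivity : 0 ≤ (2 * Real.pi)⁻¹)
  rw [← mul_assoc, inv_mul_cancel₀ (by positivity), mul_add, ← mul_assoc _ _ V,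
    inv_mul_cancel₀ (by positivity)] at h4
  linarith


/-- The `L¹` norm of a function on the torus. -/
abbrev l1 (f : TF) : ℝ := ∫ p, |f.1 p| ∂flatMeasure

lemma l1_nonneg (f : TF) : 0 ≤ l1 f := integral_nonneg fun _ => abs_nonneg _

lemma l1_le_tint {f g : TF} (h : ∀ p, |f.1 p| ≤ g.1 p) : l1 f ≤ tint g :=
  integral_mono (continuous_coe f).abs.integrable_flat (continuous_coe g).integrable_flat h

lemma l1_mul_le (f g : TF) : l1 (f * g) ≤ (tint (f ^ 2) + tint (g ^ 2)) / 2 := by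
  have h : l1 (f * g) ≤ tint ((1 / 2 : ℝ) • (f ^ 2 + g ^ 2)) := l1_le_tint fun p => by
    simp only [mul_val, smul_val, add_val, pow_val, abs_le]
    constructor <;> nlinarith [sq_nonneg (f.1 p + g.1 p), sq_nonneg (f.1 p - g.1 p)]
  refine h.trans (le_of_eq ?_)
  rw [map_smul, map_add, smul_eq_mul]; ring

lemma std_zero : std 0 = (1, 0) := by simp [std, coordVec]
lemma std_one : std 1 = (0, 1) := by simp [std, coordVec]

/-- The average of `|f|` over a horizontal circle, plus the total variation of `f` there. -/
def circleBound₁ (f : TF) (y : ℝ) : ℝ :=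
  (2 * Real.pi)⁻¹ * (∫ t in (0:ℝ)..(2 * Real.pi), |f.1 (t, y)|)
    + ∫ t in (0:ℝ)..(2 * Real.pi), |(D (std 0) f).1 (t, y)|

/-- The average of `|f|` over a vertical circle, plus the total variation of `f` there. -/
def circleBound₂ (f : TF) (x : ℝ) : ℝ :=
  (2 * Real.pi)⁻¹ * (∫ t in (0:ℝ)..(2 * Real.pi), |f.1 (x, t)|)
    + ∫ t in (0:ℝ)..(2 * Real.pi), |(D (std 1) f).1 (x, t)|

lemma abs_le_circleBound₁ (f : TF) {x : ℝ} (hx : x ∈ Set.Icc 0 (2 * Real.pi)) (y : ℝ) :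
    |f.1 (x, y)| ≤ circleBound₁ f y := by
  unfold circleBound₁
  rw [std_zero]
  exact abs_le_interval (fun t => hasDerivAt_fst f t y)
    ((continuous_coe (D (1, 0) f)).comp (by fun_prop : Continuous fun t : ℝ => (t, y))) hx

lemma abs_le_circleBound₂ (f : TF) {y : ℝ} (hy : y ∈ Set.Icc 0 (2 * Real.pi)) (x : ℝ) :
    |f.1 (x, y)| ≤ circleBound₂ f x := by
  unfold circleBound₂
  rw [std_one]
  exact abs_le_interval (fun t => hasDerivAt_snd f x t)
    ((continuous_coe (D (0, 1) f)).comp (by fun_prop : Continuous fun t : ℝ => (x, t))) hy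

lemma continuous_integral_abs_fst (f : TF) :
    Continuous fun y => ∫ t in (0:ℝ)..(2 * Real.pi), |f.1 (t, y)| :=
  intervalIntegral.continuous_parametric_intervalIntegral_of_continuous'
    (f := fun y t => |f.1 (t, y)|)
    ((continuous_coe f).abs.comp (by fun_prop : Continuous fun q : ℝ × ℝ => (q.2, q.1))) _ _

lemma continuous_integral_abs_snd (f : TF) :
    Continuous fun x => ∫ t in (0:ℝ)..(2 * Real.pi), |f.1 (x, t)| :=
  intervalIntegral.continuous_parametric_intervalIntegral_of_continuous'
    (f := fun x t => |f.1 (x, t)|) ((continuous_coe f).abs) _ _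

lemma continuous_circleBound₁ (f : TF) : Continuous (circleBound₁ f) :=
  (continuous_const.mul (continuous_integral_abs_fst f)).add (continuous_integral_abs_fst _)

lemma continuous_circleBound₂ (f : TF) : Continuous (circleBound₂ f) :=
  (continuous_const.mul (continuous_integral_abs_snd f)).add (continuous_integral_abs_snd _)

lemma integral_circleBound₁ (f : TF) : ∫ y in (0:ℝ)..(2 * Real.pi), circleBound₁ f y =
    (2 * Real.pi)⁻¹ * l1 f + l1 (D (std 0) f) := by
  unfold circleBound₁
  rw [intervalIntegral.integral_add
    ((continuous_integral_abs_fst f).intervalIntegrable _ _ |>.const_mul _)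
    ((continuous_integral_abs_fst _).intervalIntegrable _ _), intervalIntegral.integral_const_mul,
    ← integral_flat_symm (continuous_coe f).abs, ← integral_flat_symm (continuous_coe _).abs]

lemma integral_circleBound₂ (f : TF) : ∫ x in (0:ℝ)..(2 * Real.pi), circleBound₂ f x =
    (2 * Real.pi)⁻¹ * l1 f + l1 (D (std 1) f) := by
  unfold circleBound₂
  rw [intervalIntegral.integral_add
    ((continuous_integral_abs_snd f).intervalIntegrable _ _ |>.const_mul _)
    ((continuous_integral_abs_snd _).intervalIntegrable _ _), intervalIntegral.integral_const_mul,
    ← integral_flat (continuous_coe f).abs, ← integral_flat (continuous_coe _).abs]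

lemma inv_two_pi_le_one : (2 * Real.pi)⁻¹ ≤ 1 := inv_le_one_of_one_le₀ (by linarith [Real.pi_gt_three])

/-- The embedding of `W^{2,1}` into the bounded functions. -/
lemma abs_le_l1 (f : TF) (p : ℝ × ℝ) : |f.1 p| ≤
    l1 f + l1 (D (std 0) f) + l1 (D (std 1) f) + l1 (D (std 1) (D (std 0) f)) := by
  obtain ⟨⟨x, y⟩, ⟨hx, hy⟩, hq⟩ := TF.exists_mem_square p
  have hπ := Real.pi_pos
  rw [← hq f]
  have h : ∀ g : TF, ∫ t in (0:ℝ)..(2 * Real.pi), |g.1 (t, y)| ≤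
      (2 * Real.pi)⁻¹ * l1 g + l1 (D (std 1) g) := fun g => by
    rw [← integral_circleBound₂]
    refine intervalIntegral.integral_mono_on (by positivity)
      (((continuous_coe g).abs.comp (by fun_prop : Continuous fun t : ℝ => (t, y))).intervalIntegrable
        _ _) ((continuous_circleBound₂ g).intervalIntegrable _ _) fun t _ => ?_
    exact abs_le_circleBound₂ g hy t
  refine (abs_le_circleBound₁ f hx y).trans ?_
  unfold circleBound₁
  have h1 := mul_le_mul_of_nonneg_left (h f) (by positivity : 0 ≤ (2 * Real.pi)⁻¹)
  have h2 := h (D (std 0) f)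
  have e : ∀ A : ℝ, 0 ≤ A → (2 * Real.pi)⁻¹ * A ≤ A := fun A hA =>
    mul_le_of_le_one_left hA inv_two_pi_le_one
  have n1 := l1_nonneg f
  have n2 := l1_nonneg (D (std 1) f)
  have e1 := e _ n1
  have e2 := e _ (add_nonneg n1 n2)
  have e3 := e _ (l1_nonneg (D (std 0) f))
  have e4 := mul_le_mul_of_nonneg_left e1 (by positivity : 0 ≤ (2 * Real.pi)⁻¹)
  rw [mul_add] at e2 h1
  linarith

/-- The embedding of `W^{1,2}` into `L⁴`. -/
lemma tint_pow_four_le (g : TF) :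
    tint (g ^ 4) ≤ 4 * (tint (g ^ 2) + tint (bi std 1 g g)) ^ 2 := by
  have hπ := Real.pi_pos
  set f := g ^ 2 with hf
  -- With f = g², one factor of f² is bounded by a function of x alone and the other by a function
  -- of y alone, so the double integral factorizes.
  have h1 : tint (g ^ 4) ≤ (∫ x in (0:ℝ)..(2 * Real.pi), circleBound₂ f x) *
      ∫ y in (0:ℝ)..(2 * Real.pi), circleBound₁ f y := by
    have e : g ^ 4 = f ^ 2 := by rw [hf]; ring
    rw [e, tint_def, integral_flat (continuous_coe _)]
    simp_rw [← intervalIntegral.integral_mul_const, ← intervalIntegral.integral_const_mul]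
    have c := (continuous_circleBound₁ f)
    have c' := (continuous_circleBound₂ f)
    refine intervalIntegral.integral_mono_on (by positivity) (Continuous.intervalIntegrable
      (intervalIntegral.continuous_parametric_intervalIntegral_of_continuous'
        (f := fun x t => (f ^ 2).1 (x, t)) (continuous_coe (f ^ 2)) _ _) _ _) ?_ fun x hx => ?_
    · refine Continuous.intervalIntegrable ?_ _ _
      simp_rw [intervalIntegral.integral_const_mul]
      exact c'.mul continuous_const
    refine intervalIntegral.integral_mono_on (by positivity) (((continuous_coe (f ^ 2)).comp
      (by fun_prop : Continuous fun t : ℝ => (x, t))).intervalIntegrable _ _)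
      ((continuous_const.mul c).intervalIntegrable _ _) fun y hy => ?_
    have a1 := abs_le_circleBound₁ f hx y
    have a2 := abs_le_circleBound₂ f hy x
    rw [pow_val, ← sq_abs, pow_two]
    exact mul_le_mul a2 a1 (abs_nonneg _) ((abs_nonneg _).trans a2)
  have n0 : l1 f = tint (g ^ 2) := by
    rw [tint_def]
    exact integral_congr_ae (Filter.Eventually.of_forall fun p => by
      simp [hf])
  have n1 : ∀ i, l1 (D (std i) f) ≤ tint (g ^ 2) + tint (D (std i) g ^ 2) := fun i => by
    have h : D (std i) f = (2:ℝ) • (g * D (std i) g) := by rw [hf, D_sq]; exact ext_val fun p => by simp; ring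
    have h2 := l1_mul_le g (D (std i) g)
    have h3 : l1 (D (std i) f) = 2 * l1 (g * D (std i) g) := by
      rw [h, l1, l1, ← integral_const_mul]
      exact integral_congr_ae (Filter.Eventually.of_forall fun p => by simp [abs_mul])
    linarith
  rw [integral_circleBound₁, integral_circleBound₂, n0] at h1
  have e : tint (bi std 1 g g) = tint (D (std 0) g ^ 2) + tint (D (std 1) g ^ 2) := by
    rw [bi_one, map_add]
  have p0 := tint_sq_nonneg g
  have p1 := tint_sq_nonneg (D (std 0) g)
  have p2 := tint_sq_nonneg (D (std 1) g)
  have e1 := mul_le_of_le_one_left p0 inv_two_pi_le_one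
  refine h1.trans ?_
  have b : ∀ i : Fin 2, (2 * Real.pi)⁻¹ * tint (g ^ 2) + l1 (D (std i) f) ≤
      2 * (tint (g ^ 2) + tint (bi std 1 g g)) := fun i => by
    have h := n1 i
    have h2 : tint (D (std i) g ^ 2) ≤ tint (bi std 1 g g) := by
      rw [e]; fin_cases i
      · exact le_add_of_nonneg_right p2
      · exact le_add_of_nonneg_left p1
    have h3 := (tint_sq_nonneg (D (std i) g)).trans h2
    linarith
  have b0 : 0 ≤ (2 * Real.pi)⁻¹ * tint (g ^ 2) + l1 (D (std 0) f) :=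
    add_nonneg (by positivity) (l1_nonneg _)
  calc _ ≤ (2 * (tint (g ^ 2) + tint (bi std 1 g g))) * (2 * (tint (g ^ 2) + tint (bi std 1 g g))) :=
        mul_le_mul (b 1) (b 0) b0 (by rw [e]; linarith)
    _ = _ := by ring

end CliffordTorus
end

noncomputable section
namespace CliffordTorus
open MeasureTheory

/-! ### Conformal tori in the three-sphere, in components -/

abbrev cos₁ : TF := cosT (1, 0)
abbrev sin₁ : TF := sinT (1, 0)
abbrev cos₂ : TF := cosT (0, 1)
abbrev sin₂ : TF := sinT (0, 1)

lemma D_cos₁ : D (std 0) cos₁ = -sin₁ ∧ D (std 1) cos₁ = 0 := by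
  simp [cos₁, D_cosT, std_zero, std_one, phase_apply]
lemma D_sin₁ : D (std 0) sin₁ = cos₁ ∧ D (std 1) sin₁ = 0 := by
  simp [sin₁, D_sinT, std_zero, std_one, phase_apply]
lemma D_cos₂ : D (std 0) cos₂ = 0 ∧ D (std 1) cos₂ = -sin₂ := by
  simp [cos₂, D_cosT, std_zero, std_one, phase_apply]
lemma D_sin₂ : D (std 0) sin₂ = 0 ∧ D (std 1) sin₂ = cos₂ := by
  simp [sin₂, D_sinT, std_zero, std_one, phase_apply]

lemma cos₁_sq (p : ℝ × ℝ) : cos₁.1 p ^ 2 = 1 - sin₁.1 p ^ 2 := by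
  rw [cosT_val, sinT_val, Real.sin_sq]; ring
lemma cos₂_sq (p : ℝ × ℝ) : cos₂.1 p ^ 2 = 1 - sin₂.1 p ^ 2 := by
  rw [cosT_val, sinT_val, Real.sin_sq]; ring

/-- The number `1 / √2`. -/
def rt : ℝ := (√2)⁻¹

lemma rt_sq : rt ^ 2 = 1 / 2 := by rw [rt, inv_pow, Real.sq_sqrt (by norm_num)]; norm_num

/-- The components of the Clifford torus. -/
def cliff : Fin 4 → TF := ![rt • cos₁, rt • sin₁, rt • cos₂, rt • sin₂]

/-- The operator `α ∂₁² + β ∂₁∂₂ + γ ∂₂²`. -/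
def quad (α β γ : ℝ) : TF →ₗ[ℝ] TF where
  toFun f := α • D (std 0) (D (std 0) f) + β • D (std 0) (D (std 1) f)
    + γ • D (std 1) (D (std 1) f)
  map_add' f g := ext_val fun p => by simp; ring
  map_smul' r f := ext_val fun p => by simp; ring

lemma quad_apply (α β γ : ℝ) (f : TF) : quad α β γ f =
    α • D (std 0) (D (std 0) f) + β • D (std 0) (D (std 1) f) + γ • D (std 1) (D (std 1) f) := rfl

/-- A conformally parametrized torus in the three-sphere with conformal factor `w`, in components,
with the flat metric `a dθ² + 2b dθ dφ + c dφ²`, normalized modulo rotations. -/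
structure ConformalTorus where
  F : Fin 4 → TF
  w : TF
  a : ℝ
  b : ℝ
  c : ℝ
  sphere : ∑ k, F k ^ 2 = 1
  metric₁₁ : ∑ k, D (std 0) (F k) ^ 2 = a • w
  metric₁₂ : ∑ k, D (std 0) (F k) * D (std 1) (F k) = b • w
  metric₂₂ : ∑ k, D (std 1) (F k) ^ 2 = c • w
  det : a * c - b ^ 2 = 1 / 4
  a_pos : 0 < a
  c_pos : 0 < c
  normalized : ∀ i j, tint (F i * cliff j) = tint (F j * cliff i)

namespace ConformalTorus

variable (T : ConformalTorus)

/-- The deviation from the Clifford torus. -/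
def h (k : Fin 4) : TF := T.F k - cliff k

/-- The conformal factor, minus one. -/
def z : TF := T.w - 1

/-- The mean curvature vector, times the conformal factor. -/
def G (k : Fin 4) : TF := quad (4 * T.c) (-8 * T.b) (4 * T.a) (T.F k) + 2 * T.w * T.F k

/-- The components of the deviation along the first and the second circle. -/
def X₁ : TF := T.h 1 * cos₁ - T.h 0 * sin₁
def X₂ : TF := T.h 3 * cos₂ - T.h 2 * sin₂

/-- The component of the deviation normal to the Clifford torus in the sphere. -/
def s : TF := T.h 0 * cos₁ + T.h 1 * sin₁ - T.h 2 * cos₂ - T.h 3 * sin₂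

/-- The component of the deviation normal to the sphere. -/
def η : TF := T.h 0 * cos₁ + T.h 1 * sin₁ + T.h 2 * cos₂ + T.h 3 * sin₂

/-- The components of the conformal Killing operator on the tangential part. -/
def A₁ : TF := D (std 0) T.X₁ - D (std 1) T.X₂
def A₂ : TF := D (std 1) T.X₁ + D (std 0) T.X₂

/-- Together with `q₂`, the quadratic remainder of the trace-free conformality equations: each term
is a product of two small quantities. -/
def q₁ : TF := rt • ((T.a - T.c) • T.z - ∑ k, D (std 0) (T.h k) ^ 2 + ∑ k, D (std 1) (T.h k) ^ 2)
def q₂ : TF := (2 * rt) • (T.b • T.z - ∑ k, D (std 0) (T.h k) * D (std 1) (T.h k))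

/-- The part of the operator due to the change of the conformal structure. -/
def K : TF →ₗ[ℝ] TF := quad (4 * (T.c - 1 / 2)) (-8 * T.b) (4 * (T.a - 1 / 2))

lemma F_eq (k : Fin 4) : T.F k = cliff k + T.h k := by rw [h]; ring
lemma w_eq : T.w = 1 + T.z := by rw [z]; ring

lemma D_F : (D (std 0) (T.F 0) = D (std 0) (T.h 0) - rt • sin₁ ∧
    D (std 0) (T.F 1) = D (std 0) (T.h 1) + rt • cos₁ ∧
    D (std 0) (T.F 2) = D (std 0) (T.h 2) ∧ D (std 0) (T.F 3) = D (std 0) (T.h 3)) ∧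
    D (std 1) (T.F 0) = D (std 1) (T.h 0) ∧ D (std 1) (T.F 1) = D (std 1) (T.h 1) ∧
    D (std 1) (T.F 2) = D (std 1) (T.h 2) - rt • sin₂ ∧
    D (std 1) (T.F 3) = D (std 1) (T.h 3) + rt • cos₂ := by
  simp [F_eq, cliff, D_cos₁, D_cos₂, D_sin₁, D_sin₂]
  ring_nf; simp

/-- Expanding |f₀ + h|² = 1 leaves 2⟨f₀, h⟩ = −|h|², and f₀ points in the direction measured by η.
-/
lemma η_eq : T.η = -rt • ∑ k, T.h k ^ 2 := ext_val fun p => by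
  have h := congrArg (fun f : TF => f.1 p) T.sphere
  simp [F_eq, cliff, Fin.sum_univ_four] at h
  simp [η, Fin.sum_univ_four]
  have r := rt_sq
  have c1 := cos₁_sq p
  have c2 := cos₂_sq p
  linear_combination rt * h - rt * rt ^ 2 * (c1 + c2) - (2 * ((T.h 0).1 p * cos₁.1 p
    + (T.h 1).1 p * sin₁.1 p + (T.h 2).1 p * cos₂.1 p + (T.h 3).1 p * sin₂.1 p) + 2 * rt) * r

/-- The difference of the two diagonal metric equations, linearized. The component s enters because
the two circles bend in opposite normal directions. -/
lemma A₁_add_s : T.A₁ + T.s = algebraMap ℝ TF (rt * (T.a - T.c)) + T.q₁ := ext_val fun p => by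
  have h1 := congrArg (fun f : TF => f.1 p) T.metric₁₁
  have h2 := congrArg (fun f : TF => f.1 p) T.metric₂₂
  simp [D_F, w_eq, Fin.sum_univ_four] at h1 h2
  simp [A₁, X₁, X₂, s, q₁, Fin.sum_univ_four, D_mul, D_cos₁, D_cos₂, D_sin₁, D_sin₂]
  have r := rt_sq
  have c1 := cos₁_sq p
  have c2 := cos₂_sq p
  linear_combination rt * (h1 - h2) - rt * rt ^ 2 * (c1 - c2) - 2 * (
    (D (std 0) (T.h 1)).1 p * cos₁.1 p - (D (std 0) (T.h 0)).1 p * sin₁.1 p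
    - (D (std 1) (T.h 3)).1 p * cos₂.1 p + (D (std 1) (T.h 2)).1 p * sin₂.1 p) * r

lemma A₂_eq : T.A₂ = algebraMap ℝ TF (2 * rt * T.b) + T.q₂ := ext_val fun p => by
  have h1 := congrArg (fun f : TF => f.1 p) T.metric₁₂
  simp [D_F, w_eq, Fin.sum_univ_four] at h1
  simp [A₂, X₁, X₂, q₂, Fin.sum_univ_four, D_mul, D_cos₁, D_cos₂, D_sin₁, D_sin₂]
  have r := rt_sq
  linear_combination 2 * rt * h1 - 2 * (
    (D (std 1) (T.h 1)).1 p * cos₁.1 p - (D (std 1) (T.h 0)).1 p * sin₁.1 p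
    + (D (std 0) (T.h 3)).1 p * cos₂.1 p - (D (std 0) (T.h 2)).1 p * sin₂.1 p) * r

/-- The trace of the metric equations. Minimality of the Clifford torus shows in the absence of a
term linear in s. -/
lemma z_eq : (T.a + T.c) • T.z = (2 * rt) • (D (std 0) T.X₁ + D (std 1) T.X₂ + T.η)
    + ∑ k, bi std 1 (T.h k) (T.h k) + algebraMap ℝ TF (1 - (T.a + T.c)) := ext_val fun p => by
  have h1 := congrArg (fun f : TF => f.1 p) T.metric₁₁
  have h2 := congrArg (fun f : TF => f.1 p) T.metric₂₂
  simp [D_F, w_eq, Fin.sum_univ_four] at h1 h2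
  simp [X₁, X₂, η, bi_one, Fin.sum_univ_four, D_mul, D_cos₁, D_cos₂, D_sin₁, D_sin₂]
  have r := rt_sq
  have c1 := cos₁_sq p
  have c2 := cos₂_sq p
  linear_combination -(h1 + h2) + rt ^ 2 * (c1 + c2) + 2 * r

/-- For a = c = 1/2 and b = 0 the operator in `G` is twice the flat Laplacian, and f₀ satisfies the
equation with G = 0. -/
lemma lap_h (k : Fin 4) : (2 : ℝ) • lap std (T.h k) = T.G k - (2 : ℝ) • (T.z * T.F k)
    - (2 : ℝ) • T.h k - T.K (cliff k) - T.K (T.h k) := ext_val fun p => by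
  fin_cases k <;>
  simp [G, K, quad_apply, lap_apply, F_eq, w_eq, cliff, D_cos₁, D_cos₂, D_sin₁, D_sin₂] <;> ring

lemma lap_s : lap std T.s = lap std (T.h 0) * cos₁ + lap std (T.h 1) * sin₁
    - lap std (T.h 2) * cos₂ - lap std (T.h 3) * sin₂ + 2 * T.A₁ + T.s := ext_val fun p => by
  simp [s, A₁, X₁, X₂, lap_apply, D_mul, D_cos₁, D_cos₂, D_sin₁, D_sin₂]; ring

/-- Projection of `lap_h` to the Clifford normal. Differentiating the moving frame produces A₁,
which is eliminated by `A₁_add_s`; this shifts the zeroth-order coefficient to that of the Jacobi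
operator. The constants from K(f₀) cancel those proportional to a − c, and the term with z f₀ drops
since f₀ is orthogonal to the normal. Besides G only quadratic terms remain. -/
lemma jacobi : (2 : ℝ) • (lap std T.s + 2 * T.s) =
    (T.G 0 * cos₁ + T.G 1 * sin₁ - T.G 2 * cos₂ - T.G 3 * sin₂)
    - (2 : ℝ) • (T.z * T.s) + (4 : ℝ) • T.q₁
    - (T.K (T.h 0) * cos₁ + T.K (T.h 1) * sin₁ - T.K (T.h 2) * cos₂ - T.K (T.h 3) * sin₂) :=
  ext_val fun p => by
  have h := fun k => congrArg (fun f : TF => f.1 p) (T.lap_h k)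
  have h0 := h 0
  have h1 := h 1
  have h2 := h 2
  have h3 := h 3
  have hA := congrArg (fun f : TF => f.1 p) T.A₁_add_s
  have k0 : ∀ k, (T.K (cliff k)).1 p = if k = 0 ∨ k = 1 then -(4 * (T.c - 1 / 2)) * (cliff k).1 p
      else -(4 * (T.a - 1 / 2)) * (cliff k).1 p := fun k => by
    fin_cases k <;>
    simp [K, quad_apply, cliff, D_cos₁, D_cos₂, D_sin₁, D_sin₂] <;> ring
  simp [k0, F_eq] at h0 h1 h2 h3 hA
  rw [lap_s]
  simp [cliff] at h0 h1 h2 h3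
  simp [s] at hA ⊢
  have c1 := cos₁_sq p
  have c2 := cos₂_sq p
  linear_combination cos₁.1 p * h0 + sin₁.1 p * h1 - cos₂.1 p * h2 - sin₂.1 p * h3 + 4 * hA
    + rt * (4 * (T.c - 1 / 2) - 2 * T.z.1 p) * c1 - rt * (4 * (T.a - 1 / 2) - 2 * T.z.1 p) * c2

end ConformalTorus
end CliffordTorus
end

noncomputable section
namespace CliffordTorus
open MeasureTheory

/-! ### Elementary estimates of square integrals -/

lemma tint_one_mem : 39 ≤ tint 1 ∧ tint 1 ≤ 40 := by
  have h := tint_algebraMap 1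
  rw [map_one] at h
  rw [h]
  constructor <;> nlinarith [Real.pi_gt_d2, Real.pi_lt_d2]

lemma tint_const_sq (r : ℝ) : tint (algebraMap ℝ TF r ^ 2) = tint 1 * r ^ 2 := by
  rw [← map_pow (algebraMap ℝ TF), Algebra.algebraMap_eq_smul_one, map_smul, smul_eq_mul, mul_comm]

lemma tint_sq_mono {f g : TF} (h : ∀ p, |f.1 p| ≤ |g.1 p|) : tint (f ^ 2) ≤ tint (g ^ 2) :=
  tint_mono fun p => by simpa using sq_le_sq.2 (h p)

lemma mul_tint (r : ℝ) (f : TF) : r * tint f = tint (r • f) := by rw [map_smul, smul_eq_mul]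

lemma tint_smul_sq (r : ℝ) (f : TF) : tint ((r • f) ^ 2) = r ^ 2 * tint (f ^ 2) := by
  rw [smul_pow, map_smul, smul_eq_mul]

lemma tint_sq_add_le (f g : TF) : tint ((f + g) ^ 2) ≤ 2 * tint (f ^ 2) + 2 * tint (g ^ 2) := by
  have := tint_add_sq_le one_pos f g
  norm_num at this
  exact this

lemma tint_sq_sub_le (f g : TF) : tint ((f - g) ^ 2) ≤ 2 * tint (f ^ 2) + 2 * tint (g ^ 2) := by
  have := tint_sq_add_le f (-g)
  rwa [← sub_eq_add_neg, show (-g) ^ 2 = g ^ 2 by ring] at this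

lemma tint_sq_sum_le (f : Fin 4 → TF) : tint ((∑ k, f k) ^ 2) ≤ 4 * ∑ k, tint (f k ^ 2) := by
  rw [← map_sum, mul_tint]
  refine tint_mono fun p => ?_
  have := sq_sum_le_card_mul_sum_sq (s := Finset.univ) (f := fun k => (f k).1 p)
  simpa using this

lemma tint_mul_sq_le_of_abs_le {f : TF} {B : ℝ} (hf : ∀ p, |f.1 p| ≤ B) (g : TF) :
    tint ((f * g) ^ 2) ≤ B ^ 2 * tint (g ^ 2) := by
  rw [mul_tint]
  refine tint_mono fun p => ?_
  simp only [pow_val, mul_val, smul_val, mul_pow]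
  exact mul_le_mul_of_nonneg_right (by rw [← sq_abs]; gcongr; exact hf p) (sq_nonneg _)

lemma tint_mul_sq_le_pow_four (f g : TF) :
    tint ((f * g) ^ 2) ≤ (1 / 2) * (tint (f ^ 4) + tint (g ^ 4)) := by
  rw [← map_add, mul_tint]
  refine tint_mono fun p => ?_
  simp only [pow_val, mul_val, smul_val, add_val]
  nlinarith [sq_nonneg ((f.1 p) ^ 2 - (g.1 p) ^ 2)]

lemma sq_tint_le (f : TF) : tint f ^ 2 ≤ 40 * tint (f ^ 2) := by
  have h := tint_mul_sq_le 1 f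
  rw [one_mul, one_pow] at h
  nlinarith [tint_one_mem.2, tint_sq_nonneg f]

lemma tint_normal_sq_le (u : Fin 4 → TF) :
    tint ((u 0 * cos₁ + u 1 * sin₁ - u 2 * cos₂ - u 3 * sin₂) ^ 2) ≤ 2 * ∑ k, tint (u k ^ 2) := by
  rw [← map_sum, mul_tint]
  refine tint_mono fun p => ?_
  simp only [Fin.sum_univ_four, pow_val, mul_val, smul_val, add_val, sub_val]
  have c1 := cos₁_sq p
  have c2 := cos₂_sq p
  have e1 : ((u 0).1 p * cos₁.1 p + (u 1).1 p * sin₁.1 p) ^ 2 ≤ (u 0).1 p ^ 2 + (u 1).1 p ^ 2 := by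
    have : (u 0).1 p ^ 2 + (u 1).1 p ^ 2 - ((u 0).1 p * cos₁.1 p + (u 1).1 p * sin₁.1 p) ^ 2 =
      ((u 1).1 p * cos₁.1 p - (u 0).1 p * sin₁.1 p) ^ 2 := by
      linear_combination -((u 0).1 p ^ 2 + (u 1).1 p ^ 2) * c1
    nlinarith [sq_nonneg ((u 1).1 p * cos₁.1 p - (u 0).1 p * sin₁.1 p)]
  have e2 : ((u 2).1 p * cos₂.1 p + (u 3).1 p * sin₂.1 p) ^ 2 ≤ (u 2).1 p ^ 2 + (u 3).1 p ^ 2 := by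
    have : (u 2).1 p ^ 2 + (u 3).1 p ^ 2 - ((u 2).1 p * cos₂.1 p + (u 3).1 p * sin₂.1 p) ^ 2 =
      ((u 3).1 p * cos₂.1 p - (u 2).1 p * sin₂.1 p) ^ 2 := by
      linear_combination -((u 2).1 p ^ 2 + (u 3).1 p ^ 2) * c2
    nlinarith [sq_nonneg ((u 3).1 p * cos₂.1 p - (u 2).1 p * sin₂.1 p)]
  nlinarith [sq_nonneg ((u 0).1 p * cos₁.1 p + (u 1).1 p * sin₁.1 p
    + ((u 2).1 p * cos₂.1 p + (u 3).1 p * sin₂.1 p))]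

lemma tint_quad_sq_le (α β γ : ℝ) (f : TF) : tint (quad α β γ f ^ 2) ≤
    (α ^ 2 + β ^ 2 / 2 + γ ^ 2) * tint (bi std 2 f f) := by
  rw [mul_tint]
  refine tint_mono fun p => ?_
  rw [bi_two, quad_apply]
  simp only [pow_val, mul_val, smul_val, add_val, two_val]
  set x := (D (std 0) (D (std 0) f)).1 p
  set y := (D (std 0) (D (std 1) f)).1 p
  set z := (D (std 1) (D (std 1) f)).1 p
  nlinarith [sq_nonneg (α * z - γ * x), sq_nonneg (2 * α * y - β * x), sq_nonneg (2 * γ * y - β * z)]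

/-- The Cauchy–Riemann operator controls the full gradient: the cross terms form a Jacobian, which
integrates to zero. -/
lemma tint_conformalKilling_sq (X Y : TF) :
    tint ((D (std 0) X - D (std 1) Y) ^ 2) + tint ((D (std 1) X + D (std 0) Y) ^ 2) =
      tint (bi std 1 X X) + tint (bi std 1 Y Y) := by
  have h : tint (D (std 0) X * D (std 1) Y) = tint (D (std 1) X * D (std 0) Y) := by
    rw [tint_D_mul, D_comm, ← tint_D_mul]
  have e : (D (std 0) X - D (std 1) Y) ^ 2 + (D (std 1) X + D (std 0) Y) ^ 2 =
      bi std 1 X X + bi std 1 Y Y + (2 : ℝ) • (D (std 1) X * D (std 0) Y)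
      - (2 : ℝ) • (D (std 0) X * D (std 1) Y) := ext_val fun p => by simp [bi_one]; ring
  rw [← map_add, e, map_sub, map_add, map_smul, map_smul, h, map_add]; ring

namespace ConformalTorus

variable (T : ConformalTorus)

/-! ### The constraints imposed by the normalization -/

lemma tint_h_mul (i j : Fin 4) : tint (T.h i * cliff j) = tint (T.h j * cliff i) := by
  have := T.normalized i j
  rw [F_eq, F_eq, add_mul, add_mul, map_add, map_add, mul_comm (cliff i)] at this
  linarith

/-- The normalization tested on rotations of the first circle; `tint_X₂` does the same for the
second. -/
lemma tint_X₁ : tint T.X₁ = 0 := by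
  have h := T.tint_h_mul 1 0
  have e : rt • T.X₁ = T.h 1 * cliff 0 - T.h 0 * cliff 1 := ext_val fun p => by
    simp [X₁, cliff]; ring
  have h2 : rt * tint T.X₁ = 0 := by rw [← smul_eq_mul, ← map_smul, e, map_sub, h, sub_self]
  exact (mul_eq_zero.1 h2).resolve_left (by rw [rt]; positivity)

lemma tint_X₂ : tint T.X₂ = 0 := by
  have h := T.tint_h_mul 3 2
  have e : rt • T.X₂ = T.h 3 * cliff 2 - T.h 2 * cliff 3 := ext_val fun p => by
    simp [X₂, cliff]; ring
  have h2 : rt * tint T.X₂ = 0 := by rw [← smul_eq_mul, ← map_smul, e, map_sub, h, sub_self]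
  exact (mul_eq_zero.1 h2).resolve_left (by rw [rt]; positivity)

/-- A rotation field mixing the circles has normal component κ and tangential components ∂₁κ and
−∂₂κ up to scaling. Integrating by parts turns the orthogonality of h to it into the vanishing of
∫κ(s − A₁). By `A₁_add_s` the integrand contains 2s − q₁ and a constant, which the mean-zero κ
removes. -/
lemma tint_kernel_of {κ : TF} (hκ : tint κ = 0) {i j : Fin 4}
    (e : rt • (T.s * κ + T.X₁ * D (std 0) κ - T.X₂ * D (std 1) κ) =
      T.h i * cliff j - T.h j * cliff i) :
    tint (κ * ((2 : ℝ) • T.s - T.q₁)) = 0 := by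
  have h2 : rt * tint (T.s * κ + T.X₁ * D (std 0) κ - T.X₂ * D (std 1) κ) = 0 := by
    rw [← smul_eq_mul, ← map_smul, e, map_sub, T.tint_h_mul i j, sub_self]
  have h3 := (mul_eq_zero.1 h2).resolve_left (by rw [rt]; positivity)
  have h4 : κ * ((2 : ℝ) • T.s - T.q₁) = (rt * (T.a - T.c)) • κ + (T.s * κ - κ * D (std 0) T.X₁
      + κ * D (std 1) T.X₂) := ext_val fun p => by
    have hA := congrArg (fun f : TF => f.1 p) T.A₁_add_s
    simp [A₁] at hA ⊢
    linear_combination κ.1 p * hA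
  rw [map_sub, map_add, mul_comm T.X₁, mul_comm T.X₂, tint_D_mul, tint_D_mul] at h3
  rw [h4, map_add, map_smul, hκ, smul_zero, zero_add, map_add, map_sub]
  linarith

lemma tint_kernelBasis (i : Fin 4) : tint (kernelBasis i * ((2 : ℝ) • T.s - T.q₁)) = 0 := by
  have d0 : ∀ f g : TF, D (std 0) f = g → tint g = 0 := fun f g h => h ▸ tint_D _ f
  -- The four planes spanned by one coordinate of each circle give the four products of sines and
  -- cosines; the addition formulas recombine them.
  have cc : tint (cos₁ * cos₂ * ((2 : ℝ) • T.s - T.q₁)) = 0 := by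
    refine T.tint_kernel_of (i := 0) (j := 2)
      (d0 (sin₁ * cos₂) _ (by simp [D_mul, D_sin₁, D_cos₂])) (ext_val fun p => ?_)
    simp [D_mul, D_cos₁, D_cos₂, X₁, X₂, s, cliff]
    linear_combination rt * (T.h 0).1 p * cos₂.1 p * cos₁_sq p
      - rt * (T.h 2).1 p * cos₁.1 p * cos₂_sq p
  have cs : tint (cos₁ * sin₂ * ((2 : ℝ) • T.s - T.q₁)) = 0 := by
    refine T.tint_kernel_of (i := 0) (j := 3)
      (d0 (sin₁ * sin₂) _ (by simp [D_mul, D_sin₁, D_sin₂])) (ext_val fun p => ?_)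
    simp [D_mul, D_cos₁, D_sin₂, X₁, X₂, s, cliff]
    linear_combination rt * (T.h 0).1 p * sin₂.1 p * cos₁_sq p
      - rt * (T.h 3).1 p * cos₁.1 p * cos₂_sq p
  have sc : tint (sin₁ * cos₂ * ((2 : ℝ) • T.s - T.q₁)) = 0 := by
    refine T.tint_kernel_of (i := 1) (j := 2)
      (d0 (-cos₁ * cos₂) _ (by simp [D_mul, D_cos₁, D_cos₂])) (ext_val fun p => ?_)
    simp [D_mul, D_sin₁, D_cos₂, X₁, X₂, s, cliff]
    linear_combination rt * (T.h 1).1 p * cos₂.1 p * cos₁_sq p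
      - rt * (T.h 2).1 p * sin₁.1 p * cos₂_sq p
  have ss : tint (sin₁ * sin₂ * ((2 : ℝ) • T.s - T.q₁)) = 0 := by
    refine T.tint_kernel_of (i := 1) (j := 3)
      (d0 (-cos₁ * sin₂) _ (by simp [D_mul, D_cos₁, D_sin₂])) (ext_val fun p => ?_)
    simp [D_mul, D_sin₁, D_sin₂, X₁, X₂, s, cliff]
    linear_combination rt * (T.h 1).1 p * sin₂.1 p * cos₁_sq p
      - rt * (T.h 3).1 p * sin₁.1 p * cos₂_sq p
  have e : ∀ p, (kernelBasis 0).1 p = cos₁.1 p * cos₂.1 p - sin₁.1 p * sin₂.1 p ∧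
      (kernelBasis 1).1 p = sin₁.1 p * cos₂.1 p + cos₁.1 p * sin₂.1 p ∧
      (kernelBasis 2).1 p = cos₁.1 p * cos₂.1 p + sin₁.1 p * sin₂.1 p ∧
      (kernelBasis 3).1 p = sin₁.1 p * cos₂.1 p - cos₁.1 p * sin₂.1 p := fun p => by
    simp [kernelBasis, cosT_val, sinT_val, phase_apply, Real.cos_add, Real.sin_add]
    ring_nf
  have f0 : kernelBasis 0 = cos₁ * cos₂ - sin₁ * sin₂ := ext_val fun p => (e p).1
  have f1 : kernelBasis 1 = sin₁ * cos₂ + cos₁ * sin₂ := ext_val fun p => (e p).2.1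
  have f2 : kernelBasis 2 = cos₁ * cos₂ + sin₁ * sin₂ := ext_val fun p => (e p).2.2.1
  have f3 : kernelBasis 3 = sin₁ * cos₂ - cos₁ * sin₂ := ext_val fun p => (e p).2.2.2
  fin_cases i
  · change tint (kernelBasis 0 * _) = 0
    rw [f0, sub_mul, map_sub, cc, ss, sub_self]
  · change tint (kernelBasis 1 * _) = 0
    rw [f1, add_mul, map_add, sc, cs, add_zero]
  · change tint (kernelBasis 2 * _) = 0
    rw [f2, add_mul, map_add, cc, ss, add_zero]
  · change tint (kernelBasis 3 * _) = 0
    rw [f3, sub_mul, map_sub, sc, cs, sub_self]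

end ConformalTorus
end CliffordTorus
end

noncomputable section
namespace CliffordTorus
open MeasureTheory

/-! ### Estimates for the deviation from the Clifford torus -/

/-- Interpolation through ∫|∇f|² = −∫ f Δf. -/
lemma tint_bi_one_le (f : TF) :
    tint (bi std 1 f f) ≤ (1 / 2) * (tint (f ^ 2) + tint (bi std 2 f f)) := by
  have h := tint_mul_lap std f
  have h2 := tint_lap_sq std f
  rw [← h2, ← map_add, mul_tint]
  have h3 : tint (bi std 1 f f) = tint (-(f * lap std f)) := by rw [map_neg tint, h, neg_neg]
  rw [h3]
  refine tint_mono fun p => ?_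
  simp only [neg_val, mul_val, smul_val, add_val, pow_val]
  nlinarith [sq_nonneg (f.1 p + (lap std f).1 p)]

lemma tint_bi_nonneg (j : ℕ) (f : TF) : 0 ≤ tint (bi std j f f) := tint_nonneg (bi_self_nonneg std j f)

lemma tint_bi_two_cliff (k : Fin 4) : tint (bi std 2 (cliff k) (cliff k)) ≤ 20 := by
  have h2 : lap std (cliff k) = -cliff k := ext_val fun p => by
    fin_cases k <;> simp [lap_apply, cliff, D_cos₁, D_cos₂, D_sin₁, D_sin₂]
  have h3 : tint (cliff k ^ 2) ≤ (1 / 2) * tint 1 := by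
    rw [mul_tint]
    refine tint_mono fun p => ?_
    have r := rt_sq
    fin_cases k <;> simp [cliff, mul_pow, r, cosT_val, sinT_val, Real.abs_cos_le_one,
      Real.abs_sin_le_one]
  rw [← tint_lap_sq, h2, show (-cliff k) ^ 2 = cliff k ^ 2 by ring]
  linarith [tint_one_mem.2]

lemma tint_D_sq_le (i : Fin 2) (f : TF) : tint (D (std i) f ^ 2) ≤ tint (bi std 1 f f) :=
  tint_mono fun p => by
    have := bi_D_le std 0 i f p
    simp only [bi, mul_val] at this ⊢
    simpa [pow_two] using this

namespace ConformalTorus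

variable (T : ConformalTorus)

/-- The square of the Sobolev norm of one component of the deviation. -/
def sob (k : Fin 4) : ℝ :=
  tint (T.h k ^ 2) + tint (bi std 1 (T.h k) (T.h k)) + tint (bi std 2 (T.h k) (T.h k))

/-- The square of the Sobolev norm of the deviation. -/
def sobSq : ℝ := ∑ k, T.sob k

/-- The square of the deviation of the conformal structure. -/
def conf : ℝ := (T.a - 1 / 2) ^ 2 + T.b ^ 2 + (T.c - 1 / 2) ^ 2

/-- The square of the `L²` norm of the mean curvature vector (up to the conformal factor). -/
def curv : ℝ := ∑ k, tint (T.G k ^ 2)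

/-- The conditions expressing that the torus is `δ`-close to the Clifford torus. -/
structure Near (δ : ℝ) : Prop where
  le : δ ≤ 1 / 4
  z_le : ∀ p, |T.z.1 p| ≤ δ
  a_le : |T.a - 1 / 2| ≤ δ
  b_le : |T.b| ≤ δ
  c_le : |T.c - 1 / 2| ≤ δ
  sob_le : T.sobSq ≤ δ ^ 2

/-- The bound for the terms of second order. -/
def quadBound (δ : ℝ) : ℝ := δ ^ 2 * (T.sobSq + T.conf)

lemma sob_nonneg (k : Fin 4) : 0 ≤ T.sob k :=
  add_nonneg (add_nonneg (tint_sq_nonneg _) (tint_bi_nonneg _ _)) (tint_bi_nonneg _ _)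

lemma sob_le_sobSq (k : Fin 4) : T.sob k ≤ T.sobSq :=
  Finset.single_le_sum (fun i _ => T.sob_nonneg i) (Finset.mem_univ k)

lemma sobSq_nonneg : 0 ≤ T.sobSq := Finset.sum_nonneg fun k _ => T.sob_nonneg k
lemma conf_nonneg : 0 ≤ T.conf := by unfold conf; positivity
lemma curv_nonneg : 0 ≤ T.curv := Finset.sum_nonneg fun _ _ => tint_sq_nonneg _

lemma tint_h_pow_four (k : Fin 4) : tint (T.h k ^ 4) ≤ 4 * T.sobSq ^ 2 := by
  refine (tint_pow_four_le _).trans ?_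
  have h1 := T.sob_le_sobSq k
  have h2 := tint_sq_nonneg (T.h k)
  have h3 := tint_bi_nonneg 1 (T.h k)
  have h4 := tint_bi_nonneg 2 (T.h k)
  unfold sob at h1
  gcongr
  linarith

/-- The embedding into L⁴ is what makes products of two first derivatives quadratically small in L²
under W^{2,2} control alone. -/
lemma tint_D_h_pow_four (i : Fin 2) (k : Fin 4) : tint (D (std i) (T.h k) ^ 4) ≤ 4 * T.sobSq ^ 2 := by
  refine (tint_pow_four_le _).trans ?_
  have h1 := T.sob_le_sobSq k
  have h2 := tint_sq_nonneg (T.h k)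
  have h5 := tint_sq_nonneg (D (std i) (T.h k))
  have h6 := tint_bi_nonneg 1 (D (std i) (T.h k))
  have h3 := tint_D_sq_le i (T.h k)
  have h4 : tint (bi std 1 (D (std i) (T.h k)) (D (std i) (T.h k))) ≤
    tint (bi std 2 (T.h k) (T.h k)) := tint_mono fun p => bi_D_le std 1 i (T.h k) p
  unfold sob at h1
  gcongr
  linarith

variable {T} {δ : ℝ}

lemma Near.nonneg (hT : T.Near δ) : 0 ≤ δ := (abs_nonneg _).trans hT.b_le

lemma Near.sobSq_sq_le (hT : T.Near δ) : T.sobSq ^ 2 ≤ T.quadBound δ := by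
  have := mul_le_mul_of_nonneg_right hT.sob_le T.sobSq_nonneg
  unfold quadBound
  nlinarith [mul_nonneg (sq_nonneg δ) T.conf_nonneg]

lemma sq_mul_sobSq_le (T : ConformalTorus) (δ : ℝ) : δ ^ 2 * T.sobSq ≤ T.quadBound δ := by
  unfold quadBound
  nlinarith [mul_nonneg (sq_nonneg δ) T.conf_nonneg]

lemma sq_mul_conf_le (T : ConformalTorus) (δ : ℝ) : δ ^ 2 * T.conf ≤ T.quadBound δ := by
  unfold quadBound
  nlinarith [mul_nonneg (sq_nonneg δ) T.sobSq_nonneg]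

lemma quadBound_nonneg (T : ConformalTorus) (δ : ℝ) : 0 ≤ T.quadBound δ :=
  mul_nonneg (sq_nonneg δ) (add_nonneg T.sobSq_nonneg T.conf_nonneg)

lemma Near.tint_z_sq_le (hT : T.Near δ) : tint (T.z ^ 2) ≤ 40 * δ ^ 2 := by
  have h := tint_mul_sq_le_of_abs_le hT.z_le 1
  rw [mul_one, one_pow] at h
  nlinarith [tint_one_mem.2, sq_nonneg δ]

lemma Near.tint_D_h_mul (hT : T.Near δ) (i j : Fin 2) (k : Fin 4) :
    tint ((D (std i) (T.h k) * D (std j) (T.h k)) ^ 2) ≤ 4 * T.quadBound δ := by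
  have := tint_mul_sq_le_pow_four (D (std i) (T.h k)) (D (std j) (T.h k))
  linarith [T.tint_D_h_pow_four i k, T.tint_D_h_pow_four j k, hT.sobSq_sq_le]

lemma Near.tint_sum_D_h_mul (hT : T.Near δ) (i j : Fin 2) :
    tint ((∑ k, D (std i) (T.h k) * D (std j) (T.h k)) ^ 2) ≤ 64 * T.quadBound δ := by
  refine (tint_sq_sum_le _).trans ?_
  have := Finset.sum_le_sum fun k (_ : k ∈ Finset.univ) => hT.tint_D_h_mul i j k
  simp at this
  linarith

lemma Near.tint_sum_D_h_sq (hT : T.Near δ) (i : Fin 2) :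
    tint ((∑ k, D (std i) (T.h k) ^ 2) ^ 2) ≤ 64 * T.quadBound δ := by
  simpa only [pow_two (D (std i) (T.h _))] using hT.tint_sum_D_h_mul i i

lemma Near.tint_q₁ (hT : T.Near δ) : tint (T.q₁ ^ 2) ≤ 400 * T.quadBound δ := by
  have h1 := tint_sq_add_le ((T.a - T.c) • T.z - ∑ k, D (std 0) (T.h k) ^ 2)
    (∑ k, D (std 1) (T.h k) ^ 2)
  have h2 := tint_sq_sub_le ((T.a - T.c) • T.z) (∑ k, D (std 0) (T.h k) ^ 2)
  rw [tint_smul_sq] at h2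
  rw [q₁, tint_smul_sq, rt_sq]
  have h3 : (T.a - T.c) ^ 2 ≤ 2 * T.conf := by
    unfold conf; nlinarith [sq_nonneg (T.a - 1 / 2 + (T.c - 1 / 2)), sq_nonneg T.b]
  have h4 : (T.a - T.c) ^ 2 * tint (T.z ^ 2) ≤ 2 * T.conf * (40 * δ ^ 2) :=
    mul_le_mul h3 hT.tint_z_sq_le (tint_sq_nonneg _) (by linarith [T.conf_nonneg])
  linarith [hT.tint_sum_D_h_sq 0, hT.tint_sum_D_h_sq 1, T.sq_mul_conf_le δ, T.quadBound_nonneg δ]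

lemma Near.tint_q₂ (hT : T.Near δ) : tint (T.q₂ ^ 2) ≤ 500 * T.quadBound δ := by
  have h2 := tint_sq_sub_le (T.b • T.z) (∑ k, D (std 0) (T.h k) * D (std 1) (T.h k))
  rw [tint_smul_sq] at h2
  rw [q₂, tint_smul_sq, mul_pow, rt_sq]
  have h3 : T.b ^ 2 ≤ T.conf := by
    unfold conf; nlinarith [sq_nonneg (T.a - 1 / 2), sq_nonneg (T.c - 1 / 2)]
  have h4 : T.b ^ 2 * tint (T.z ^ 2) ≤ T.conf * (40 * δ ^ 2) :=
    mul_le_mul h3 hT.tint_z_sq_le (tint_sq_nonneg _) (by linarith [T.conf_nonneg])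
  linarith [hT.tint_sum_D_h_mul 0 1, T.sq_mul_conf_le δ, T.quadBound_nonneg δ]

lemma tint_K_sq_le (f : TF) : tint (T.K f ^ 2) ≤ 32 * T.conf * tint (bi std 2 f f) := by
  refine (tint_quad_sq_le _ _ _ f).trans ?_
  refine mul_le_mul_of_nonneg_right ?_ (tint_bi_nonneg 2 f)
  unfold conf
  nlinarith [sq_nonneg (T.a - 1 / 2), sq_nonneg (T.c - 1 / 2), sq_nonneg T.b]

lemma Near.tint_K_h (hT : T.Near δ) (k : Fin 4) : tint (T.K (T.h k) ^ 2) ≤ 32 * T.quadBound δ := by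
  refine (tint_K_sq_le _).trans ?_
  have h1 : tint (bi std 2 (T.h k) (T.h k)) ≤ δ ^ 2 := by
    refine le_trans ?_ ((T.sob_le_sobSq k).trans hT.sob_le)
    unfold sob
    linarith [tint_sq_nonneg (T.h k), tint_bi_nonneg 1 (T.h k)]
  nlinarith [mul_le_mul_of_nonneg_left h1 T.conf_nonneg, T.sq_mul_conf_le δ]

lemma tint_K_cliff (k : Fin 4) : tint (T.K (cliff k) ^ 2) ≤ 640 * T.conf := by
  refine (tint_K_sq_le _).trans ?_
  have h1 := tint_bi_two_cliff k
  nlinarith [mul_le_mul_of_nonneg_left h1 T.conf_nonneg]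

lemma tint_s_sq_le_sobSq : tint (T.s ^ 2) ≤ 2 * T.sobSq := by
  refine (tint_normal_sq_le T.h).trans (mul_le_mul_of_nonneg_left ?_ zero_le_two)
  refine Finset.sum_le_sum fun k _ => ?_
  unfold sob; linarith [tint_bi_nonneg 1 (T.h k), tint_bi_nonneg 2 (T.h k)]

lemma Near.tint_jacobi (hT : T.Near δ) :
    tint ((lap std T.s + 2 * T.s) ^ 2) ≤ 4 * T.curv + 8000 * T.quadBound δ := by
  set Y := lap std T.s + 2 * T.s with hY
  have e := tint_smul_sq 2 Y
  rw [hY, jacobi, ← hY] at e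
  have h1 := tint_normal_sq_le T.G
  have h2 := tint_normal_sq_le fun k => T.K (T.h k)
  have h3 := Finset.sum_le_sum fun k (_ : k ∈ Finset.univ) => hT.tint_K_h k
  have h6 := tint_mul_sq_le_of_abs_le hT.z_le T.s
  have h7 := mul_le_mul_of_nonneg_left T.tint_s_sq_le_sobSq (sq_nonneg δ)
  have h8 := hT.tint_q₁
  simp only [Finset.sum_const, Finset.card_univ, Fintype.card_fin, nsmul_eq_mul] at h3
  set g := T.G 0 * cos₁ + T.G 1 * sin₁ - T.G 2 * cos₂ - T.G 3 * sin₂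
  set n := T.K (T.h 0) * cos₁ + T.K (T.h 1) * sin₁ - T.K (T.h 2) * cos₂ - T.K (T.h 3) * sin₂
  have e1 := tint_sq_sub_le (g - (2 : ℝ) • (T.z * T.s) + (4 : ℝ) • T.q₁) n
  have e2 := tint_sq_add_le (g - (2 : ℝ) • (T.z * T.s)) ((4 : ℝ) • T.q₁)
  have e3 := tint_sq_sub_le g ((2 : ℝ) • (T.z * T.s))
  rw [tint_smul_sq] at e2 e3
  have hP : ∑ k, tint (T.G k ^ 2) = T.curv := rfl
  push_cast at h3
  have Q := T.quadBound_nonneg δ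
  have C := T.curv_nonneg
  have S := T.sq_mul_sobSq_le δ
  rw [hP] at h1
  linarith

/-- By `tint_kernelBasis` the kernel coefficients of s are half those of q₁, hence quadratic, while
the spectral gap controls the rest. -/
lemma Near.tint_s (hT : T.Near δ) : tint (T.s ^ 2) ≤ 4 * T.curv + 8400 * T.quadBound δ := by
  have hπ := Real.pi_pos
  have h1 := spectral_gap T.s
  have h2 : ∀ i, tint (kernelBasis i * T.s) ^ 2 ≤ (1 / 4) * (2 * Real.pi ^ 2 * tint (T.q₁ ^ 2)) :=
    fun i => by
      have e := T.tint_kernelBasis i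
      rw [mul_sub, map_sub, mul_smul_comm, map_smul, smul_eq_mul] at e
      have h3 := tint_mul_sq_le (kernelBasis i) T.q₁
      rw [pow_two (kernelBasis i), tint_kernelBasis_mul, if_pos rfl] at h3
      have h4 : tint (kernelBasis i * T.s) = (1 / 2) * tint (kernelBasis i * T.q₁) := by linarith
      rw [h4, mul_pow]; linarith
  have h3 := Finset.sum_le_sum fun i (_ : i ∈ Finset.univ) => h2 i
  simp only [Finset.sum_const, Finset.card_univ, Fintype.card_fin, nsmul_eq_mul] at h3
  have h4 : (2 * Real.pi ^ 2)⁻¹ * ∑ i, tint (kernelBasis i * T.s) ^ 2 ≤ tint (T.q₁ ^ 2) := by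
    rw [inv_mul_le_iff₀ (by positivity)]
    push_cast at h3
    linarith
  linarith [hT.tint_jacobi, hT.tint_q₁]

/-- Averaging `A₁_add_s` removes the derivatives, so a − c is read off from the means of s and q₁.
-/
lemma Near.sq_sub_le (hT : T.Near δ) : (T.a - T.c) ^ 2 ≤ 8 * T.curv + 20000 * T.quadBound δ := by
  have h := congrArg tint T.A₁_add_s
  have h0 : tint T.A₁ = 0 := by rw [A₁, map_sub, tint_D, tint_D, sub_self]
  rw [map_add, map_add, h0, zero_add, Algebra.algebraMap_eq_smul_one, map_smul, smul_eq_mul] at h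
  have h1 := sq_tint_le T.s
  have h2 := sq_tint_le T.q₁
  have h3 : (rt * (T.a - T.c)) ^ 2 * tint 1 ^ 2 ≤ 2 * tint T.s ^ 2 + 2 * tint T.q₁ ^ 2 := by
    rw [← mul_pow, show rt * (T.a - T.c) * tint 1 = tint T.s - tint T.q₁ by linarith]
    nlinarith [sq_nonneg (tint T.s + tint T.q₁)]
  rw [mul_pow, rt_sq] at h3
  have h4 : 160 * (T.a - T.c) ^ 2 ≤ (T.a - T.c) ^ 2 * tint 1 ^ 2 := by
    have : (160:ℝ) ≤ tint 1 ^ 2 := by nlinarith [tint_one_mem.1]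
    nlinarith [sq_nonneg (T.a - T.c)]
  linarith [hT.tint_s, hT.tint_q₁, T.curv_nonneg, T.quadBound_nonneg δ]

/-- The averaged equation for A₂ has no linear source, so b is determined by quadratic terms alone.
-/
lemma Near.b_sq_le (hT : T.Near δ) : T.b ^ 2 ≤ 500 * T.quadBound δ := by
  have h := congrArg tint T.A₂_eq
  have h0 : tint T.A₂ = 0 := by rw [A₂, map_add, tint_D, tint_D, add_zero]
  rw [map_add, h0, Algebra.algebraMap_eq_smul_one, map_smul, smul_eq_mul] at h
  have h2 := sq_tint_le T.q₂
  have h3 : (2 * rt * T.b) ^ 2 * tint 1 ^ 2 = tint T.q₂ ^ 2 := by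
    rw [← mul_pow, show 2 * rt * T.b * tint 1 = -tint T.q₂ by linarith, neg_sq]
  rw [mul_pow, mul_pow, rt_sq] at h3
  have h4 : 160 * T.b ^ 2 ≤ T.b ^ 2 * tint 1 ^ 2 := by
    have : (160:ℝ) ≤ tint 1 ^ 2 := by nlinarith [tint_one_mem.1]
    nlinarith [sq_nonneg T.b]
  linarith [hT.tint_q₂, T.quadBound_nonneg δ, sq_nonneg T.b]

lemma one_le_a_add_c : 1 ≤ T.a + T.c := by
  nlinarith [T.a_pos, T.c_pos, T.det, sq_nonneg (T.a - T.c), sq_nonneg T.b]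

/-- The determinant constraint says (a + c)² − 1 = (a − c)² + 4b², so the trace deviates only to
second order in the trace-free part. -/
lemma Near.trace_sq_le (hT : T.Near δ) : (T.a + T.c - 1) ^ 2 ≤ (T.a - T.c) ^ 2 + 4 * T.b ^ 2 := by
  have h1 := T.one_le_a_add_c
  obtain ⟨a1, a2⟩ := abs_le.1 hT.a_le
  obtain ⟨b1, b2⟩ := abs_le.1 hT.b_le
  obtain ⟨c1, c2⟩ := abs_le.1 hT.c_le
  have := hT.le
  have e : (T.a + T.c - 1) * (T.a + T.c + 1) = (T.a - T.c) ^ 2 + 4 * T.b ^ 2 := by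
    linear_combination 4 * T.det
  nlinarith

lemma Near.conf_le (hT : T.Near δ) : T.conf ≤ 10 * T.curv + 30000 * T.quadBound δ := by
  have h : T.conf = (1 / 2) * ((T.a - T.c) ^ 2 + (T.a + T.c - 1) ^ 2) + T.b ^ 2 := by
    unfold conf; ring
  linarith [hT.trace_sq_le, hT.b_sq_le, hT.sq_sub_le, T.curv_nonneg, T.quadBound_nonneg δ]

/-- The Cauchy–Riemann data are bounded by s, a − c, b and quadratic terms;
`tint_conformalKilling_sq` converts this into gradients. -/
lemma Near.tint_bi_X (hT : T.Near δ) : tint (bi std 1 T.X₁ T.X₁) + tint (bi std 1 T.X₂ T.X₂) ≤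
    1000 * T.curv + 2000000 * T.quadBound δ := by
  rw [← tint_conformalKilling_sq]
  have h1 : tint (T.A₁ ^ 2) ≤ 4 * tint (T.s ^ 2) + 80 * (T.a - T.c) ^ 2 + 2 * tint (T.q₁ ^ 2) := by
    rw [show T.A₁ = algebraMap ℝ TF (rt * (T.a - T.c)) - T.s + T.q₁ by linear_combination T.A₁_add_s]
    have h2 := tint_sq_add_le (algebraMap ℝ TF (rt * (T.a - T.c)) - T.s) T.q₁
    have h3 := tint_sq_sub_le (algebraMap ℝ TF (rt * (T.a - T.c))) T.s
    rw [tint_const_sq, mul_pow, rt_sq] at h3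
    nlinarith [tint_one_mem.2, sq_nonneg (T.a - T.c)]
  have h2 : tint (T.A₂ ^ 2) ≤ 160 * T.b ^ 2 + 2 * tint (T.q₂ ^ 2) := by
    rw [A₂_eq]
    have h2 := tint_sq_add_le (algebraMap ℝ TF (2 * rt * T.b)) T.q₂
    rw [tint_const_sq, mul_pow, mul_pow, rt_sq] at h2
    nlinarith [tint_one_mem.2, sq_nonneg T.b]
  change tint (T.A₁ ^ 2) + tint (T.A₂ ^ 2) ≤ _
  linarith [hT.tint_s, hT.tint_q₁, hT.tint_q₂, hT.b_sq_le, hT.sq_sub_le, T.curv_nonneg,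
    T.quadBound_nonneg δ]

lemma Near.tint_η (hT : T.Near δ) : tint (T.η ^ 2) ≤ 40 * T.quadBound δ := by
  rw [η_eq, tint_smul_sq, neg_sq, rt_sq]
  have h := tint_sq_sum_le fun k => T.h k ^ 2
  have h2 := Finset.sum_le_sum fun k (_ : k ∈ Finset.univ) => T.tint_h_pow_four k
  simp only [Finset.sum_const, Finset.card_univ, Fintype.card_fin, nsmul_eq_mul] at h2
  simp only [← pow_mul] at h
  push_cast at h2
  norm_num at h
  linarith [hT.sobSq_sq_le, T.quadBound_nonneg δ]

lemma Near.tint_h (hT : T.Near δ) :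
    ∑ k, tint (T.h k ^ 2) ≤ 1100 * T.curv + 2100000 * T.quadBound δ := by
  -- The expansion of |h|² in the moving frame; the vectors defining η and s have length √2.
  have e : ∑ k, T.h k ^ 2 = (1 / 2 : ℝ) • (T.η ^ 2 + T.s ^ 2) + T.X₁ ^ 2 + T.X₂ ^ 2 :=
    ext_val fun p => by
      simp [Fin.sum_univ_four, η, s, X₁, X₂]
      linear_combination -((T.h 0).1 p ^ 2 + (T.h 1).1 p ^ 2) * cos₁_sq p
        - ((T.h 2).1 p ^ 2 + (T.h 3).1 p ^ 2) * cos₂_sq p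
  rw [← map_sum, e, map_add, map_add, map_smul, map_add, smul_eq_mul]
  linarith [poincare T.tint_X₁, poincare T.tint_X₂, hT.tint_bi_X, hT.tint_s, hT.tint_η,
    T.curv_nonneg, T.quadBound_nonneg δ]

lemma Near.tint_z (hT : T.Near δ) :
    tint (T.z ^ 2) ≤ 50000 * T.curv + 100000000 * T.quadBound δ := by
  have h0 : tint (T.z ^ 2) ≤ (T.a + T.c) ^ 2 * tint (T.z ^ 2) := by
    have := T.one_le_a_add_c
    exact le_mul_of_one_le_left (tint_sq_nonneg _) (by nlinarith)
  rw [← tint_smul_sq, z_eq] at h0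
  refine h0.trans ?_
  have e1 := tint_sq_add_le ((2 * rt) • (D (std 0) T.X₁ + D (std 1) T.X₂ + T.η)
    + ∑ k, bi std 1 (T.h k) (T.h k)) (algebraMap ℝ TF (1 - (T.a + T.c)))
  have e2 := tint_sq_add_le ((2 * rt) • (D (std 0) T.X₁ + D (std 1) T.X₂ + T.η))
    (∑ k, bi std 1 (T.h k) (T.h k))
  have e3 := tint_sq_add_le (D (std 0) T.X₁ + D (std 1) T.X₂) T.η
  have e4 := tint_sq_add_le (D (std 0) T.X₁) (D (std 1) T.X₂)
  rw [tint_smul_sq, mul_pow, rt_sq] at e2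
  rw [tint_const_sq] at e1
  have b1 : tint (D (std 0) T.X₁ ^ 2) ≤ tint (bi std 1 T.X₁ T.X₁) := by
    rw [bi_one, map_add]; linarith [tint_sq_nonneg (D (std 1) T.X₁)]
  have b2 : tint (D (std 1) T.X₂ ^ 2) ≤ tint (bi std 1 T.X₂ T.X₂) := by
    rw [bi_one, map_add]; linarith [tint_sq_nonneg (D (std 0) T.X₂)]
  have b3 : tint ((∑ k, bi std 1 (T.h k) (T.h k)) ^ 2) ≤ 256 * T.quadBound δ := by
    simp only [bi_one, Finset.sum_add_distrib]
    linarith [tint_sq_add_le (∑ k, D (std 0) (T.h k) ^ 2) (∑ k, D (std 1) (T.h k) ^ 2),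
      hT.tint_sum_D_h_sq 0, hT.tint_sum_D_h_sq 1]
  have b4 : tint 1 * (1 - (T.a + T.c)) ^ 2 ≤ 40 * ((T.a - T.c) ^ 2 + 4 * T.b ^ 2) := by
    rw [show (1 - (T.a + T.c)) ^ 2 = (T.a + T.c - 1) ^ 2 by ring]
    exact mul_le_mul tint_one_mem.2 hT.trace_sq_le (sq_nonneg _) (by norm_num)
  linarith [hT.tint_bi_X, hT.tint_η, hT.b_sq_le, hT.sq_sub_le, T.curv_nonneg,
    T.quadBound_nonneg δ]

lemma abs_F_le (k : Fin 4) (p : ℝ × ℝ) : |(T.F k).1 p| ≤ 1 := by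
  have h := congrArg (fun f : TF => f.1 p) T.sphere
  simp only [sum_val, pow_val, one_val] at h
  have h2 := Finset.single_le_sum (f := fun k => (T.F k).1 p ^ 2) (fun i _ => sq_nonneg _)
    (Finset.mem_univ k)
  rw [h] at h2
  exact (sq_le_one_iff_abs_le_one _).1 h2

lemma Near.tint_lap (hT : T.Near δ) (k : Fin 4) :
    tint (lap std (T.h k) ^ 2) ≤ 2000000 * T.curv + 10000000000 * T.quadBound δ := by
  have e := tint_smul_sq 2 (lap std (T.h k))
  rw [lap_h] at e
  have e1 := tint_sq_sub_le (T.G k - (2 : ℝ) • (T.z * T.F k) - (2 : ℝ) • T.h k - T.K (cliff k))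
    (T.K (T.h k))
  have e2 := tint_sq_sub_le (T.G k - (2 : ℝ) • (T.z * T.F k) - (2 : ℝ) • T.h k) (T.K (cliff k))
  have e3 := tint_sq_sub_le (T.G k - (2 : ℝ) • (T.z * T.F k)) ((2 : ℝ) • T.h k)
  have e4 := tint_sq_sub_le (T.G k) ((2 : ℝ) • (T.z * T.F k))
  rw [tint_smul_sq] at e3 e4
  have e5 := tint_mul_sq_le_of_abs_le (T.abs_F_le k) T.z
  rw [mul_comm (T.F k)] at e5
  have e6 : tint (T.G k ^ 2) ≤ T.curv :=
    Finset.single_le_sum (f := fun k => tint (T.G k ^ 2)) (fun i _ => tint_sq_nonneg _)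
      (Finset.mem_univ k)
  have e7 := (Finset.single_le_sum (f := fun k => tint (T.h k ^ 2)) (fun i _ => tint_sq_nonneg _)
      (Finset.mem_univ k)).trans hT.tint_h
  linarith [T.tint_K_cliff k, hT.tint_K_h k, hT.conf_le, hT.tint_z, T.curv_nonneg,
    T.quadBound_nonneg δ]

/-- L² bounds on h and Δh give all second derivatives, since on the flat torus the Laplacian and the
Hessian have equal L² norms. -/
lemma Near.sobSq_add_conf_le (hT : T.Near δ) :
    T.sobSq + T.conf ≤ 10 ^ 8 * T.curv + 10 ^ 11 * T.quadBound δ := by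
  have h : T.sobSq ≤ ∑ k, (2 * tint (T.h k ^ 2) + 2 * tint (lap std (T.h k) ^ 2)) := by
    refine Finset.sum_le_sum fun k _ => ?_
    unfold sob
    have h1 := tint_bi_one_le (T.h k)
    rw [← tint_lap_sq] at h1 ⊢
    linarith [tint_sq_nonneg (T.h k), tint_sq_nonneg (lap std (T.h k))]
  rw [Finset.sum_add_distrib, ← Finset.mul_sum] at h
  have h2 := Finset.sum_le_sum fun k (_ : k ∈ Finset.univ) =>
    mul_le_mul_of_nonneg_left (hT.tint_lap k) zero_le_two
  simp only [Finset.sum_const, Finset.card_univ, Fintype.card_fin, nsmul_eq_mul] at h2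
  push_cast at h2
  linarith [hT.tint_h, hT.conf_le, T.curv_nonneg, T.quadBound_nonneg δ]

/-- The deviation from the Clifford torus is controlled by the mean curvature. -/
theorem Near.le_curv (hT : T.Near δ) (hδ : 10 ^ 12 * δ ^ 2 ≤ 1) :
    T.sobSq + T.conf ≤ 10 ^ 9 * T.curv ∧ tint (T.z ^ 2) ≤ 10 ^ 9 * T.curv := by
  -- The quadratic error has factor 10¹¹δ² ≤ 1/10 and is absorbed into the left side.
  have h1 := hT.sobSq_add_conf_le
  have h2 := mul_le_mul_of_nonneg_right hδ (add_nonneg T.sobSq_nonneg T.conf_nonneg)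
  have h3 : T.quadBound δ = δ ^ 2 * (T.sobSq + T.conf) := rfl
  have h4 := hT.tint_z
  have h5 := T.curv_nonneg
  have h6 := T.sobSq_nonneg
  have h7 := T.conf_nonneg
  constructor <;> nlinarith

end ConformalTorus
end CliffordTorus
end

noncomputable section
namespace CliffordTorus
open MeasureTheory

/-! ### Estimates for the conformal factor -/

lemma l1_add_le (f g : TF) : l1 (f + g) ≤ l1 f + l1 g := by
  rw [l1, l1, l1, ← integral_add (continuous_coe f).abs.integrable_flat
    (continuous_coe g).abs.integrable_flat]
  exact integral_mono (continuous_coe (f + g)).abs.integrable_flat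
    ((continuous_coe f).abs.add (continuous_coe g).abs).integrable_flat fun p => abs_add_le _ _

lemma l1_mono {f g : TF} (h : ∀ p, |f.1 p| ≤ |g.1 p|) : l1 f ≤ l1 g :=
  integral_mono (continuous_coe f).abs.integrable_flat (continuous_coe g).abs.integrable_flat h

lemma l1_smul (r : ℝ) (f : TF) : l1 (r • f) = |r| * l1 f := by
  rw [l1, l1, ← integral_const_mul]
  exact integral_congr_ae (Filter.Eventually.of_forall fun p => by simp [abs_mul])

lemma l1_smul_le {r : ℝ} (hr : |r| ≤ 1) (f : TF) : l1 (r • f) ≤ l1 f := by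
  rw [l1_smul]; exact mul_le_of_le_one_left (l1_nonneg f) hr

/-- Integration of |f| ≤ (f²/y + y)/2, with total mass at most 40. -/
lemma l1_le_of_tint_sq_le {f : TF} {y A : ℝ} (hy : 0 < y) (h : tint (f ^ 2) ≤ A * y ^ 2) :
    l1 f ≤ (A / 2 + 20) * y := by
  have h1 : l1 f ≤ tint ((1 / 2 : ℝ) • (y⁻¹ • f ^ 2 + y • 1)) := l1_le_tint fun p => by
    simp only [smul_val, add_val, pow_val, one_val]
    have e : 1 / 2 * (y⁻¹ * f.1 p ^ 2 + y * 1) - |f.1 p| = 1 / 2 * y⁻¹ * (|f.1 p| - y) ^ 2 := by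
      rw [← sq_abs (f.1 p)]; field_simp; ring
    have : 0 ≤ 1 / 2 * y⁻¹ * (|f.1 p| - y) ^ 2 := by positivity
    linarith
  refine h1.trans ?_
  rw [map_smul, map_add, map_smul, map_smul, smul_eq_mul, smul_eq_mul, smul_eq_mul]
  have h2 : y⁻¹ * tint (f ^ 2) ≤ A * y := by
    rw [inv_mul_le_iff₀ hy]; linarith
  nlinarith [tint_one_mem.2]

lemma l1_D_D_le {e : Fin 2 → ℝ × ℝ} {m : Fin 2 → Fin 2 → ℝ} (hm : ∀ i p, |m i p| ≤ 1)
    (he : ∀ i, std i = m i 0 • e 0 + m i 1 • e 1) {f : TF} {B : ℝ}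
    (hB : ∀ p q, l1 (D (e p) (D (e q) f)) ≤ B) (i j : Fin 2) :
    l1 (D (std i) (D (std j) f)) ≤ 4 * B := by
  have h : D (std i) (D (std j) f) =
      (m i 0 * m j 0) • D (e 0) (D (e 0) f) + (m i 0 * m j 1) • D (e 0) (D (e 1) f)
      + ((m i 1 * m j 0) • D (e 1) (D (e 0) f) + (m i 1 * m j 1) • D (e 1) (D (e 1) f)) := by
    rw [he i, he j]
    simp only [D_add_vec, D_smul_vec, map_add, map_smul]
    exact ext_val fun p => by simp; ring
  have hmm : ∀ i j p q, |m i p * m j q| ≤ 1 := fun i j p q => by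
    rw [abs_mul]; exact mul_le_one₀ (hm i p) (abs_nonneg _) (hm j q)
  rw [h]
  refine (l1_add_le _ _).trans ?_
  have h1 := l1_add_le ((m i 0 * m j 0) • D (e 0) (D (e 0) f)) ((m i 0 * m j 1) • D (e 0) (D (e 1) f))
  have h2 := l1_add_le ((m i 1 * m j 0) • D (e 1) (D (e 0) f)) ((m i 1 * m j 1) • D (e 1) (D (e 1) f))
  linarith [l1_smul_le (hmm i j 0 0) (D (e 0) (D (e 0) f)), l1_smul_le (hmm i j 0 1) (D (e 0) (D (e 1) f)),
    l1_smul_le (hmm i j 1 0) (D (e 1) (D (e 0) f)), l1_smul_le (hmm i j 1 1) (D (e 1) (D (e 1) f)),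
    hB 0 0, hB 0 1, hB 1 0, hB 1 1]

/-- Each component of f₀ depends on one variable only. -/
lemma hess_cliff (k : Fin 4) : hess std (cliff k) = 0 := ext_val fun p => by
  fin_cases k <;> simp [hess, cliff, D_cos₁, D_cos₂, D_sin₁, D_sin₂]

lemma hess_smul (e : Fin 2 → ℝ × ℝ) (r : ℝ) (f : TF) : hess e (r • f) = r ^ 2 • hess e f :=
  ext_val fun p => by simp [hess]; ring

lemma hessBi_smul_smul (e : Fin 2 → ℝ × ℝ) (r t : ℝ) (f g : TF) :
    hessBi e (r • f) (t • g) = (r * t) • hessBi e f g :=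
  ext_val fun p => by simp [hessBi]; ring

/-- The Hessian determinant of a perturbation, with a free scaling parameter. -/
lemma hess_add_eq {e : Fin 2 → ℝ × ℝ} {f : TF} (hf : hess e f = 0) (g : TF) {t : ℝ} (ht : t ≠ 0) :
    hess e (f + g) = hess e (t • f + t⁻¹ • g) + (1 - (t⁻¹) ^ 2) • hess e g := by
  rw [hess_add, hess_add, hess_smul, hess_smul, hessBi_smul_smul, hf, mul_inv_cancel₀ ht]
  exact ext_val fun p => by simp; ring

lemma tint_bi_two_add_le (e : Fin 2 → ℝ × ℝ) (f g : TF) : tint (bi e 2 (f + g) (f + g)) ≤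
    2 * tint (bi e 2 f f) + 2 * tint (bi e 2 g g) := by
  simp only [← tint_lap_sq, map_add]
  exact tint_sq_add_le _ _

lemma tint_bi_two_smul (e : Fin 2 → ℝ × ℝ) (r : ℝ) (f : TF) :
    tint (bi e 2 (r • f) (r • f)) = r ^ 2 * tint (bi e 2 f f) := by
  simp only [← tint_lap_sq, map_smul]
  exact tint_smul_sq _ _

namespace ConformalTorus

variable (T : ConformalTorus)

/-- A frame in which the Laplacian of the flat metric has no first-order or mixed terms. -/
def frame : Fin 2 → ℝ × ℝ :=
  ![(2 * √T.c) • std 0 - (2 * T.b / √T.c) • std 1, (1 / √T.c) • std 1]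

lemma D_frame (f : TF) : D (T.frame 0) f = (2 * √T.c) • D (std 0) f - (2 * T.b / √T.c) • D (std 1) f ∧
    D (T.frame 1) f = (1 / √T.c) • D (std 1) f := by
  constructor
  · simp only [frame, Matrix.cons_val_zero, sub_eq_add_neg, ← neg_smul, D_add_vec, D_smul_vec]
  · rw [show T.frame 1 = (1 / √T.c) • std 1 from rfl, D_smul_vec]

/-- Completing the square in the quadratic form of the inverse metric; the determinant constraint
gives (1 + 4b²)/c = 4a. -/
lemma lap_frame (f : TF) : lap T.frame f = quad (4 * T.c) (-8 * T.b) (4 * T.a) f :=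
  ext_val fun p => by
    have hc := T.c_pos
    have hs : √T.c ^ 2 = T.c := Real.sq_sqrt hc.le
    have h0 : √T.c ≠ 0 := (Real.sqrt_pos.2 hc).ne'
    have hd := T.det
    simp only [lap_apply, (T.D_frame _).1, (T.D_frame _).2, quad_apply, map_sub, map_smul,
      D_comm (std 1) (std 0)]
    simp
    set σ := √T.c
    set x := (D (std 0) (D (std 0) f)).1 p
    set y := (D (std 0) (D (std 1) f)).1 p
    set v := (D (std 1) (D (std 1) f)).1 p
    have ha : T.a = (1 / 4 + T.b ^ 2) / σ ^ 2 := by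
      rw [hs, eq_div_iff hc.ne']; linarith
    rw [ha, ← hs]
    field_simp
    ring

lemma hess_frame (f : TF) : hess T.frame f = (4 : ℝ) • hess std f :=
  ext_val fun p => by
    have h0 : √T.c ≠ 0 := (Real.sqrt_pos.2 T.c_pos).ne'
    simp only [hess, (T.D_frame _).1, (T.D_frame _).2, map_sub, map_smul, D_comm (std 1) (std 0)]
    simp
    field_simp
    ring

/-- The Gauss equation for the conformal factor. -/
lemma lap_z : lap T.frame T.z = ∑ k, (-2 : ℝ) • hess T.frame (T.F k) := by
  -- The combination ∂₂²g₁₁ − 2∂₁∂₂g₁₂ + ∂₁²g₂₂ loses all third derivatives and equals −2 Σ det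
  -- D²F_k; on the other side it is the Laplacian of z divided by 4.
  have h00 := congrArg (fun f => D (std 1) (D (std 1) f)) T.metric₁₁
  have h01 := congrArg (fun f => D (std 0) (D (std 1) f)) T.metric₁₂
  have h11 := congrArg (fun f => D (std 0) (D (std 0) f)) T.metric₂₂
  have e : ∀ i j, D (std i) (D (std j) T.w) = D (std i) (D (std j) T.z) := fun i j => by
    rw [w_eq, map_add, D_one, zero_add]
  have h2 : ∀ v, D v (2 : TF) = 0 := fun v => by
    have := D_algebraMap (Γ := periods) v 2
    rwa [map_ofNat] at this
  simp only [map_sum, map_smul, D_sq, D_mul, h2, e, zero_mul, zero_add, map_add,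
    D_comm (std 1) (std 0)] at h00 h01 h11
  simp only [lap_frame, hess_frame]
  refine ext_val fun p => ?_
  have g00 := congrArg (fun f : TF => f.1 p) h00
  have g01 := congrArg (fun f : TF => f.1 p) h01
  have g11 := congrArg (fun f : TF => f.1 p) h11
  simp only [quad_apply, hess, Fin.sum_univ_four] at g00 g01 g11 ⊢
  simp at g00 g01 g11 ⊢
  linear_combination -4 * g00 + 8 * g01 - 4 * g11

variable {T} {δ : ℝ}

lemma Near.c_mem (hT : T.Near δ) : 1 / 4 ≤ T.c ∧ T.c ≤ 3 / 4 := by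
  obtain ⟨h1, h2⟩ := abs_le.1 hT.c_le
  have := hT.le
  constructor <;> linarith

lemma Near.a_mem (hT : T.Near δ) : 1 / 4 ≤ T.a ∧ T.a ≤ 3 / 4 := by
  obtain ⟨h1, h2⟩ := abs_le.1 hT.a_le
  have := hT.le
  constructor <;> linarith

lemma Near.exists_std_eq (hT : T.Near δ) : ∃ m : Fin 2 → Fin 2 → ℝ, (∀ i p, |m i p| ≤ 1) ∧
    ∀ i, std i = m i 0 • T.frame 0 + m i 1 • T.frame 1 := by
  have hc := hT.c_mem
  have h1 : 1 / 2 ≤ √T.c := Real.le_sqrt_of_sq_le (by linarith)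
  have h2 : √T.c ≤ 1 := Real.sqrt_le_iff.2 ⟨zero_le_one, by linarith⟩
  have h0 : 0 < √T.c := by linarith
  refine ⟨![![1 / (2 * √T.c), T.b / √T.c], ![0, √T.c]], ?_, ?_⟩
  · intro i p
    fin_cases i <;> fin_cases p
    · change |1 / (2 * √T.c)| ≤ 1
      rw [abs_of_pos (by positivity), div_le_one (by positivity)]; linarith
    · change |T.b / √T.c| ≤ 1
      rw [abs_div, abs_of_pos h0, div_le_one h0]
      linarith [hT.b_le, hT.le]
    · simp
    · change |√T.c| ≤ 1
      rwa [abs_of_pos h0]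
  · intro i
    have e1 : T.frame 1 = (1 / √T.c) • std 1 := rfl
    have e0 : T.frame 0 = (2 * √T.c) • std 0 - (2 * T.b / √T.c) • std 1 := rfl
    fin_cases i
    · change std 0 = (1 / (2 * √T.c)) • T.frame 0 + (T.b / √T.c) • T.frame 1
      rw [e0, e1, std_zero, std_one]
      ext <;> simp
      · field_simp
      · field_simp; ring
    · change std 1 = (0 : ℝ) • T.frame 0 + √T.c • T.frame 1
      rw [e1, zero_smul, zero_add, smul_smul, mul_one_div_cancel h0.ne', one_smul]

lemma Near.tint_bi_frame_le (hT : T.Near δ) (f : TF) :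
    tint (bi T.frame 2 f f) ≤ 34 * tint (bi std 2 f f) := by
  rw [← tint_lap_sq, lap_frame]
  refine (tint_quad_sq_le _ _ _ f).trans ?_
  refine mul_le_mul_of_nonneg_right ?_ (tint_bi_nonneg 2 f)
  have hb := abs_le.1 (hT.b_le.trans hT.le)
  nlinarith [hT.a_mem, hT.c_mem]

/-- The hypotheses on the size of the deviation. -/
structure Small (T : ConformalTorus) (y : ℝ) : Prop where
  pos : 0 < y
  le_one : y ≤ 1
  sob_le : T.sobSq ≤ y ^ 2
  z_le : tint (T.z ^ 2) ≤ y ^ 2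

variable {y : ℝ}

lemma Small.l1_z (hy : T.Small y) : l1 T.z ≤ 21 * y := by
  have := l1_le_of_tint_sq_le (A := 1) hy.pos (by simpa using hy.z_le)
  linarith [hy.pos]

/-- A direct bound by ∫|D²F|² would not be small. Since det D²f₀ = 0, the term bilinear in f₀ and h
is rewritten through the determinant of t f₀ + t⁻¹h. With t² = y and h of size y in W^{2,2}, both
the rescaled function and the correction t⁻² det D²h cost O(y). -/
lemma Near.l1_D_D_z (hT : T.Near δ) (hy : T.Small y) (i j : Fin 2) :
    l1 (D (std i) (D (std j) T.z)) ≤ 10 ^ 7 * y := by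
  have hy0 := hy.pos
  obtain ⟨m, hm, hstd⟩ := hT.exists_std_eq
  set t := √y with ht
  have ht0 : t ≠ 0 := (Real.sqrt_pos.2 hy0).ne'
  have ht2 : t ^ 2 = y := Real.sq_sqrt hy0.le
  have hess0 : ∀ k, hess T.frame (cliff k) = 0 := fun k => by rw [hess_frame, hess_cliff, smul_zero]
  have hφ : lap T.frame T.z = ∑ i : Fin 4 ⊕ Fin 4,
      Sum.elim (fun _ => (-2 : ℝ)) (fun _ => -2 * (1 - (t⁻¹) ^ 2)) i •
      hess T.frame (Sum.elim (fun k => t • cliff k + t⁻¹ • T.h k) T.h i) := by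
    rw [Fintype.sum_sum_type, lap_z, ← Finset.sum_add_distrib]
    refine Finset.sum_congr rfl fun k _ => ?_
    rw [F_eq, hess_add_eq (hess0 k) _ ht0]
    simp only [Sum.elim_inl, Sum.elim_inr, smul_add, smul_smul]
  refine (l1_D_D_le hm hstd (B := 1000000 * y) (fun p q => ?_) i j).trans (by linarith)
  refine (integral_abs_second_deriv_le _ _ _ _ hφ p q).trans ?_
  have hz := hy.l1_z
  have hh : ∀ k, tint (bi std 2 (T.h k) (T.h k)) ≤ y ^ 2 := fun k => by
    refine le_trans ?_ ((T.sob_le_sobSq k).trans hy.sob_le)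
    unfold sob
    linarith [tint_sq_nonneg (T.h k), tint_bi_nonneg 1 (T.h k)]
  have yi : y⁻¹ * y ^ 2 = y := by field_simp
  have ti : t⁻¹ ^ 2 = y⁻¹ := by rw [inv_pow, ht2]
  have b1 : ∀ k : Fin 4, |(-2 : ℝ)| * tint (bi T.frame 2 (t • cliff k + t⁻¹ • T.h k)
      (t • cliff k + t⁻¹ • T.h k)) ≤ 3000 * y := fun k => by
    have e1 := tint_bi_two_add_le T.frame (t • cliff k) (t⁻¹ • T.h k)
    rw [tint_bi_two_smul, tint_bi_two_smul, ht2, ti] at e1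
    have e2 := mul_le_mul_of_nonneg_left ((hT.tint_bi_frame_le (cliff k)).trans
      (mul_le_mul_of_nonneg_left (tint_bi_two_cliff k) (by norm_num))) hy0.le
    have e3 := mul_le_mul_of_nonneg_left ((hT.tint_bi_frame_le (T.h k)).trans
      (mul_le_mul_of_nonneg_left (hh k) (by norm_num))) (inv_nonneg.2 hy0.le)
    norm_num
    linarith
  have b2 : ∀ k : Fin 4, |-2 * (1 - (t⁻¹) ^ 2)| * tint (bi T.frame 2 (T.h k) (T.h k)) ≤ 68 * y :=
    fun k => by
    have i1 : 1 ≤ y⁻¹ := (one_le_inv₀ hy0).2 hy.le_one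
    rw [ti, abs_mul, abs_of_nonpos (by linarith : 1 - y⁻¹ ≤ 0)]
    norm_num
    have e3 := (hT.tint_bi_frame_le (T.h k)).trans
      (mul_le_mul_of_nonneg_left (hh k) (by norm_num))
    have e4 := mul_le_mul_of_nonneg_left e3 (by linarith : 0 ≤ y⁻¹ - 1)
    nlinarith
  rw [Fintype.sum_sum_type]
  simp only [Sum.elim_inl, Sum.elim_inr]
  have s1 := Finset.sum_le_sum fun k (_ : k ∈ Finset.univ) => b1 k
  have s2 := Finset.sum_le_sum fun k (_ : k ∈ Finset.univ) => b2 k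
  simp only [Finset.sum_const, Finset.card_univ, Fintype.card_fin, nsmul_eq_mul] at s1 s2
  push_cast at s1 s2
  linarith

lemma Near.abs_D_F_le (hT : T.Near δ) (k : Fin 4) (p : ℝ × ℝ) : |(D (std 0) (T.F k)).1 p| ≤ 1 := by
  have h := congrArg (fun f : TF => f.1 p) T.metric₁₁
  simp only [sum_val, pow_val, smul_val] at h
  have h2 := Finset.single_le_sum (f := fun k => (D (std 0) (T.F k)).1 p ^ 2)
    (fun i _ => sq_nonneg _) (Finset.mem_univ k)
  rw [h] at h2
  refine (sq_le_one_iff_abs_le_one _).1 (h2.trans ?_)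
  have h3 := (abs_le.1 (hT.z_le p)).2
  rw [w_eq, add_val, one_val]
  nlinarith [hT.a_mem, hT.le]

/-- Differentiation of the first diagonal metric entry. The Clifford metric is constant, so every
remaining term contains a derivative of h. -/
lemma D_z (i : Fin 2) : T.a • D (std i) T.z = (2 : ℝ) • ∑ k, (D (std i) (D (std 0) (cliff k)) *
    D (std 0) (T.h k) + D (std 0) (T.F k) * D (std i) (D (std 0) (T.h k))) := by
  have h := congrArg (fun f => D (std i) f) T.metric₁₁
  simp only [map_sum, map_smul, D_sq] at h
  rw [w_eq, map_add, D_one, zero_add] at h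
  rw [← h]
  refine ext_val fun p => ?_
  simp only [sum_val, smul_val, Finset.mul_sum]
  rw [Fin.sum_univ_four, Fin.sum_univ_four]
  fin_cases i <;>
  simp [D_F, cliff, D_cos₁, D_cos₂, D_sin₁, D_sin₂] <;> ring

lemma Near.tint_D_z (hT : T.Near δ) (hy : T.Small y) (i : Fin 2) :
    tint (D (std i) T.z ^ 2) ≤ 10 ^ 4 * y ^ 2 := by
  have e := tint_smul_sq T.a (D (std i) T.z)
  rw [D_z, tint_smul_sq] at e
  have h1 := tint_sq_sum_le fun k => D (std i) (D (std 0) (cliff k)) *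
    D (std 0) (T.h k) + D (std 0) (T.F k) * D (std i) (D (std 0) (T.h k))
  have h2 : ∀ k, tint ((D (std i) (D (std 0) (cliff k)) *
    D (std 0) (T.h k) + D (std 0) (T.F k) * D (std i) (D (std 0) (T.h k))) ^ 2) ≤ 2 * y ^ 2 := fun k => by
    have c1 : ∀ p, |(D (std i) (D (std 0) (cliff k))).1 p| ≤ 1 := fun p => by
      have r : |rt| ≤ 1 := by
        rw [← sq_le_one_iff_abs_le_one, rt_sq]; norm_num
      have r2 : ∀ x : ℝ, |x| ≤ 1 → |rt| * |x| ≤ 1 := fun x hx => mul_le_one₀ r (abs_nonneg _) hx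
      fin_cases i <;> fin_cases k <;>
        simp [cliff, D_cos₁, D_cos₂, D_sin₁, D_sin₂, abs_mul] <;>
        exact r2 _ (by first | exact Real.abs_cos_le_one _ | exact Real.abs_sin_le_one _)
    have e1 := tint_mul_sq_le_of_abs_le c1 (D (std 0) (T.h k))
    have e2 := tint_mul_sq_le_of_abs_le (hT.abs_D_F_le k) (D (std i) (D (std 0) (T.h k)))
    have e3 := tint_sq_add_le (D (std i) (D (std 0) (cliff k)) * D (std 0) (T.h k))
      (D (std 0) (T.F k) * D (std i) (D (std 0) (T.h k)))
    have b1 := tint_D_sq_le 0 (T.h k)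
    have b2 := (tint_D_sq_le i (D (std 0) (T.h k))).trans
      (tint_mono fun p => bi_D_le std 1 0 (T.h k) p)
    have b3 := (T.sob_le_sobSq k).trans hy.sob_le
    unfold sob at b3
    linarith [tint_sq_nonneg (T.h k)]
  have h3 := Finset.sum_le_sum fun k (_ : k ∈ Finset.univ) => h2 k
  simp only [Finset.sum_const, Finset.card_univ, Fintype.card_fin, nsmul_eq_mul] at h3
  push_cast at h3
  have h4 : 1 / 16 * tint (D (std i) T.z ^ 2) ≤ T.a ^ 2 * tint (D (std i) T.z ^ 2) := by
    refine mul_le_mul_of_nonneg_right ?_ (tint_sq_nonneg _)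
    nlinarith [hT.a_mem]
  nlinarith [sq_nonneg y]

lemma Near.abs_z_le (hT : T.Near δ) (hy : T.Small y) (p : ℝ × ℝ) : |T.z.1 p| ≤ 10 ^ 8 * y := by
  have h := abs_le_l1 T.z p
  linarith [hy.l1_z, l1_le_of_tint_sq_le hy.pos (hT.tint_D_z hy 0),
    l1_le_of_tint_sq_le hy.pos (hT.tint_D_z hy 1), hT.l1_D_D_z hy 1 0, hy.pos]

lemma Near.w_mem (hT : T.Near δ) (p : ℝ × ℝ) : 3 / 4 ≤ T.w.1 p ∧ T.w.1 p ≤ 5 / 4 := by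
  have h := abs_le.1 ((hT.z_le p).trans hT.le)
  rw [w_eq, add_val, one_val]
  constructor <;> linarith

/-- Since 2u = log(1 + z), the factor 2 outweighs the Lipschitz constant of the logarithm on [3/4,
5/4]. -/
lemma Near.abs_u_le (hT : T.Near δ) {u : TF} (hu : ∀ p, T.w.1 p = Real.exp (2 * u.1 p))
    (p : ℝ × ℝ) : |u.1 p| ≤ |T.z.1 p| := by
  have hw := hT.w_mem p
  have hw0 : 0 < T.w.1 p := by linarith
  have h1 : 2 * u.1 p = Real.log (T.w.1 p) := by rw [hu, Real.log_exp]
  have h2 := Real.log_le_sub_one_of_pos hw0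
  have h3 := Real.one_sub_inv_le_log_of_pos hw0
  have hz : T.z.1 p = T.w.1 p - 1 := rfl
  have h4 : -(3 / 2) * |T.z.1 p| ≤ 1 - (T.w.1 p)⁻¹ := by
    rw [show 1 - (T.w.1 p)⁻¹ = T.z.1 p / T.w.1 p by rw [hz]; field_simp, le_div_iff₀ hw0]
    nlinarith [neg_abs_le (T.z.1 p), abs_nonneg (T.z.1 p)]
  have h5 := le_abs_self (T.z.1 p)
  have h6 := abs_nonneg (T.z.1 p)
  rw [abs_le]
  constructor <;> linarith

lemma D_w {u : TF} (hu : ∀ p, T.w.1 p = Real.exp (2 * u.1 p)) (i : Fin 2) :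
    D (std i) T.z = (2 : ℝ) • (T.w * D (std i) u) := ext_val fun p => by
  have h : T.w.1 = fun p => Real.exp (2 * u.1 p) := funext hu
  have h1 : D (std i) T.z = D (std i) T.w := by rw [w_eq, map_add, D_one, zero_add]
  have h2 := (((differentiable u p).hasFDerivAt).const_mul 2).exp
  rw [h1, D_val, h, h2.fderiv]
  simp [D_val, hu]; ring

lemma D_D_w {u : TF} (hu : ∀ p, T.w.1 p = Real.exp (2 * u.1 p)) (i j : Fin 2) :
    D (std i) (D (std j) T.z) = (2 : ℝ) • (T.w * D (std i) (D (std j) u))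
      + (4 : ℝ) • (T.w * (D (std i) u * D (std j) u)) := by
  have h1 : D (std i) T.w = D (std i) T.z := by rw [w_eq, map_add, D_one, zero_add]
  rw [D_w hu, map_smul, D_mul, h1, D_w hu]
  exact ext_val fun p => by simp; ring

lemma Near.abs_D_u_le (hT : T.Near δ) {u : TF} (hu : ∀ p, T.w.1 p = Real.exp (2 * u.1 p))
    (i : Fin 2) (p : ℝ × ℝ) : |(D (std i) u).1 p| ≤ |(D (std i) T.z).1 p| := by
  have hw := hT.w_mem p
  rw [D_w hu, smul_val, mul_val, ← mul_assoc, abs_mul]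
  refine le_mul_of_one_le_left (abs_nonneg _) ?_
  rw [abs_of_pos (by linarith)]; linarith

/-- The product of first derivatives coming from the exponential is integrable by the W^{1,2} bound
on z. -/
lemma Near.l1_D_D_u (hT : T.Near δ) {u : TF} (hu : ∀ p, T.w.1 p = Real.exp (2 * u.1 p))
    (i j : Fin 2) : l1 (D (std i) (D (std j) u)) ≤
      l1 (D (std i) (D (std j) T.z)) + tint (D (std i) T.z ^ 2) + tint (D (std j) T.z ^ 2) := by
  have h1 : l1 (D (std i) (D (std j) u)) ≤ l1 (D (std i) (D (std j) T.z)
      + (-4 : ℝ) • (T.w * (D (std i) u * D (std j) u))) := l1_mono fun p => by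
    have hw := hT.w_mem p
    rw [D_D_w hu]
    simp only [add_val, smul_val, mul_val]
    rw [show 2 * (T.w.1 p * (D (std i) (D (std j) u)).1 p) + 4 * (T.w.1 p * ((D (std i) u).1 p
      * (D (std j) u).1 p)) + -4 * (T.w.1 p * ((D (std i) u).1 p * (D (std j) u).1 p)) =
      2 * T.w.1 p * (D (std i) (D (std j) u)).1 p by ring, abs_mul]
    refine le_mul_of_one_le_left (abs_nonneg _) ?_
    rw [abs_of_pos (by linarith)]; linarith
  have h2 : l1 ((-4 : ℝ) • (T.w * (D (std i) u * D (std j) u))) ≤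
      l1 ((2 : ℝ) • (D (std i) T.z * D (std j) T.z)) := l1_mono fun p => by
    have hw := hT.w_mem p
    rw [D_w hu, D_w hu]
    simp only [smul_val, mul_val]
    rw [show 2 * (2 * (T.w.1 p * (D (std i) u).1 p) * (2 * (T.w.1 p * (D (std j) u).1 p))) =
      -(2 * T.w.1 p) * (-4 * (T.w.1 p * ((D (std i) u).1 p * (D (std j) u).1 p))) by ring,
      abs_mul (-(2 * T.w.1 p))]
    refine le_mul_of_one_le_left (abs_nonneg _) ?_
    rw [abs_neg, abs_of_pos (by linarith)]; linarith
  have h3 := l1_mul_le (D (std i) T.z) (D (std j) T.z)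
  have h4 := l1_smul 2 (D (std i) T.z * D (std j) T.z)
  rw [abs_of_pos two_pos] at h4
  linarith [l1_add_le (D (std i) (D (std j) T.z)) ((-4 : ℝ) • (T.w * (D (std i) u * D (std j) u)))]

end ConformalTorus
end CliffordTorus
end

noncomputable section
namespace CliffordTorus
open MeasureTheory

/-! ### Vector-valued functions on the torus -/

/-- The map into four-space with the given components. -/
def vec (G : Fin 4 → TF) : ℝ × ℝ → E4 := fun p => WithLp.toLp 2 fun k => (G k).1 p

@[simp] lemma vec_apply (G : Fin 4 → TF) (p : ℝ × ℝ) (k : Fin 4) : vec G p k = (G k).1 p := rfl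

lemma contDiff_vec (G : Fin 4 → TF) : ContDiff ℝ ∞ (vec G) :=
  contDiff_euclidean.2 fun k => smooth (G k)

lemma pderiv_vec (i : Fin 2) (G : Fin 4 → TF) : pderiv i (vec G) = vec fun k => D (std i) (G k) := by
  funext p
  ext k
  have h := ((contDiff_vec G).differentiable (by simp) p).hasFDerivAt
  have h2 := ((EuclideanSpace.proj k : E4 →L[ℝ] ℝ).hasFDerivAt (x := vec G p)).comp p h
  have h3 : fderiv ℝ (G k).1 p = (EuclideanSpace.proj k : E4 →L[ℝ] ℝ).comp (fderiv ℝ (vec G) p) :=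
    h2.fderiv
  rw [vec_apply, D_val, h3]
  rfl

lemma pderiv_val (i : Fin 2) (g : TF) : pderiv i g.1 = (D (std i) g).1 := rfl

lemma inner_vec (G K : Fin 4 → TF) (p : ℝ × ℝ) :
    inner ℝ (vec G p) (vec K p) = (∑ k, G k * K k).1 p := by
  simp [PiLp.inner_apply, mul_comm]

lemma norm_vec_sq (G : Fin 4 → TF) (p : ℝ × ℝ) : ‖vec G p‖ ^ 2 = (∑ k, G k ^ 2).1 p := by
  simp [EuclideanSpace.norm_sq_eq]

lemma eLpNorm_two_eq {E : Type*} [NormedAddCommGroup E] {g : ℝ × ℝ → E} (hg : Continuous g) {r : ℝ}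
    (h : ∫ p, ‖g p‖ ^ 2 ∂flatMeasure = r) : eLpNorm g 2 flatMeasure = ENNReal.ofReal (√r) := by
  have hi : Integrable (fun p => ‖g p‖ ^ 2) flatMeasure := (hg.norm.pow 2).integrable_flat
  rw [eLpNorm_eq_lintegral_rpow_enorm_toReal two_ne_zero ENNReal.ofNat_ne_top, ← h,
    Real.sqrt_eq_rpow, ← ENNReal.ofReal_rpow_of_nonneg (integral_nonneg fun _ => sq_nonneg _)
      (by norm_num), ofReal_integral_eq_lintegral_ofReal hi
      (Filter.Eventually.of_forall fun _ => sq_nonneg _)]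
  simp only [ENNReal.toReal_ofNat]
  congr 1
  refine lintegral_congr fun p => ?_
  rw [ENNReal.ofReal_pow (norm_nonneg _), ofReal_norm]
  exact ENNReal.rpow_natCast _ 2

lemma eLpNorm_vec (G : Fin 4 → TF) :
    eLpNorm (vec G) 2 flatMeasure = ENNReal.ofReal (√(∑ k, tint (G k ^ 2))) := by
  refine eLpNorm_two_eq (contDiff_vec G).continuous ?_
  rw [← map_sum, tint_def]
  exact integral_congr_ae (Filter.Eventually.of_forall fun p => norm_vec_sq G p)

lemma eLpNorm_two_val (g : TF) : eLpNorm g.1 2 flatMeasure = ENNReal.ofReal (√(tint (g ^ 2))) := by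
  refine eLpNorm_two_eq (continuous_coe g) ?_
  rw [tint_def]
  exact integral_congr_ae (Filter.Eventually.of_forall fun p => by simp)

lemma eLpNorm_one_val (g : TF) : eLpNorm g.1 1 flatMeasure = ENNReal.ofReal (l1 g) := by
  rw [eLpNorm_one_eq_lintegral_enorm, ← ofReal_integral_norm_eq_lintegral_enorm
    (continuous_coe g).integrable_flat]
  rfl

lemma sobolevNorm_two_eq {E : Type*} [NormedAddCommGroup E] [NormedSpace ℝ E] (p : ℝ≥0∞)
    (g : ℝ × ℝ → E) : sobolevNorm 2 p g = eLpNorm g p flatMeasure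
      + (eLpNorm (pderiv 1 g) p flatMeasure + eLpNorm (pderiv 0 g) p flatMeasure)
      + (eLpNorm (pderiv 1 (pderiv 1 g)) p flatMeasure
        + eLpNorm (pderiv 0 (pderiv 1 g)) p flatMeasure
        + eLpNorm (pderiv 0 (pderiv 0 g)) p flatMeasure) := by
  simp [sobolevNorm, Finset.sum_range_succ, Finset.Nat.antidiagonal_succ, add_assoc]

lemma sobolevNorm_one_eq {E : Type*} [NormedAddCommGroup E] [NormedSpace ℝ E] (p : ℝ≥0∞)
    (g : ℝ × ℝ → E) : sobolevNorm 1 p g = eLpNorm g p flatMeasure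
      + (eLpNorm (pderiv 1 g) p flatMeasure + eLpNorm (pderiv 0 g) p flatMeasure) := by
  simp [sobolevNorm, Finset.sum_range_succ, Finset.Nat.antidiagonal_succ]

/-- A bound almost everywhere on the period square holds everywhere. -/
lemma abs_le_of_eLpNorm_top_le {g : TF} {r : ℝ} (hr : 0 ≤ r)
    (h : eLpNorm g.1 ∞ flatMeasure ≤ ENNReal.ofReal r) (p : ℝ × ℝ) : |g.1 p| ≤ r := by
  have hπ := Real.pi_pos
  set S : Set (ℝ × ℝ) := Set.Ioo 0 (2 * Real.pi) ×ˢ Set.Ioo 0 (2 * Real.pi) with hS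
  have hae : ∀ᵐ x ∂flatMeasure, |g.1 x| ≤ r := by
    rw [eLpNorm_exponent_top] at h
    filter_upwards [ae_le_eLpNormEssSup (f := g.1) (μ := flatMeasure)] with x hx
    have := hx.trans h
    rwa [← ofReal_norm, ENNReal.ofReal_le_ofReal_iff hr] at this
  have hopen : IsOpen (S ∩ {x | r < |g.1 x|}) :=
    (isOpen_Ioo.prod isOpen_Ioo).inter (isOpen_lt continuous_const (continuous_coe g).abs)
  have hin : ∀ x ∈ S, |g.1 x| ≤ r := by
    by_contra! hne
    obtain ⟨x, hx, hx2⟩ := hne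
    have hpos := hopen.measure_pos volume ⟨x, hx, hx2⟩
    rw [ae_iff] at hae
    simp only [not_le] at hae
    have hle : volume (S ∩ {x | r < |g.1 x|}) ≤ flatMeasure {x | r < |g.1 x|} := by
      rw [flatMeasure, Measure.restrict_apply (isOpen_lt continuous_const
        (continuous_coe g).abs).measurableSet, Set.inter_comm]
      exact measure_mono (Set.inter_subset_inter_right _
        (Set.prod_mono Set.Ioo_subset_Ioc_self Set.Ioo_subset_Ioc_self))
    rw [hae] at hle
    exact absurd hpos (not_lt.2 hle)
  obtain ⟨q, hq, hqp⟩ := TF.exists_mem_square p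
  rw [← hqp g]
  have hcl : q ∈ closure S := by
    rw [hS, closure_prod_eq, closure_Ioo (by positivity)]
    exact hq
  exact closure_minimal hin (isClosed_le (continuous_coe g).abs continuous_const) hcl

/-! ### Smoothness -/

lemma contDiff_angularE4 {f : Torus → S3}
    (hf : Manifold.IsImmersion ((𝓡 1).prod (𝓡 1)) (𝓡 3) ∞ f) : ContDiff ℝ ∞ (angularE4 f) := by
  have h1 := hf.contMDiff
  have h2 : ContMDiff (𝓡 3) 𝓘(ℝ, E4) ∞ ((↑) : S3 → E4) := contMDiff_coe_sphere
  have h3 : ContMDiff 𝓘(ℝ, ℝ × ℝ) ((𝓡 1).prod (𝓡 1)) ∞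
      (fun p : ℝ × ℝ => ((Circle.exp p.1, Circle.exp p.2) : Torus)) :=
    (contMDiff_circleExp.comp contDiff_fst.contMDiff).prodMk
      (contMDiff_circleExp.comp contDiff_snd.contMDiff)
  exact contMDiff_iff_contDiff.1 (h2.comp (h1.comp h3))

lemma angular_periodic {E : Type*} (g : Torus → E) : ∀ γ ∈ periods, ∀ p,
    angular g (p + γ) = angular g p := by
  intro γ hγ p
  rcases hγ with rfl | rfl <;> simp [angular, Circle.exp_add, Circle.exp_two_pi]

/-- The components of a smooth map into the sphere. -/
def component {f : Torus → S3} (hf : ContDiff ℝ ∞ (angularE4 f)) (k : Fin 4) : TF :=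
  ⟨fun p => angularE4 f p k, contDiff_euclidean.1 hf k, fun γ hγ p => by
    have := angular_periodic (fun x => (f x : E4)) γ hγ p
    exact congrArg (fun v : E4 => v k) this⟩

lemma vec_component {f : Torus → S3} (hf : ContDiff ℝ ∞ (angularE4 f)) :
    vec (component hf) = angularE4 f := rfl

lemma vec_cliff : vec cliff = clifford := by
  funext p
  ext k
  fin_cases k <;> simp [cliff, clifford, rt, cosT_val, sinT_val, phase_apply]

/-! ### Rotations in coordinate planes -/

section Rotation

open Matrix

variable {i j : Fin 4}

/-- The rotation by the angle `t` in the plane of the coordinates `i` and `j`. -/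
def planeRotation (i j : Fin 4) (t : ℝ) : Matrix (Fin 4) (Fin 4) ℝ :=
  1 + (Real.cos t - 1) • (single i i 1 + single j j 1)
    + Real.sin t • (single j i 1 - single i j 1)

lemma planeRotation_add (hij : i ≠ j) (s t : ℝ) :
    planeRotation i j s * planeRotation i j t = planeRotation i j (s + t) := by
  set P : Matrix (Fin 4) (Fin 4) ℝ := single i i 1 + single j j 1 with hP
  set J : Matrix (Fin 4) (Fin 4) ℝ := single j i 1 - single i j 1 with hJ
  have PP : P * P = P := by simp [hP, mul_add, add_mul, hij, hij.symm]
  have PJ : P * J = J := by simp [hP, hJ, mul_sub, add_mul, hij, hij.symm]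
  have JP : J * P = J := by simp [hP, hJ, mul_add, sub_mul, hij, hij.symm]; abel
  have JJ : J * J = -P := by simp [hP, hJ, mul_sub, sub_mul, hij, hij.symm]; abel
  simp only [planeRotation, ← hP, ← hJ, mul_add, add_mul, one_mul, mul_one, smul_mul_smul_comm,
    PP, PJ, JP, JJ, Real.cos_add, Real.sin_add]
  module

lemma planeRotation_zero : planeRotation i j 0 = 1 := by simp [planeRotation]

lemma planeRotation_transpose (t : ℝ) : (planeRotation i j t)ᵀ = planeRotation i j (-t) := by
  simp [planeRotation, transpose_add, transpose_sub, transpose_single]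
  module

lemma planeRotation_mem (hij : i ≠ j) (t : ℝ) :
    planeRotation i j t ∈ specialOrthogonalGroup (Fin 4) ℝ := by
  have ort : ∀ t, planeRotation i j t * (planeRotation i j t)ᵀ = 1 := fun t => by
    rw [planeRotation_transpose, planeRotation_add hij, add_neg_cancel, planeRotation_zero]
  refine mem_specialOrthogonalGroup_iff.2 ⟨(mem_orthogonalGroup_iff _ _).2 (ort t), ?_⟩
  -- The half angle gives the sign: det R(t) is the square of det R(t/2), which is 1 by
  -- orthogonality.
  have h := congrArg det (ort (t / 2))
  rw [det_mul, det_transpose, det_one] at h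
  have h2 := planeRotation_add hij (t / 2) (t / 2)
  rw [add_halves] at h2
  rw [← h2, det_mul, h]

end Rotation

lemma eq_zero_of_cos_add_sin_le {A B : ℝ} (h : ∀ t, (Real.cos t - 1) * A + Real.sin t * B ≤ 0) :
    B = 0 := by
  have hd : HasDerivAt (fun t => (Real.cos t - 1) * A + Real.sin t * B) B 0 := by
    have := (((Real.hasDerivAt_cos 0).sub_const 1).mul_const A).add
      ((Real.hasDerivAt_sin 0).mul_const B)
    rw [Real.sin_zero, neg_zero, zero_mul, zero_add, Real.cos_zero, one_mul] at this
    exact this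
  have hm : IsLocalMax (fun t => (Real.cos t - 1) * A + Real.sin t * B) 0 :=
    Filter.Eventually.of_forall fun t => by simpa using h t
  exact hm.hasDerivAt_eq_zero hd

lemma norm_sq_sub {R : Matrix (Fin 4) (Fin 4) ℝ} (hR : R ∈ Matrix.specialOrthogonalGroup (Fin 4) ℝ)
    (x y : E4) : ‖Matrix.toEuclideanCLM (𝕜 := ℝ) R x - y‖ ^ 2 =
      ‖x‖ ^ 2 + ‖y‖ ^ 2 - 2 * ∑ k, ∑ l, R k l * (x l * y k) := by
  have hU : Matrix.toEuclideanCLM (𝕜 := ℝ) R ∈ unitary (E4 →L[ℝ] E4) :=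
    Unitary.map_mem _ (Matrix.mem_specialOrthogonalGroup_iff.1 hR).1
  have hn : ‖Matrix.toEuclideanCLM (𝕜 := ℝ) R x‖ = ‖x‖ :=
    (ContinuousLinearMap.norm_map_of_mem_unitary hU) x
  rw [norm_sub_sq_real, hn]
  have : inner ℝ (Matrix.toEuclideanCLM (𝕜 := ℝ) R x) y = ∑ k, ∑ l, R k l * (x l * y k) := by
    simp only [PiLp.inner_apply, Matrix.ofLp_toEuclideanCLM, Matrix.mulVec, dotProduct]
    refine Finset.sum_congr rfl fun k _ => ?_
    simp [Finset.mul_sum]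
    exact Finset.sum_congr rfl fun l _ => by ring
  rw [this]; ring

/-- Rotations preserve both norms, so only the cross term varies with R; its first variation in the
(i, j)-plane at the identity is the asserted antisymmetric difference. -/
lemma tint_mul_cliff_symm {F : Fin 4 → TF} (h : RotationNormalized (vec F)) (i j : Fin 4) :
    tint (F i * cliff j) = tint (F j * cliff i) := by
  rcases eq_or_ne i j with rfl | hij
  · rfl
  have key : ∀ R ∈ Matrix.specialOrthogonalGroup (Fin 4) ℝ,
      ∫ p, ‖Matrix.toEuclideanCLM (𝕜 := ℝ) R (vec F p) - clifford p‖ ^ 2 ∂flatMeasure =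
        tint (∑ k, F k ^ 2 + ∑ k, cliff k ^ 2) - 2 * ∑ k, ∑ l, R k l * tint (F l * cliff k) := by
    intro R hR
    have e : tint (∑ k, F k ^ 2 + ∑ k, cliff k ^ 2) - 2 * ∑ k, ∑ l, R k l * tint (F l * cliff k) =
        tint (∑ k, F k ^ 2 + ∑ k, cliff k ^ 2 - (2:ℝ) • ∑ k, ∑ l, R k l • (F l * cliff k)) := by
      simp only [map_sub, map_smul, map_sum, smul_eq_mul]
    rw [e, tint_def]
    refine integral_congr_ae (Filter.Eventually.of_forall fun p => ?_)
    simp only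
    rw [norm_sq_sub hR, ← vec_cliff, norm_vec_sq, norm_vec_sq]
    simp
  have h1 : (1 : Matrix (Fin 4) (Fin 4) ℝ) ∈ Matrix.specialOrthogonalGroup (Fin 4) ℝ := one_mem _
  have k1 := key 1 h1
  rw [map_one] at k1
  have h0 := eq_zero_of_cos_add_sin_le (A := tint (F i * cliff i) + tint (F j * cliff j))
    (B := tint (F i * cliff j) - tint (F j * cliff i)) fun t => by
      have hR := planeRotation_mem hij t
      have h2 := h _ hR
      rw [key _ hR] at h2
      simp only [one_apply_eq_self] at k1
      rw [k1] at h2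
      have h3 : ∑ k, ∑ l, planeRotation i j t k l * tint (F l * cliff k) =
          ∑ k, ∑ l, (1 : Matrix (Fin 4) (Fin 4) ℝ) k l * tint (F l * cliff k)
          + ((Real.cos t - 1) * (tint (F i * cliff i) + tint (F j * cliff j))
          + Real.sin t * (tint (F i * cliff j) - tint (F j * cliff i))) := by
        simp only [planeRotation, Matrix.add_apply, Matrix.smul_apply, Matrix.sub_apply,
          add_mul, Finset.sum_add_distrib, smul_eq_mul, mul_assoc, ← Finset.mul_sum, sub_mul,
          Finset.sum_sub_distrib]
        simp [Matrix.single_apply, ite_and]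
        ring
      linarith
  linarith

end CliffordTorus
end

noncomputable section
namespace CliffordTorus
open MeasureTheory

/-! ### From maps to components -/

lemma inducedMetric_vec (F : Fin 4 → TF) (p : ℝ × ℝ) (i j : Fin 2) :
    inducedMetric (vec F) p i j = (∑ k, D (std i) (F k) * D (std j) (F k)).1 p := by
  rw [inducedMetric, Matrix.of_apply, pderiv_vec, pderiv_vec, inner_vec]

/-- A normalized conformal map into the sphere, in components. -/
lemma exists_conformalTorus {F : Fin 4 → TF} {u : Torus → ℝ} {a b c : ℝ}
    (hF : ∀ p, ‖vec F p‖ = 1) (hdet : a * c - b ^ 2 = 1 / 4)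
    (hg : ∀ p, inducedMetric (vec F) p = Real.exp (2 * angular u p) • !![a, b; b, c])
    (hR : RotationNormalized (vec F)) :
    ∃ (T : ConformalTorus) (U : TF), T.F = F ∧ T.a = a ∧ T.b = b ∧ T.c = c ∧ U.1 = angular u ∧
      ∀ p, T.w.1 p = Real.exp (2 * U.1 p) := by
  have g : ∀ i j p, (∑ k, D (std i) (F k) * D (std j) (F k)).1 p =
      Real.exp (2 * angular u p) * !![a, b; b, c] i j := fun i j p => by
    rw [← inducedMetric_vec, hg]; rfl
  have g00 := g 0 0
  have g01 := g 0 1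
  have g11 := g 1 1
  simp only [Matrix.of_apply, Matrix.cons_val] at g00 g01 g11
  have pos : ∀ {r : ℝ} {i : Fin 2} (_ : ∀ p, (∑ k, D (std i) (F k) * D (std i) (F k)).1 p =
      Real.exp (2 * angular u p) * r), 0 ≤ r := fun {r i} h => by
    have h1 := h 0
    have h2 : 0 ≤ Real.exp (2 * angular u 0) * r := by
      rw [← h1, sum_val]
      exact Finset.sum_nonneg fun k _ => mul_self_nonneg _
    exact nonneg_of_mul_nonneg_right h2 (Real.exp_pos _)
  have ha0 := pos g00
  have hc0 := pos g11
  have ha : 0 < a := lt_of_le_of_ne ha0 fun h => by subst h; nlinarith [sq_nonneg b]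
  have hc : 0 < c := lt_of_le_of_ne hc0 fun h => by subst h; nlinarith [sq_nonneg b]
  -- The conformal factor is recovered from the first diagonal metric entry. It is therefore smooth,
  -- and so is u as half its logarithm.
  set w : TF := a⁻¹ • ∑ k, D (std 0) (F k) * D (std 0) (F k) with hw
  have hwv : ∀ p, w.1 p = Real.exp (2 * angular u p) := fun p => by
    rw [hw, smul_val, g00]; field_simp
  have hu : ∀ p, angular u p = 1 / 2 * Real.log (w.1 p) := fun p => by
    rw [hwv, Real.log_exp]; ring
  have hU : ContDiff ℝ ∞ (angular u) := by
    rw [funext hu]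
    exact contDiff_const.mul ((smooth w).log fun p => by rw [hwv]; exact (Real.exp_pos _).ne')
  refine ⟨⟨F, w, a, b, c, ?_, ?_, ?_, ?_, hdet, ha, hc, tint_mul_cliff_symm hR⟩,
    ⟨angular u, hU, angular_periodic u⟩, rfl, rfl, rfl, rfl, rfl, hwv⟩
  · exact ext_val fun p => by rw [← norm_vec_sq, hF]; simp
  · simp only [pow_two]
    exact ext_val fun p => by rw [g00, smul_val, hwv, mul_comm]
  · exact ext_val fun p => by rw [g01, smul_val, hwv, mul_comm]
  · simp only [pow_two]
    exact ext_val fun p => by rw [g11, smul_val, hwv, mul_comm]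

namespace ConformalTorus

variable (T : ConformalTorus)

lemma inducedMetric_eq (p : ℝ × ℝ) :
    inducedMetric (vec T.F) p = T.w.1 p • !![T.a, T.b; T.b, T.c] := by
  have h0 := congrArg (fun f : TF => f.1 p) T.metric₁₁
  have h1 := congrArg (fun f : TF => f.1 p) T.metric₁₂
  have h2 := congrArg (fun f : TF => f.1 p) T.metric₂₂
  simp only [pow_two] at h0 h2
  have h3 : ∑ k, D (std 1) (T.F k) * D (std 0) (T.F k) = ∑ k, D (std 0) (T.F k) * D (std 1) (T.F k) :=
    Finset.sum_congr rfl fun k _ => mul_comm _ _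
  ext i j
  rw [inducedMetric_vec]
  fin_cases i <;> fin_cases j <;> simp only [Fin.zero_eta, Fin.mk_one, Fin.isValue]
  · rw [h0]; simp [mul_comm]
  · rw [h1]; simp [mul_comm]
  · rw [h3, h1]; simp [mul_comm]
  · rw [h2]; simp [mul_comm]

lemma inducedMetric_inv {p : ℝ × ℝ} (hw : 0 < T.w.1 p) : (inducedMetric (vec T.F) p)⁻¹ =
    (T.w.1 p)⁻¹ • !![4 * T.c, -4 * T.b; -4 * T.b, 4 * T.a] := by
  refine Matrix.inv_eq_right_inv ?_
  have hd := T.det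
  rw [inducedMetric_eq, smul_mul_smul_comm, mul_inv_cancel₀ hw.ne', one_smul]
  ext i j
  fin_cases i <;> fin_cases j <;> simp [Matrix.mul_apply, Fin.sum_univ_two] <;> linarith

lemma sqrt_det_inducedMetric {p : ℝ × ℝ} (hw : 0 < T.w.1 p) :
    √(inducedMetric (vec T.F) p).det = T.w.1 p / 2 := by
  rw [inducedMetric_eq, Real.sqrt_eq_iff_mul_self_eq_of_pos (by positivity)]
  simp [Matrix.det_fin_two]
  linear_combination -(T.w.1 p) ^ 2 * T.det

/-- Apply the flat Laplacian to |F|² = 1; the trace of the metric equals the compensating term 2w by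
the determinant constraint. -/
lemma sum_G_mul_F : ∑ k, T.G k * T.F k = 0 := by
  have h := fun i j => congrArg (fun f => D (std i) (D (std j) f)) T.sphere
  have h00 := h 0 0
  have h01 := h 0 1
  have h11 := h 1 1
  have h2 : ∀ v, D v (2 : TF) = 0 := fun v => by
    have := D_algebraMap (Γ := periods) v 2
    rwa [map_ofNat] at this
  simp only [map_add, D_sq, D_mul, h2, D_one, map_zero, zero_mul, zero_add, Fin.sum_univ_four]
    at h00 h01 h11
  refine ext_val fun p => ?_
  have g := congrArg (fun f : TF => f.1 p) T.sphere
  have g0 := congrArg (fun f : TF => f.1 p) T.metric₁₁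
  have g1 := congrArg (fun f : TF => f.1 p) T.metric₁₂
  have g2 := congrArg (fun f : TF => f.1 p) T.metric₂₂
  have g00 := congrArg (fun f : TF => f.1 p) h00
  have g01 := congrArg (fun f : TF => f.1 p) h01
  have g11 := congrArg (fun f : TF => f.1 p) h11
  simp only [G, quad_apply, Fin.sum_univ_four] at g g0 g1 g2 g00 g01 g11 ⊢
  simp at g g0 g1 g2 g00 g01 g11 ⊢
  linear_combination 2 * T.c * g00 - 4 * T.b * g01 + 2 * T.a * g11 + 2 * T.w.1 p * g
    - 4 * T.c * g0 + 8 * T.b * g1 - 4 * T.a * g2 - 8 * T.w.1 p * T.det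

/-- In conformal dimension two the Laplacian of the immersion has no tangential part: the
derivatives of the metric equations cancel. -/
lemma sum_G_mul_D_F (i : Fin 2) : ∑ k, T.G k * D (std i) (T.F k) = 0 := by
  have hs := congrArg (fun f => D (std i) f) T.sphere
  have h0 := congrArg (fun f => D (std i) f) T.metric₁₁
  have h1 := congrArg (fun f => D (std 0) f) T.metric₁₂
  have h1' := congrArg (fun f => D (std 1) f) T.metric₁₂
  have h2 := congrArg (fun f => D (std i) f) T.metric₂₂
  have h0' := congrArg (fun f => D (std 1) f) T.metric₁₁
  have h2' := congrArg (fun f => D (std 0) f) T.metric₂₂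
  simp only [map_add, map_smul, D_sq, D_mul, D_one, Fin.sum_univ_four, D_comm (std 1) (std 0)]
    at hs h0 h1 h1' h2 h0' h2'
  refine ext_val fun p => ?_
  have gs := congrArg (fun f : TF => f.1 p) hs
  have g0 := congrArg (fun f : TF => f.1 p) h0
  have g1 := congrArg (fun f : TF => f.1 p) h1
  have g1' := congrArg (fun f : TF => f.1 p) h1'
  have g2 := congrArg (fun f : TF => f.1 p) h2
  have g0' := congrArg (fun f : TF => f.1 p) h0'
  have g2' := congrArg (fun f : TF => f.1 p) h2'
  simp only [G, quad_apply, Fin.sum_univ_four] at gs g0 g1 g1' g2 g0' g2' ⊢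
  fin_cases i <;> simp at gs g0 g1 g1' g2 g0' g2' ⊢
  · linear_combination 2 * T.c * g0 - 4 * T.b * g0' + 4 * T.a * (g1' - g2' / 2) + T.w.1 p * gs
  · linear_combination 4 * T.c * (g1 - g0' / 2) - 4 * T.b * g2' + 2 * T.a * g2 + T.w.1 p * gs

lemma G_mem_normalSpace (p : ℝ × ℝ) : vec T.G p ∈ normalSpace (vec T.F) p := by
  rw [normalSpace, Submodule.mem_orthogonal']
  intro v hv
  induction hv using Submodule.span_induction with
  | zero => exact inner_zero_right _
  | add x y _ _ hx hy => rw [inner_add_right, hx, hy, add_zero]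
  | smul r x _ hx => rw [inner_smul_right, hx, mul_zero]
  | mem x hx =>
    rcases hx with rfl | rfl | rfl
    · rw [inner_vec, sum_G_mul_F]; rfl
    · rw [pderiv_vec, inner_vec, sum_G_mul_D_F]; rfl
    · rw [pderiv_vec, inner_vec, sum_G_mul_D_F]; rfl

/-- The inverse-metric trace of the coordinate second derivatives is w⁻¹G − 2F. The first term is
normal and the second is removed by the projection, so no Christoffel symbols are needed. -/
lemma meanCurvature_eq {p : ℝ × ℝ} (hw : 0 < T.w.1 p) :
    meanCurvature (vec T.F) p = (T.w.1 p)⁻¹ • vec T.G p := by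
  have h : meanCurvature (vec T.F) p = (normalSpace (vec T.F) p).starProjection
      (∑ i : Fin 2, ∑ j : Fin 2, (inducedMetric (vec T.F) p)⁻¹ i j •
        pderiv i (pderiv j (vec T.F)) p) := by
    simp only [meanCurvature, secondForm, map_sum, map_smul]
  rw [h]
  refine Submodule.eq_starProjection_of_mem_orthogonal
    (Submodule.smul_mem _ _ (T.G_mem_normalSpace p)) ?_
  have e : (∑ i : Fin 2, ∑ j : Fin 2, (inducedMetric (vec T.F) p)⁻¹ i j •
      pderiv i (pderiv j (vec T.F)) p) - (T.w.1 p)⁻¹ • vec T.G p = (-2 : ℝ) • vec T.F p := by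
    ext k
    simp only [inducedMetric_inv T hw, pderiv_vec, Fin.sum_univ_two]
    simp [G, quad_apply, D_comm (std 1) (std 0)]
    field_simp
    ring
  rw [e]
  exact Submodule.smul_mem _ _ (Submodule.le_orthogonal_orthogonal _
    (Submodule.subset_span (by simp)))

variable {T} {δ : ℝ}

lemma Near.areaMeasure_eq (hT : T.Near δ) : areaMeasure (vec T.F) =
    flatMeasure.withDensity fun p => ENNReal.ofReal (T.w.1 p / 2) := by
  unfold areaMeasure
  congr 1
  funext p
  rw [T.sqrt_det_inducedMetric (by linarith [hT.w_mem p])]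

lemma Near.area_eq (hT : T.Near δ) : area (vec T.F) = tint T.w / 2 := by
  have h : 0 ≤ᵐ[flatMeasure] fun p => T.w.1 p / 2 :=
    Filter.Eventually.of_forall fun p => by
      have := hT.w_mem p
      simp only [Pi.zero_apply]; linarith
  rw [area, hT.areaMeasure_eq, withDensity_apply _ MeasurableSet.univ, Measure.restrict_univ,
    ← ofReal_integral_eq_lintegral_ofReal ((continuous_coe T.w).integrable_flat.div_const 2) h,
    ENNReal.toReal_ofReal (integral_nonneg_of_ae h), integral_div, tint_def]

lemma Near.flatMeasure_le (hT : T.Near δ) : flatMeasure ≤ (4 : ℝ≥0∞) • areaMeasure (vec T.F) := by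
  rw [hT.areaMeasure_eq, ← withDensity_smul _ (by
    have := (continuous_coe T.w).measurable
    fun_prop)]
  nth_rewrite 1 [← withDensity_one (μ := flatMeasure)]
  refine withDensity_mono (Filter.Eventually.of_forall fun p => ?_)
  have := hT.w_mem p
  simp only [Pi.one_apply, Pi.smul_apply, smul_eq_mul]
  rw [← ENNReal.ofReal_one, show (4 : ℝ≥0∞) = ENNReal.ofReal 4 by simp,
    ← ENNReal.ofReal_mul (by norm_num)]
  exact ENNReal.ofReal_le_ofReal (by linarith)

lemma Near.sqrt_curv_le (hT : T.Near δ) :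
    ENNReal.ofReal (√T.curv) ≤ ENNReal.ofReal 5 * meanCurvatureNorm 2 (vec T.F) := by
  rw [curv, ← eLpNorm_vec]
  have h1 : eLpNorm (vec T.G) 2 flatMeasure ≤
      ENNReal.ofReal (5 / 4) * eLpNorm (meanCurvature (vec T.F)) 2 flatMeasure :=
    eLpNorm_le_mul_eLpNorm_of_ae_le_mul (Filter.Eventually.of_forall fun p => by
      have hw := hT.w_mem p
      have hw0 : 0 < T.w.1 p := by linarith
      rw [T.meanCurvature_eq hw0, norm_smul, norm_inv, Real.norm_of_nonneg hw0.le, ← mul_assoc]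
      refine le_mul_of_one_le_left (norm_nonneg _) ?_
      rw [← div_eq_mul_inv, one_le_div hw0]
      linarith) 2
  have h2 := eLpNorm_mono_measure (p := 2) (meanCurvature (vec T.F)) hT.flatMeasure_le
  rw [eLpNorm_smul_measure_of_ne_top (by simp), smul_eq_mul] at h2
  -- The crude replacement of √4 by 4 gives the final factor 5 = (5/4) · 4.
  have h3 : (4 : ℝ≥0∞) ^ (1 / (2 : ℝ≥0∞)).toReal ≤ ENNReal.ofReal 4 := by
    rw [show ENNReal.ofReal 4 = 4 by simp]
    refine (ENNReal.rpow_le_rpow_of_exponent_le (z := 1) (by norm_num) ?_).trans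
      (ENNReal.rpow_one 4).le
    simp only [one_div, ENNReal.toReal_inv, ENNReal.toReal_ofNat]
    norm_num
  calc _ ≤ _ := h1
    _ ≤ ENNReal.ofReal (5 / 4) * (ENNReal.ofReal 4 * meanCurvatureNorm 2 (vec T.F)) := by
      gcongr
      exact h2.trans (mul_le_mul_left h3 _)
    _ = _ := by
      rw [← mul_assoc, ← ENNReal.ofReal_mul (by norm_num)]
      norm_num

end ConformalTorus
end CliffordTorus
end

noncomputable section
namespace CliffordTorus
open MeasureTheory

/-! ### Closeness to the Clifford torus -/

namespace ConformalTorus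

variable (T : ConformalTorus)

lemma abs_D_cliff_le (i : Fin 2) (k : Fin 4) (p : ℝ × ℝ) : |(D (std i) (cliff k)).1 p| ≤ 1 := by
  have r : |rt| ≤ 1 := by
    rw [← sq_le_one_iff_abs_le_one, rt_sq]; norm_num
  have r2 : ∀ x : ℝ, |x| ≤ 1 → |rt| * |x| ≤ 1 := fun x hx => mul_le_one₀ r (abs_nonneg _) hx
  fin_cases i <;> fin_cases k <;>
    simp [cliff, D_cos₁, D_cos₂, D_sin₁, D_sin₂, abs_mul] <;>
    exact r2 _ (by first | exact Real.abs_cos_le_one _ | exact Real.abs_sin_le_one _)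

lemma tint_D_h_sq_le (i : Fin 2) (k : Fin 4) : tint (D (std i) (T.h k) ^ 2) ≤ T.sobSq := by
  refine le_trans ?_ (T.sob_le_sobSq k)
  unfold sob
  linarith [tint_D_sq_le i (T.h k), tint_sq_nonneg (T.h k), tint_bi_nonneg 2 (T.h k)]

/-- The conformal structure is read from the averaged metric, which W^{2,2} closeness controls
although pointwise derivatives are not controlled. -/
lemma abs_tint_metric_sub_le {ε : ℝ} (h0 : 0 < ε) (h1 : ε ≤ 1) (hs : T.sobSq ≤ ε ^ 2) (i j : Fin 2) :
    |tint (∑ k, D (std i) (T.F k) * D (std j) (T.F k))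
      - tint (∑ k, D (std i) (cliff k) * D (std j) (cliff k))| ≤ 200 * ε := by
  have e : tint (∑ k, D (std i) (T.F k) * D (std j) (T.F k))
      - tint (∑ k, D (std i) (cliff k) * D (std j) (cliff k)) =
      ∑ k, tint (D (std i) (cliff k) * D (std j) (T.h k) + D (std i) (T.h k) * D (std j) (cliff k)
        + D (std i) (T.h k) * D (std j) (T.h k)) := by
    rw [← map_sum, ← map_sub]
    congr 1
    rw [← Finset.sum_sub_distrib]
    refine Finset.sum_congr rfl fun k _ => ?_
    rw [F_eq, map_add, map_add]; ring
  have hk : ∀ k, |tint (D (std i) (cliff k) * D (std j) (T.h k)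
      + D (std i) (T.h k) * D (std j) (cliff k) + D (std i) (T.h k) * D (std j) (T.h k))| ≤
      50 * ε := fun k => by
    have hle : ∀ p, |(D (std i) (cliff k) * D (std j) (T.h k)
        + D (std i) (T.h k) * D (std j) (cliff k) + D (std i) (T.h k) * D (std j) (T.h k)).1 p| ≤
        (ε • (1 : TF) + (1 / 2 * (ε⁻¹ + 1)) • (D (std i) (T.h k) ^ 2 + D (std j) (T.h k) ^ 2)).1 p :=
      fun p => by
      simp only [add_val, mul_val, smul_val, one_val, pow_val]
      have y : ∀ x v : ℝ, |x| ≤ 1 → |x * v| ≤ 1 / 2 * ε + 1 / 2 * ε⁻¹ * v ^ 2 := fun x v hx => by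
        rw [abs_mul]
        have e2 : 1 / 2 * ε + 1 / 2 * ε⁻¹ * v ^ 2 - |v| = 1 / 2 * ε⁻¹ * (ε - |v|) ^ 2 := by
          rw [← sq_abs v]; field_simp; ring
        have e3 : 0 ≤ 1 / 2 * ε⁻¹ * (ε - |v|) ^ 2 := by positivity
        nlinarith [abs_nonneg v, mul_le_of_le_one_left (abs_nonneg v) hx]
      have y1 := y _ ((D (std j) (T.h k)).1 p) (abs_D_cliff_le i k p)
      have y2 := y _ ((D (std i) (T.h k)).1 p) (abs_D_cliff_le j k p)
      rw [mul_comm] at y2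
      have y3 : |(D (std i) (T.h k)).1 p * (D (std j) (T.h k)).1 p| ≤
          1 / 2 * ((D (std i) (T.h k)).1 p ^ 2 + (D (std j) (T.h k)).1 p ^ 2) := by
        rw [abs_le]
        constructor <;> nlinarith [sq_nonneg ((D (std i) (T.h k)).1 p + (D (std j) (T.h k)).1 p),
          sq_nonneg ((D (std i) (T.h k)).1 p - (D (std j) (T.h k)).1 p)]
      refine (abs_add_three _ _ _).trans ?_
      linarith
    refine (tint_abs_le hle).trans ?_
    rw [map_add, map_smul, map_smul, map_add, smul_eq_mul, smul_eq_mul]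
    have s1 := (T.tint_D_h_sq_le i k).trans hs
    have s2 := (T.tint_D_h_sq_le j k).trans hs
    have s3 := mul_le_mul_of_nonneg_left (add_le_add s1 s2)
      (by positivity : 0 ≤ 1 / 2 * (ε⁻¹ + 1))
    have s4 : 1 / 2 * (ε⁻¹ + 1) * (ε ^ 2 + ε ^ 2) = ε + ε ^ 2 := by
      linear_combination ε * inv_mul_cancel₀ h0.ne'
    nlinarith [tint_one_mem.2]
  rw [e]
  refine (Finset.abs_sum_le_sum_abs _ _).trans ((Finset.sum_le_sum fun k _ => hk k).trans ?_)
  simp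
  linarith

lemma tint_metric_cliff : tint (∑ k, D (std 0) (cliff k) * D (std 0) (cliff k)) = 1 / 2 * tint 1 ∧
    tint (∑ k, D (std 0) (cliff k) * D (std 1) (cliff k)) = 0 ∧
    tint (∑ k, D (std 1) (cliff k) * D (std 1) (cliff k)) = 1 / 2 * tint 1 := by
  have r := rt_sq
  refine ⟨?_, ?_, ?_⟩
  · rw [mul_tint]
    congr 1
    refine ext_val fun p => ?_
    simp [Fin.sum_univ_four, cliff, D_cos₁, D_cos₂, D_sin₁, D_sin₂]
    linear_combination r + rt ^ 2 * cos₁_sq p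
  · rw [← map_zero tint]
    congr 1
    exact ext_val fun p => by simp [Fin.sum_univ_four, cliff, D_cos₁, D_cos₂, D_sin₁, D_sin₂]
  · rw [mul_tint]
    congr 1
    refine ext_val fun p => ?_
    simp [Fin.sum_univ_four, cliff, D_cos₁, D_cos₂, D_sin₁, D_sin₂]
    linear_combination r + rt ^ 2 * cos₂_sq p

lemma near_of_small {ε : ℝ} (h0 : 0 < ε) (h1 : ε ≤ 1 / 1000) (hz : ∀ p, |T.z.1 p| ≤ 4 * ε)
    (hs : T.sobSq ≤ ε ^ 2) : T.Near (10 * ε) := by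
  obtain ⟨m0, m1, m2⟩ := tint_metric_cliff
  have g0 := T.abs_tint_metric_sub_le h0 (by linarith) hs 0 0
  have g1 := T.abs_tint_metric_sub_le h0 (by linarith) hs 0 1
  have g2 := T.abs_tint_metric_sub_le h0 (by linarith) hs 1 1
  have e0 := T.metric₁₁
  have e2 := T.metric₂₂
  simp only [pow_two] at e0 e2
  rw [m0, e0, map_smul, smul_eq_mul] at g0
  rw [m1, T.metric₁₂, map_smul, smul_eq_mul, sub_zero] at g1
  rw [m2, e2, map_smul, smul_eq_mul] at g2
  have hw : tint T.w = tint 1 + tint T.z := by rw [w_eq, map_add]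
  have hzt : |tint T.z| ≤ 160 * ε := by
    have := tint_abs_le (f := T.z) (g := (4 * ε) • 1) fun p => by simpa using hz p
    rw [map_smul, smul_eq_mul] at this
    nlinarith [tint_one_mem.2]
  obtain ⟨z1, z2⟩ := abs_le.1 hzt
  obtain ⟨o1, o2⟩ := tint_one_mem
  -- Removing r∫z, at most 160ε, from the 200ε discrepancy leaves |r − 1/2| ∫1 ≤ 360ε, and the total
  -- mass is at least 39.
  have diag : ∀ r : ℝ, 0 < r → |r * tint T.w - 1 / 2 * tint 1| ≤ 200 * ε → |r - 1 / 2| ≤ 10 * ε := by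
    intro r hr h
    obtain ⟨h2, h3⟩ := abs_le.1 h
    have r1 : r ≤ 1 := by
      by_contra! hlt
      nlinarith
    rw [hw] at h2 h3
    rw [abs_le]
    constructor <;> nlinarith
  refine ⟨by linarith, fun p => (hz p).trans (by linarith), diag _ T.a_pos g0, ?_, diag _ T.c_pos g2,
    hs.trans (by nlinarith)⟩
  rw [abs_mul, hw, abs_of_pos (by linarith : 0 < tint 1 + tint T.z)] at g1
  nlinarith [abs_nonneg T.b]

/-! ### Sobolev norms in components -/

lemma sobSq_eq : T.sobSq = ∑ k, tint (T.h k ^ 2)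
    + (∑ k, tint (D (std 1) (T.h k) ^ 2) + ∑ k, tint (D (std 0) (T.h k) ^ 2))
    + (∑ k, tint (D (std 1) (D (std 1) (T.h k)) ^ 2)
      + 2 * ∑ k, tint (D (std 0) (D (std 1) (T.h k)) ^ 2)
      + ∑ k, tint (D (std 0) (D (std 0) (T.h k)) ^ 2)) := by
  simp only [sobSq, sob, bi_one, bi_two, map_add, two_mul, Finset.sum_add_distrib]
  ring

lemma sobolevNorm_h : sobolevNorm 2 2 (vec T.h) = ENNReal.ofReal (√(∑ k, tint (T.h k ^ 2)))
    + (ENNReal.ofReal (√(∑ k, tint (D (std 1) (T.h k) ^ 2)))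
      + ENNReal.ofReal (√(∑ k, tint (D (std 0) (T.h k) ^ 2))))
    + (ENNReal.ofReal (√(∑ k, tint (D (std 1) (D (std 1) (T.h k)) ^ 2)))
      + ENNReal.ofReal (√(∑ k, tint (D (std 0) (D (std 1) (T.h k)) ^ 2)))
      + ENNReal.ofReal (√(∑ k, tint (D (std 0) (D (std 0) (T.h k)) ^ 2)))) := by
  rw [sobolevNorm_two_eq]
  simp only [pderiv_vec, eLpNorm_vec]

lemma sum_tint_sq_nonneg (g : Fin 4 → TF) : 0 ≤ ∑ k, tint (g k ^ 2) :=
  Finset.sum_nonneg fun _ _ => tint_sq_nonneg _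

lemma sobolevNorm_h_le : sobolevNorm 2 2 (vec T.h) ≤ ENNReal.ofReal (6 * √T.sobSq) := by
  have e := T.sobSq_eq
  have n0 := sum_tint_sq_nonneg T.h
  have n1 := sum_tint_sq_nonneg fun k => D (std 1) (T.h k)
  have n2 := sum_tint_sq_nonneg fun k => D (std 0) (T.h k)
  have n3 := sum_tint_sq_nonneg fun k => D (std 1) (D (std 1) (T.h k))
  have n4 := sum_tint_sq_nonneg fun k => D (std 0) (D (std 1) (T.h k))
  have n5 := sum_tint_sq_nonneg fun k => D (std 0) (D (std 0) (T.h k))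
  have b : ∀ x, x ≤ T.sobSq → ENNReal.ofReal (√x) ≤ ENNReal.ofReal (√T.sobSq) := fun x hx =>
    ENNReal.ofReal_le_ofReal (Real.sqrt_le_sqrt hx)
  rw [sobolevNorm_h, ENNReal.ofReal_mul (by norm_num)]
  refine (add_le_add (add_le_add (b _ ?_) (add_le_add (b _ ?_) (b _ ?_)))
    (add_le_add (add_le_add (b _ ?_) (b _ ?_)) (b _ ?_))).trans (le_of_eq ?_)
  any_goals linarith
  rw [show ENNReal.ofReal 6 = 6 by simp]
  ring

/-- Six norms enter the sum, but the mixed second derivative counts twice in the squared norm,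
whence 7. -/
lemma sobSq_le_of_sobolevNorm_le {r : ℝ} (hr : 0 ≤ r)
    (h : sobolevNorm 2 2 (vec T.h) ≤ ENNReal.ofReal r) : T.sobSq ≤ 7 * r ^ 2 := by
  have b : ∀ x, 0 ≤ x → ENNReal.ofReal (√x) ≤ sobolevNorm 2 2 (vec T.h) → x ≤ r ^ 2 := fun x h0 hx =>
    Real.sqrt_le_left hr |>.1 ((ENNReal.ofReal_le_ofReal_iff hr).1 (hx.trans h))
  rw [sobolevNorm_h] at b
  have n0 := b _ (sum_tint_sq_nonneg T.h) (le_self_add.trans le_self_add)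
  have n1 := b _ (sum_tint_sq_nonneg fun k => D (std 1) (T.h k))
    ((le_self_add.trans le_add_self).trans le_self_add)
  have n2 := b _ (sum_tint_sq_nonneg fun k => D (std 0) (T.h k))
    ((le_add_self.trans le_add_self).trans le_self_add)
  have n3 := b _ (sum_tint_sq_nonneg fun k => D (std 1) (D (std 1) (T.h k)))
    ((le_self_add.trans le_self_add).trans le_add_self)
  have n4 := b _ (sum_tint_sq_nonneg fun k => D (std 0) (D (std 1) (T.h k)))
    ((le_add_self.trans le_self_add).trans le_add_self)
  have n5 := b _ (sum_tint_sq_nonneg fun k => D (std 0) (D (std 0) (T.h k)))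
    (le_add_self.trans le_add_self)
  rw [sobSq_eq]
  linarith

/-! ### The final estimates -/

/-- The size of the deviation from the Clifford torus. -/
def size : ℝ := √(T.sobSq + tint (T.z ^ 2))

lemma size_nonneg : 0 ≤ T.size := Real.sqrt_nonneg _

lemma size_sq : T.size ^ 2 = T.sobSq + tint (T.z ^ 2) :=
  Real.sq_sqrt (add_nonneg T.sobSq_nonneg (tint_sq_nonneg _))

variable {T} {δ : ℝ}

lemma Near.size_le (hT : T.Near δ) (hδ : δ ≤ 1 / 100) : T.size ≤ 1 / 2 := by
  refine (Real.sqrt_le_left (by norm_num)).2 ?_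
  have := hT.nonneg
  nlinarith [hT.sob_le, hT.tint_z_sq_le]

/-- `Small` demands y > 0 in order to divide by y, while the size may vanish; apply the bound
slightly above the size and let the excess tend to zero. -/
lemma le_size_of_forall_small (hs : T.size ≤ 1 / 2) {A K : ℝ} (hK : 0 ≤ K)
    (h : ∀ y, T.Small y → A ≤ K * y) : A ≤ K * T.size := by
  refine le_of_forall_small hK fun x hx hx1 => ?_
  have h0 := T.size_nonneg
  have h2 : T.size ^ 2 ≤ (T.size + x / 2) ^ 2 := by nlinarith
  rw [size_sq] at h2
  have h3 := h (T.size + x / 2) ⟨by linarith, by linarith,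
    by linarith [tint_sq_nonneg T.z], by linarith [T.sobSq_nonneg]⟩
  nlinarith

lemma Near.conformal_factor_le (hT : T.Near δ) (hδ : δ ≤ 1 / 100) {U : TF}
    (hU : ∀ p, T.w.1 p = Real.exp (2 * U.1 p)) :
    eLpNorm U.1 ∞ flatMeasure + sobolevNorm 1 2 U.1 + sobolevNorm 2 1 U.1 ≤
      ENNReal.ofReal (10 ^ 9 * T.size) := by
  have hs := hT.size_le hδ
  have s0 := T.size_nonneg
  have h1 : ∀ p, ‖U.1 p‖ ≤ 10 ^ 8 * T.size := fun p => by
    refine le_size_of_forall_small hs (by norm_num) fun y hy => ?_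
    exact (hT.abs_u_le hU p).trans (hT.abs_z_le hy p)
  have h2 : √(tint (U ^ 2)) ≤ T.size := Real.sqrt_le_sqrt
    ((tint_sq_mono (hT.abs_u_le hU)).trans (le_add_of_nonneg_left T.sobSq_nonneg))
  have h3 : ∀ i, √(tint (D (std i) U ^ 2)) ≤ 100 * T.size := fun i => by
    refine le_size_of_forall_small hs (by norm_num) fun y hy => ?_
    refine (Real.sqrt_le_left (by linarith [hy.pos])).2 ?_
    refine (tint_sq_mono (hT.abs_D_u_le hU i)).trans ((hT.tint_D_z hy i).trans (le_of_eq ?_))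
    ring
  have h4 : l1 U ≤ 21 * T.size :=
    le_size_of_forall_small hs (by norm_num) fun y hy => (l1_mono (hT.abs_u_le hU)).trans hy.l1_z
  have h5 : ∀ i, l1 (D (std i) U) ≤ 10 ^ 4 * T.size := fun i => by
    refine le_size_of_forall_small hs (by norm_num) fun y hy => ?_
    refine (l1_mono (hT.abs_D_u_le hU i)).trans ?_
    linarith [l1_le_of_tint_sq_le hy.pos (hT.tint_D_z hy i), hy.pos]
  have h6 : ∀ i j, l1 (D (std i) (D (std j) U)) ≤ 2 * 10 ^ 7 * T.size := fun i j => by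
    refine le_size_of_forall_small hs (by norm_num) fun y hy => ?_
    have hy2 : y ^ 2 ≤ y := by nlinarith [hy.pos, hy.le_one]
    linarith [hT.l1_D_D_u hU i j, hT.l1_D_D_z hy i j, hT.tint_D_z hy i, hT.tint_D_z hy j, hy.pos]
  have e1 : eLpNorm U.1 ∞ flatMeasure ≤ ENNReal.ofReal (10 ^ 8 * T.size) := by
    rw [eLpNorm_exponent_top]
    exact eLpNormEssSup_le_of_ae_bound (Filter.Eventually.of_forall h1)
  rw [sobolevNorm_one_eq, sobolevNorm_two_eq]
  simp only [pderiv_val, eLpNorm_two_val, eLpNorm_one_val]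
  have of := fun {x y : ℝ} (h : x ≤ y) => ENNReal.ofReal_le_ofReal h
  refine (add_le_add (add_le_add e1 (add_le_add (of h2) (add_le_add (of (h3 1)) (of (h3 0)))))
    (add_le_add (add_le_add (of h4) (add_le_add (of (h5 1)) (of (h5 0))))
      (add_le_add (add_le_add (of (h6 1 1)) (of (h6 0 1))) (of (h6 0 0))))).trans ?_
  repeat rw [← ENNReal.ofReal_add (by positivity) (by positivity)]
  exact of (by linarith)

lemma Near.abs_area_sub_le (hT : T.Near δ) :
    |area (vec T.F) - 2 * Real.pi ^ 2| ≤ 4 * √(tint (T.z ^ 2)) := by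
  have h1 : tint 1 = 4 * Real.pi ^ 2 := by
    have := tint_algebraMap 1
    rwa [map_one, mul_one] at this
  have h2 : area (vec T.F) - 2 * Real.pi ^ 2 = tint T.z / 2 := by
    rw [hT.area_eq, w_eq, map_add, h1]; ring
  rw [h2]
  refine abs_le_of_sq_le_sq ?_ (by positivity)
  rw [mul_pow, Real.sq_sqrt (tint_sq_nonneg _)]
  linarith [sq_tint_le T.z, tint_sq_nonneg T.z]

lemma Near.deviation_le (hT : T.Near δ) {q : ℝ} (hq : 0 ≤ q) (h1 : T.sobSq + T.conf ≤ q ^ 2)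
    (h2 : tint (T.z ^ 2) ≤ q ^ 2) :
    sobolevNorm 2 2 (vec T.h) + ENNReal.ofReal (|T.b| + |T.a - 1 / 2| + |T.c - 1 / 2|
      + |area (vec T.F) - 2 * Real.pi ^ 2|) ≤ ENNReal.ofReal (13 * q) := by
  have c0 := T.conf_nonneg
  have s0 := T.sobSq_nonneg
  have ha : |T.a - 1 / 2| ≤ q := abs_le_of_sq_le_sq (by
    unfold conf at h1; nlinarith [sq_nonneg T.b, sq_nonneg (T.c - 1 / 2)]) hq
  have hb : |T.b| ≤ q := abs_le_of_sq_le_sq (by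
    unfold conf at h1; nlinarith [sq_nonneg (T.a - 1 / 2), sq_nonneg (T.c - 1 / 2)]) hq
  have hc : |T.c - 1 / 2| ≤ q := abs_le_of_sq_le_sq (by
    unfold conf at h1; nlinarith [sq_nonneg T.b, sq_nonneg (T.a - 1 / 2)]) hq
  have hz : √(tint (T.z ^ 2)) ≤ q := (Real.sqrt_le_left hq).2 h2
  have hs : √T.sobSq ≤ q := (Real.sqrt_le_left hq).2 (by linarith)
  refine (add_le_add_left T.sobolevNorm_h_le _).trans ?_
  rw [← ENNReal.ofReal_add (by positivity) (by positivity)]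
  -- The factor 13 is 6 for the Sobolev norm, 3 for a, b, c and 4 for the area.
  exact ENNReal.ofReal_le_ofReal (by linarith [hT.abs_area_sub_le])

lemma vec_F_sub_clifford (T : ConformalTorus) : vec T.F - clifford = vec T.h := by
  rw [← vec_cliff]
  funext p
  ext k
  simp [h]

/-- The estimates for a normalized conformal torus close to the Clifford torus. -/
theorem estimates (T : ConformalTorus) {U : TF} (hw : ∀ p, T.w.1 p = Real.exp (2 * U.1 p))
    (hsmall : sobolevNorm 2 2 (vec T.F - clifford) + eLpNorm U.1 ∞ flatMeasure ≤
      ENNReal.ofReal (1 / 10 ^ 8)) :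
    sobolevNorm 2 2 (vec T.F - clifford) + ENNReal.ofReal (|T.b| + |T.a - 1 / 2| + |T.c - 1 / 2|
        + |area (vec T.F) - 2 * Real.pi ^ 2|) ≤
      ENNReal.ofReal (10 ^ 20) * meanCurvatureNorm 2 (vec T.F) ∧
    eLpNorm U.1 ∞ flatMeasure + sobolevNorm 1 2 U.1 + sobolevNorm 2 1 U.1 ≤
      ENNReal.ofReal (10 ^ 20) * meanCurvatureNorm 2 (vec T.F) := by
  rw [vec_F_sub_clifford] at hsmall ⊢
  have hs : T.sobSq ≤ (1 / 10 ^ 7) ^ 2 :=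
    (T.sobSq_le_of_sobolevNorm_le (by norm_num) (le_self_add.trans hsmall)).trans
      (by norm_num)
  have hUb : ∀ p, |U.1 p| ≤ 1 / 10 ^ 8 :=
    abs_le_of_eLpNorm_top_le (by norm_num) (le_add_self.trans hsmall)
  have hz : ∀ p, |T.z.1 p| ≤ 4 * (1 / 10 ^ 7) := fun p => by
    have h1 : |2 * U.1 p| ≤ 2 * (1 / 10 ^ 8) := by
      rw [abs_mul, abs_two]; linarith [hUb p]
    have h2 := Real.abs_exp_sub_one_le (h1.trans (by norm_num))
    rw [← hw] at h2
    exact h2.trans (by linarith)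
  -- This gives closeness δ = 10 · 10⁻⁷, for which 10¹²δ² = 1 just meets the absorption condition.
  have hT := T.near_of_small (by norm_num) (by norm_num) hz hs
  obtain ⟨h1, h2⟩ := hT.le_curv (by norm_num)
  have hc := T.curv_nonneg
  -- The square of 10⁵√curv dominates the sum of the two bounds 10⁹ · curv from `Near.le_curv`.
  have hq : (10 ^ 5 * √T.curv) ^ 2 = 10 ^ 10 * T.curv := by
    rw [mul_pow, Real.sq_sqrt hc]; norm_num
  have key : ∀ r : ℝ, 0 ≤ r → r ≤ 10 ^ 14 → ENNReal.ofReal (r * (10 ^ 5 * √T.curv)) ≤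
      ENNReal.ofReal (10 ^ 20) * meanCurvatureNorm 2 (vec T.F) := fun r hr hr2 => by
    rw [← mul_assoc, ENNReal.ofReal_mul (by positivity)]
    refine (mul_le_mul_right hT.sqrt_curv_le _).trans ?_
    rw [← mul_assoc, ← ENNReal.ofReal_mul (by positivity)]
    gcongr
    linarith
  refine ⟨?_, ?_⟩
  · exact (hT.deviation_le (by positivity) (by rw [hq]; linarith) (by rw [hq]; linarith)).trans
      (key 13 (by norm_num) (by norm_num))
  · refine (hT.conformal_factor_le (by norm_num) hw).trans (le_trans (ENNReal.ofReal_le_ofReal ?_)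
      (key (10 ^ 9) (by norm_num) (by norm_num)))
    gcongr
    rw [ConformalTorus.size]
    refine (Real.sqrt_le_left (by positivity)).2 ?_
    rw [hq]
    linarith [T.conf_nonneg]

end ConformalTorus

lemma norm_vec_component {f : Torus → S3} (hf : ContDiff ℝ ∞ (angularE4 f)) (p : ℝ × ℝ) :
    ‖vec (component hf) p‖ = 1 := by
  rw [vec_component]
  exact mem_sphere_zero_iff_norm.1 (f (Circle.exp p.1, Circle.exp p.2)).2

end CliffordTorus
end

theorem mainTheorem2 :
    ∃ ε C : ℝ, 0 < ε ∧ 0 < C ∧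
      ∀ (f : CliffordTorus.Torus → CliffordTorus.S3) (u : CliffordTorus.Torus → ℝ) (a b c : ℝ),
        Manifold.IsImmersion ((𝓡 1).prod (𝓡 1)) (𝓡 3) ∞ f →
        a * c - b ^ 2 = 1 / 4 →
        (∀ p : ℝ × ℝ, CliffordTorus.inducedMetric (CliffordTorus.angularE4 f) p =
          Real.exp (2 * CliffordTorus.angular u p) • !![a, b; b, c]) →
        CliffordTorus.RotationNormalized (CliffordTorus.angularE4 f) →
        CliffordTorus.sobolevNorm 2 2 (CliffordTorus.angularE4 f - CliffordTorus.clifford)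
            + MeasureTheory.eLpNorm (CliffordTorus.angular u) ∞ CliffordTorus.flatMeasure
            + CliffordTorus.meanCurvatureNorm 1 (CliffordTorus.angularE4 f)
          ≤ ENNReal.ofReal ε →
        ContDiff ℝ ∞ (CliffordTorus.angular u) ∧
        CliffordTorus.sobolevNorm 2 2 (CliffordTorus.angularE4 f - CliffordTorus.clifford)
            + ENNReal.ofReal (|b| + |a - 1 / 2| + |c - 1 / 2|
              + |CliffordTorus.area (CliffordTorus.angularE4 f) - 2 * Real.pi ^ 2|)
          ≤ ENNReal.ofReal C * CliffordTorus.meanCurvatureNorm 2 (CliffordTorus.angularE4 f) ∧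
        MeasureTheory.eLpNorm (CliffordTorus.angular u) ∞ CliffordTorus.flatMeasure
            + CliffordTorus.sobolevNorm 1 2 (CliffordTorus.angular u)
            + CliffordTorus.sobolevNorm 2 1 (CliffordTorus.angular u)
          ≤ ENNReal.ofReal C
            * CliffordTorus.meanCurvatureNorm 2 (CliffordTorus.angularE4 f) := by
  open CliffordTorus in
  refine ⟨1 / 10 ^ 8, 10 ^ 20, by norm_num, by norm_num, fun f u a b c hf hdet hg hR hsmall => ?_⟩
  have hsm := contDiff_angularE4 hf
  rw [← vec_component hsm] at hg hR hsmall ⊢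
  obtain ⟨T, U, hTF, hTa, hTb, hTc, hU, hw⟩ :=
    exists_conformalTorus (norm_vec_component hsm) hdet hg hR
  have h := T.estimates hw
  rw [hTF, hTa, hTb, hTc, hU] at h
  exact ⟨hU ▸ smooth U, h (le_self_add.trans hsmall)⟩
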